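/- **Setting.** There are $K\ge 1$ arms and a known threshold $\mu_0\in\mathbb R$. An instance $\nu=(\nu_a)_{a\in[K]}$ consists of probability distributions on $\mathbb R$ with means $\mu_a$ such that $R-\mu_a$ is 1-sub-Gaussian for $R\sim\nu_a$; all sampled rewards are independent. Let the arms be numbered (in a way unknown to the algorithm) so that $\mu_1=\max_a\mu_a$. The instance is positive if $\mu_1>\mu_0$ and negative if $\mu_1<\mu_0$. Put $\Delta_{i,j}=|\mu_i-\mu_j|$ for $i,j\in\{0,\dots,K\}$, and $$H_1^{\mathrm{pos}}=\sum_{a=1}^K\frac{2}{\max\{\Delta_{0,a}^2,\Delta_{1,a}^2\}},\qquad H_1^{\mathrm{neg}}=\sum_{a=1}^K\frac{2}{\Delta_{0,a}^2}.$$ **Algorithm SEE** (inputs $K,\mu_0$, a confidence level $\delta\in(0,1)$ and a parameter $C>1$). Let $\delta_k=3^{-k}$, $\alpha_k=5^k$, $\beta_k=2^k$, $T_k^{ee}=1000(C+1)^2K\beta_k\log(4K/\delta_k)$, $T_k^{et}=1000\beta_k\log(4\alpha_kK/\delta)$, and for $t\ge1$, with $m=\max\{\lceil\log_2t\rceil,1\}$,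 $$U(t,\delta')=\frac1t\sqrt{2\cdot2^{m}\log\frac{2m^2}{\delta'}}.$$ The algorithm keeps an exploration history, an exploitation history and a container $Q$ of exploration rewards, all initially empty. In phases $k=1,2,\dots$ it does the following. *Exploration.* For an arm $a$ with $N_a\geq 1$ rewards in the exploration history and empirical mean $\hat\mu_a$, let $\mathrm{UCB}_a=\hat\mu_a+U(N_a,\delta_k/K)$ and $\mathrm{LCB}_a=\hat\mu_a-C\,U(N_a,\delta_k/K)$; if $N_a=0$, then $\mathrm{UCB}_a=+\infty$ and $\mathrm{LCB}_a=-\infty$. Repeat: choose an arm $A$ maximising $\mathrm{UCB}$ (ties are broken by an arbitrary fixed rule that picks one of the maximisers); move the reward of $A$ from $Q$ to the history if $Q$ contains one, otherwise sample a new reward of $A$ into the history. Let $t$ be the total number of rewards in the history and in $Q$. If $t\ge T_k^{ee}$, end with "not complete". Otherwise, if $\mathrm{UCB}_a\le\mu_0$ for all $a$, end with $\hat a_k=\mathsf{None}$. Otherwise, if $\mathrm{LCB}_A>\mu_0$, move the last reward of $A$ from the history to $Q$ and end with $\hat a_k=A$. *Decision.* If $\hat a_k=\mathsf{None}$ and $\delta_k<\delta/3$,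 stop with answer $\mathsf{None}$. If $\hat a_k=a\in[K]$, carry out an exploitation period: while the number $n$ of rewards of $a$ in the exploitation history is at most $T_k^{et}$, sample a new reward of $a$ into it, increase $n$ by one, and stop with answer $a$ if the empirical mean of the exploitation rewards of $a$ minus $U(n,\delta/(K\alpha_k))$ exceeds $\mu_0$. If the algorithm has not stopped, go to the next phase. Let $\tau\in\mathbb N\cup\{\infty\}$ be the number of sampled rewards when SEE stops ($\tau=\infty$ if it never stops), and $\hat a$ its answer. **Theorem.** Let $C>1$. 1. There is a constant $\gamma>0$ that depends only on $C$ such that for all $K\ge1$, $\mu_0$, $\delta\in(0,1)$ and all instances $\nu$ with $\Delta_{0,a}\le1$ for all $a\in[K]$ (in particular, if $\mu_0,\dots,\mu_K\in[0,1]$): - if $\nu$ is positive and ($K\ge2$ or $\delta\le\frac12$), then $$\mathbb E_\nu\tau\le\gamma\Big(\frac{\log(1/\delta)}{\Delta_{0,1}^2}+\log\Big(\frac K{\Delta_{0,1}^2}\Big)H_1^{\mathrm{pos}}\Big);$$ - if $\nu$ is negative, then $$\mathbb E_\nu\tau\le\gamma\,H_1^{\mathrm{neg}}\big(\log(1/\delta)+\log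 H_1^{\mathrm{neg}}\big).$$ 2. SEE is $(\Delta,\delta)$-PAC for all $K\ge1$ and $\mu_0$. That is, for every $\delta\in(0,1)$ and every positive or negative instance $\nu$ (with no bound on the gaps), with probability greater than $1-\delta$ we have $\tau<\infty$ and $\hat a$ is correct, i.e. $\mu_{\hat a}\ge\mu_0$ if $\nu$ is positive and $\hat a=\mathsf{None}$ if $\nu$ is negative; and for all $\Delta>0$ and $\delta\in(0,1)$ the supremum of $\mathbb E_\nu\tau$ over all instances $\nu$ with $K$ arms and $|\mu_1-\mu_0|\ge\Delta$ is finite. -/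

import Mathlib

open MeasureTheory ProbabilityTheory
open scoped ENNReal

namespace OneIdent

/-! ### Instances of 1-identification -/

/-- A bandit instance with `K` arms: reward distributions whose centred versions are
1-sub-Gaussian. The arms are in no particular order. -/
structure Instance (K : ℕ) where
  law : Fin K → Measure ℝ
  prob : ∀ a, IsProbabilityMeasure (law a)
  subGaussian : ∀ a, HasSubgaussianMGF (fun r => r - ∫ x, x ∂(law a)) 1 (law a)

variable {K : ℕ}

/-- The mean reward `μ_a`. -/
noncomputable def Instance.mean (I : Instance K) (a : Fin K) : ℝ := ∫ x, x ∂(I.law a)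

/-- The largest mean reward; it is `μ_1` when the arms are listed by decreasing mean. -/
noncomputable def Instance.best (I : Instance K) : ℝ := ⨆ a, I.mean a

/-- Positive instances for the threshold `μ₀`. -/
def posSet (K : ℕ) (μ₀ : ℝ) : Set (Instance K) := {I | μ₀ < I.best}

/-- Negative instances for the threshold `μ₀`. -/
def negSet (K : ℕ) (μ₀ : ℝ) : Set (Instance K) := {I | I.best < μ₀}

/-- Positive instances with gap at least `Δ`. -/
def posGapSet (K : ℕ) (μ₀ Δ : ℝ) : Set (Instance K) := {I | Δ ≤ I.best - μ₀}

/-- Negative instances with gap at least `Δ`. -/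
def negGapSet (K : ℕ) (μ₀ Δ : ℝ) : Set (Instance K) := {I | Δ ≤ μ₀ - I.best}

/-- `Δ_{0,a}`, the distance from `μ_a` to the threshold. -/
noncomputable def Instance.gapZero (I : Instance K) (μ₀ : ℝ) (a : Fin K) : ℝ := |μ₀ - I.mean a|

/-- `Δ_{1,a}`, the distance from `μ_a` to the largest mean. -/
noncomputable def Instance.gapOne (I : Instance K) (a : Fin K) : ℝ := |I.best - I.mean a|

/-- `Δ_{0,1}`, the distance from the largest mean to the threshold. -/
noncomputable def Instance.gap (I : Instance K) (μ₀ : ℝ) : ℝ := |μ₀ - I.best|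

/-- `H_1^pos = ∑_a 2 / max (Δ_{0,a}², Δ_{1,a}²)`. -/
noncomputable def Instance.Hpos (I : Instance K) (μ₀ : ℝ) : ℝ :=
  ∑ a, 2 / max (I.gapZero μ₀ a ^ 2) (I.gapOne a ^ 2)

/-- `H_1^neg = ∑_a 2 / Δ_{0,a}²`. -/
noncomputable def Instance.Hneg (I : Instance K) (μ₀ : ℝ) : ℝ :=
  ∑ a, 2 / I.gapZero μ₀ a ^ 2

/-- The possible answers: `some a` claims that arm `a` has mean at least `μ₀`, and `none` claims
that there is no such arm. -/
abbrev Answer (K : ℕ) := Option (Fin K)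

open Classical in
/-- The set `i*(ν)` of correct answers on a positive or negative instance. -/
def Instance.correct (I : Instance K) (μ₀ : ℝ) : Set (Answer K) :=
  if I ∈ posSet K μ₀ then {o | ∃ a, o = some a ∧ μ₀ ≤ I.mean a} else {none}

/-! ### Rewards -/

/-- The two kinds of sampling periods, exploration (`ee`) and exploitation (`et`). -/
inductive Period
  | ee
  | et

/-- The rewards: `x (p, a, s)` is the `(s+1)`-st reward that is newly sampled from arm `a` in
periods of kind `p`. -/
abbrev Rewards (K : ℕ) := Period × Fin K × ℕ → ℝ

/-- All rewards are independent, and those of arm `a` have the law of arm `a`. -/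
noncomputable def Instance.rewardLaw (I : Instance K) : Measure (Rewards K) :=
  haveI := I.prob
  Measure.infinitePi fun i : Period × Fin K × ℕ => I.law i.2.1

/-- The mean of the first `n` rewards of arm `a` in periods of kind `p`. -/
noncomputable def empMean (x : Rewards K) (p : Period) (a : Fin K) (n : ℕ) : ℝ :=
  (∑ s ∈ Finset.range n, x (p, a, s)) / n

/-! ### The algorithm -/

/-- The confidence radius `U(t, δ)`, for `t ≥ 1`. -/
noncomputable def radius (t : ℕ) (δ : ℝ) : ℝ :=
  let m : ℕ := max ⌈Real.logb 2 t⌉₊ 1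
  √(2 * 2 ^ m * Real.log (2 * (m : ℝ) ^ 2 / δ)) / t

/-- The input of the algorithm besides the number of arms. The maximiser of the upper confidence
bounds is chosen by `tieBreak` among all maximisers. -/
structure Input (K : ℕ) where
  threshold : ℝ
  conf : ℝ
  C : ℝ
  dSeq : ℕ → ℝ
  aSeq : ℕ → ℝ
  bSeq : ℕ → ℝ
  tieBreak : Finset (Fin K) → Fin K

/-- `T_k^ee = 1000 (C+1)² K β_k log (4 K / δ_k)`. -/
noncomputable def Input.Tee (P : Input K) (k : ℕ) : ℝ :=
  1000 * (P.C + 1) ^ 2 * K * P.bSeq k * Real.log (4 * K / P.dSeq k)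

/-- `T_k^et = 1000 β_k log (4 α_k K / δ)`. -/
noncomputable def Input.Tet (P : Input K) (k : ℕ) : ℝ :=
  1000 * P.bSeq k * Real.log (4 * P.aSeq k * K / P.conf)

/-- What the algorithm is doing. -/
inductive Mode (K : ℕ)
  | explore
  | exploit (a : Fin K)
  | halted (o : Answer K)

/-- The state of the algorithm. The history of the exploration periods consists, for each arm `a`,
of its first `nee a` exploration rewards; that of the exploitation periods consists of its first
`net a` exploitation rewards. The temporary container `Q` holds one reward for each arm
`a ∈ held`, namely the exploration reward number `nee a + 1`, which was sampled and then removed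
from the history. -/
structure State (K : ℕ) where
  phase : ℕ
  mode : Mode K
  nee : Fin K → ℕ
  held : Finset (Fin K)
  net : Fin K → ℕ

/-- Number of rewards sampled in exploration periods, from history and container sizes. -/
def eeCount (nee : Fin K → ℕ) (held : Finset (Fin K)) : ℕ := ∑ a, nee a + held.card

/-- Number of rewards sampled so far in all periods. -/
def State.pulls (s : State K) : ℕ := eeCount s.nee s.held + ∑ a, s.net a

/-- Upper confidence bound of arm `a` in an exploration period with tolerance `d`; it is infinite
for an arm with empty history. -/
noncomputable def ucb (x : Rewards K) (d : ℝ) (nee : Fin K → ℕ) (a : Fin K) : EReal :=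
  if nee a = 0 then ⊤ else ((empMean x .ee a (nee a) + radius (nee a) (d / K) : ℝ) : EReal)

/-- Lower confidence bound of arm `a` in an exploration period with tolerance `d`; it is `-∞`
for an arm with empty history. -/
noncomputable def lcb (C : ℝ) (x : Rewards K) (d : ℝ) (nee : Fin K → ℕ) (a : Fin K) : EReal :=
  if nee a = 0 then ⊥ else ((empMean x .ee a (nee a) - C * radius (nee a) (d / K) : ℝ) : EReal)

open Classical in
/-- The arm with the largest upper confidence bound. -/
noncomputable def Input.selectArm (P : Input K) (x : Rewards K) (d : ℝ) (nee : Fin K → ℕ) :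
    Fin K :=
  P.tieBreak (Finset.univ.filter fun a => ∀ b, ucb x d nee b ≤ ucb x d nee a)

open Classical in
/-- One pass through the loop of the exploration period, with what the main loop does after a
break. The selected arm `A` gets one more reward into its history: the one in the container if
there is one (then the number of sampled rewards does not change), otherwise a new one. -/
noncomputable def Input.exploreStep (P : Input K) (x : Rewards K) (s : State K) : State K :=
  let d := P.dSeq s.phase
  let A := P.selectArm x d s.nee
  let nee' := Function.update s.nee A (s.nee A + 1)
  let held' := s.held.erase A
  if P.Tee s.phase ≤ eeCount nee' held' then
    -- not complete: go to the next phase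
    { s with phase := s.phase + 1, nee := nee', held := held' }
  else if ∀ a, ucb x d nee' a ≤ (P.threshold : EReal) then
    -- the exploration period returns `None`
    if d < P.conf / 3 then
      { s with mode := .halted none, nee := nee', held := held' }
    else
      { s with phase := s.phase + 1, nee := nee', held := held' }
  else if (P.threshold : EReal) < lcb P.C x d nee' A then
    -- the exploration period returns `A`, whose last reward moves to the container
    { s with mode := .exploit A, nee := s.nee, held := insert A held' }
  else
    { s with nee := nee', held := held' }

open Classical in
/-- One pass through the loop of the exploitation period for arm `a`, with what the main loop does
afterwards. -/
noncomputable def Input.exploitStep (P : Input K) (x : Rewards K) (s : State K) (a : Fin K) :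
    State K :=
  if (s.net a : ℝ) ≤ P.Tet s.phase then
    let n := s.net a + 1
    let net' := Function.update s.net a n
    if P.threshold < empMean x .et a n - radius n (P.conf / (K * P.aSeq s.phase)) then
      { s with mode := .halted (some a), net := net' }
    else
      { s with net := net' }
  else
    { s with phase := s.phase + 1, mode := .explore }

/-- One step of the algorithm; a halted state does not change. -/
noncomputable def Input.step (P : Input K) (x : Rewards K) (s : State K) : State K :=
  match s.mode with
  | .explore => P.exploreStep x s
  | .exploit a => P.exploitStep x s a
  | .halted _ => s

/-- The initial state: phase 1, nothing sampled. -/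
def initState (K : ℕ) : State K where
  phase := 1
  mode := .explore
  nee := fun _ => 0
  held := ∅
  net := fun _ => 0

/-- The state after `n` steps. -/
noncomputable def Input.run (P : Input K) (x : Rewards K) (n : ℕ) : State K :=
  (P.step x)^[n] (initState K)

/-- What an identification algorithm produces on given rewards: the number `τ` of pulls, possibly
infinite, and the answer, if there is one. -/
structure Outcome (K : ℕ) where
  time : ℕ∞
  answer : Option (Answer K)

open Classical in
/-- The outcome of the algorithm SEE. As a halted state never changes, it does not matter which
halting step is taken. -/
noncomputable def Input.outcome (P : Input K) (x : Rewards K) : Outcome K :=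
  if h : ∃ n o, (P.run x n).mode = .halted o then
    { time := ((P.run x h.choose).pulls : ℕ∞), answer := some h.choose_spec.choose }
  else
    { time := ⊤, answer := none }

/-- SEE with the default schedules `δ_k = 3^{-k}`, `α_k = 5^k`, `β_k = 2^k`. -/
noncomputable def SEE (tieBreak : Finset (Fin K) → Fin K) (μ₀ C δ : ℝ) : Rewards K → Outcome K :=
  Input.outcome
    { threshold := μ₀
      conf := δ
      C := C
      dSeq := fun k => (1 / 3) ^ k
      aSeq := fun k => 5 ^ k
      bSeq := fun k => 2 ^ k
      tieBreak := tieBreak }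

/-! ### Expected stopping time and PAC guarantees -/

/-- The stopping time and the answer are random variables. -/
def IsMeasurableAlg (alg : Rewards K → Outcome K) : Prop :=
  (∀ t, MeasurableSet {x | (alg x).time = t}) ∧ ∀ o, MeasurableSet {x | (alg x).answer = o}

/-- The expected stopping time `E_ν τ`. -/
noncomputable def expectedTime (alg : Rewards K → Outcome K) (I : Instance K) : ℝ≥0∞ :=
  ∫⁻ x, ((alg x).time : ℝ≥0∞) ∂I.rewardLaw

/-- `δ`-PAC for the threshold `μ₀`; the algorithm takes the confidence level as its argument. -/
def IsDeltaPAC (μ₀ : ℝ) (alg : ℝ → Rewards K → Outcome K) : Prop :=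
  ∀ δ : ℝ, 0 < δ → δ < 1 → ∀ I ∈ posSet K μ₀ ∪ negSet K μ₀,
    ENNReal.ofReal (1 - δ) < I.rewardLaw
      {x | (alg δ x).time < ⊤ ∧ ∃ o ∈ I.correct μ₀, (alg δ x).answer = some o}

/-- `(Δ, δ)`-PAC for the threshold `μ₀`. -/
def IsGapDeltaPAC (μ₀ : ℝ) (alg : ℝ → Rewards K → Outcome K) : Prop :=
  IsDeltaPAC μ₀ alg ∧ ∀ Δ δ : ℝ, 0 < Δ → 0 < δ → δ < 1 →
    ⨆ I ∈ posGapSet K μ₀ Δ ∪ negGapSet K μ₀ Δ, expectedTime (alg δ) I < ⊤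

end OneIdent

/-!
The proof is deterministic up to one family of events. A phase `k` is *good* if, for both kinds of
rewards and all arms, every empirical mean is within the radius of tolerance `δ_k / K` of the
mean. Doob's maximal inequality for `exp (l * S n)` on dyadic blocks
(`measure_exists_le_sum_le`, `measure_exists_radius_lt_sum_le`) shows that phase `k` is bad with
probability at most `4 * 3 ^ (-k)` (`Instance.measure_badEvent_le`).

In a good phase an arm whose radius is below a level `h a`, a constant fraction of the relevant
gap, is useless: a pull of it ends the phase. Indeed it maximises the upper confidence bounds only
if its mean is close to the best one; so either its lower bound clears the threshold, or all upper
bounds are below the threshold (`phase_ne_of_small_radius`). Hence a good phase adds to the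
exploration history of arm `a` only up to about `log (K / δ_k) / h a ^ 2` rewards, and at most one
more in total, while a bad phase adds at most its budget `T_k^ee`. From a phase `kstar` on, with
`2 ^ kstar` of the order of the inverse squared gap, a good phase has enough budget to return an
answer. If it returns an arm, then, because `C > 1`, the gap of that arm to the threshold is a
constant fraction of the gap of the best arm (`mean_of_exploit`), and exploitation succeeds. On a
negative instance it returns `none`, which ends the algorithm once also `δ_k < δ / 3`.

The structure `Accounting` collects these facts for a fixed reward sequence, and `accounting_see`
proves them for SEE. By an invariant of the states, the number of pulls is at most the cost of the
phases up to `kstar` plus that of the bad phases (`Accounting.time_le`); this includes the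
sequences on which the algorithm never stops, as these have infinitely many bad phases. The cost of
phase `k` grows like `k * 2 ^ k`, so that the expected cost of the bad phases is a convergent
series (`expectedTime_see_le`), and no independence between the phases is needed. The gap-dependent
bounds follow by a choice of the levels and of `kstar`.

For the PAC property, SEE only errs if a confidence bound behind one of its answers fails, which
has probability at most `3 / 4 * δ` (`Instance.measure_errorEvent_le`, `mem_correct_of_halted`),
and it stops almost surely since its expected stopping time is finite.
-/

namespace OneIdent

/-! ### A maximal inequality for sub-Gaussian sums -/

section Maximal

variable {Ω : Type*} [MeasurableSpace Ω] {μ : Measure Ω}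

lemma one_le_lintegral_exp_of_integral_eq_zero [IsProbabilityMeasure μ] {Y : Ω → ℝ}
    (hY : HasSubgaussianMGF Y 1 μ) (hmean : ∫ ω, Y ω ∂μ = 0) (l : ℝ) :
    1 ≤ ∫⁻ ω, ENNReal.ofReal (Real.exp (l * Y ω)) ∂μ := by
  have hint := hY.integrable_exp_mul l
  rw [← ofReal_integral_eq_lintegral_ofReal hint (ae_of_all _ fun _ => (Real.exp_pos _).le),
    ENNReal.one_le_ofReal]
  calc (1 : ℝ) = ∫ ω, (l * Y ω + 1) ∂μ := by
        rw [integral_add (hY.integrable.const_mul l) (integrable_const _), integral_const_mul,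
          hmean]
        simp
    _ ≤ ∫ ω, Real.exp (l * Y ω) ∂μ :=
        integral_mono ((hY.integrable.const_mul l).add (integrable_const _)) hint
          fun ω => Real.add_one_le_exp _

/-- The exponential of the `n`-th partial sum, cut off to the sequences of which some partial sum
up to the `n`-th has reached level `ε`. -/
noncomputable def cutExp (l ε : ℝ) (n : ℕ) (y : ℕ → ℝ) : ℝ≥0∞ :=
  {y : ℕ → ℝ | ∃ k ≤ n, ε ≤ ∑ i ∈ Finset.range k, y i}.indicator
    (fun y => ENNReal.ofReal (Real.exp (l * ∑ i ∈ Finset.range n, y i))) y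

lemma measurableSet_exists_le_sum (ε : ℝ) (n : ℕ) :
    MeasurableSet {y : ℕ → ℝ | ∃ k ≤ n, ε ≤ ∑ i ∈ Finset.range k, y i} := by
  have : {y : ℕ → ℝ | ∃ k ≤ n, ε ≤ ∑ i ∈ Finset.range k, y i} =
      ⋃ k ∈ Set.Iic n, {y : ℕ → ℝ | ε ≤ ∑ i ∈ Finset.range k, y i} := by
    ext y; simp
  rw [this]
  exact MeasurableSet.biUnion (Set.to_countable _) fun k _ =>
    measurableSet_le measurable_const (by fun_prop)

lemma measurable_cutExp (l ε : ℝ) (n : ℕ) : Measurable (cutExp l ε n) :=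
  Measurable.indicator (by fun_prop) (measurableSet_exists_le_sum ε n)

lemma cutExp_congr (l ε : ℝ) (n : ℕ) {y z : ℕ → ℝ} (h : ∀ i < n, y i = z i) :
    cutExp l ε n y = cutExp l ε n z := by
  have hs : ∀ k ≤ n, ∑ i ∈ Finset.range k, y i = ∑ i ∈ Finset.range k, z i := fun k hk =>
    Finset.sum_congr rfl fun i hi => h i ((Finset.mem_range.1 hi).trans_le hk)
  unfold cutExp
  by_cases hy : ∃ k ≤ n, ε ≤ ∑ i ∈ Finset.range k, y i
  · have hz : ∃ k ≤ n, ε ≤ ∑ i ∈ Finset.range k, z i := by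
      obtain ⟨k, hk, hk'⟩ := hy
      exact ⟨k, hk, hs k hk ▸ hk'⟩
    rw [Set.indicator_of_mem (by exact hy), Set.indicator_of_mem (by exact hz), hs n le_rfl]
  · have hz : ¬ ∃ k ≤ n, ε ≤ ∑ i ∈ Finset.range k, z i := by
      rintro ⟨k, hk, hk'⟩
      exact hy ⟨k, hk, hs k hk ▸ hk'⟩
    rw [Set.indicator_of_notMem (by exact hy), Set.indicator_of_notMem (by exact hz)]

lemma indepFun_cutExp {X : ℕ → Ω → ℝ} (hm : ∀ i, Measurable (X i)) (hX : iIndepFun X μ)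
    (l ε : ℝ) (n : ℕ) :
    IndepFun (fun ω => cutExp l ε n (fun i => X i ω)) (X n) μ := by
  have h := hX.indepFun_finset (Finset.range n) {n} (by simp) hm
  let φ : (Finset.range n → ℝ) → ℕ → ℝ := fun v i =>
    if hi : i ∈ Finset.range n then v ⟨i, hi⟩ else 0
  have hφ : Measurable φ := by
    refine measurable_pi_lambda _ fun i => ?_
    by_cases hi : i < n
    · simp only [φ, Finset.mem_range, hi, dite_true]
      exact measurable_pi_apply (X := fun _ : Finset.range n => ℝ) _
    · simp [φ, hi]
  have h2 := h.comp (φ := fun v => cutExp l ε n (φ v)) (ψ := fun v => v ⟨n, by simp⟩)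
    ((measurable_cutExp l ε n).comp hφ)
    (measurable_pi_apply (X := fun _ : ({n} : Finset ℕ) => ℝ) _)
  convert h2 using 1
  · ext ω
    exact cutExp_congr l ε n fun i hi => by simp [φ, hi]
  · rfl

variable [IsProbabilityMeasure μ]

/-- The first half of Doob's inequality for the submartingale `exp (l * S n)`, by induction on `n`:
on the event that level `ε` has been reached, one more summand does not decrease the mean. -/
lemma ofReal_exp_mul_measure_le_lintegral_cutExp {X : ℕ → Ω → ℝ} (hm : ∀ i, Measurable (X i))
    (hX : iIndepFun X μ) (hsub : ∀ i, HasSubgaussianMGF (X i) 1 μ)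
    (hmean : ∀ i, ∫ ω, X i ω ∂μ = 0) {l ε : ℝ} (hl : 0 ≤ l) (n : ℕ) :
    ENNReal.ofReal (Real.exp (l * ε)) *
        μ {ω | ∃ k ≤ n, ε ≤ ∑ i ∈ Finset.range k, X i ω} ≤
      ∫⁻ ω, cutExp l ε n (fun i => X i ω) ∂μ := by
  have hmX : Measurable fun ω => fun i => X i ω := measurable_pi_lambda _ hm
  have hE : ∀ n, MeasurableSet {ω | ∃ k ≤ n, ε ≤ ∑ i ∈ Finset.range k, X i ω} := fun n =>
    hmX (measurableSet_exists_le_sum ε n)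
  induction n with
  | zero =>
    rw [← lintegral_indicator_const (hE 0)]
    refine lintegral_mono fun ω => ?_
    by_cases h : ε ≤ 0
    · simp [cutExp, h, mul_nonpos_of_nonneg_of_nonpos hl h]
    · simp [h]
  | succ n ih =>
    set E := {ω | ∃ k ≤ n, ε ≤ ∑ i ∈ Finset.range k, X i ω} with hEdef
    set F := {ω | ε ≤ ∑ i ∈ Finset.range (n + 1), X i ω} with hFdef
    have hF : MeasurableSet F := measurableSet_le measurable_const (by fun_prop)
    have hun : {ω | ∃ k ≤ n + 1, ε ≤ ∑ i ∈ Finset.range k, X i ω} = E ∪ (F \ E) := by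
      ext ω
      simp only [hEdef, hFdef, Set.union_sdiff_self, Set.mem_union, Set.mem_ofPred_eq]
      constructor
      · rintro ⟨k, hk, h⟩
        rcases hk.lt_or_eq with hk | rfl
        · exact .inl ⟨k, by omega, h⟩
        · exact .inr h
      · rintro (⟨k, hk, h⟩ | h)
        · exact ⟨k, by omega, h⟩
        · exact ⟨_, le_rfl, h⟩
    have hprod : ∫⁻ ω, cutExp l ε n (fun i => X i ω) ∂μ ≤
        ∫⁻ ω, cutExp l ε n (fun i => X i ω) * ENNReal.ofReal (Real.exp (l * X n ω)) ∂μ := by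
      have hind : IndepFun (fun ω => cutExp l ε n (fun i => X i ω))
          (fun ω => ENNReal.ofReal (Real.exp (l * X n ω))) μ :=
        (indepFun_cutExp hm hX l ε n).comp (φ := id)
          (ψ := fun r => ENNReal.ofReal (Real.exp (l * r))) measurable_id (by fun_prop)
      have := lintegral_mul_eq_lintegral_mul_lintegral_of_indepFun
        ((measurable_cutExp l ε n).comp hmX)
        (by have := hm n; fun_prop) hind
      simp only [Pi.mul_apply, Function.comp_def] at this
      rw [this]
      exact le_mul_of_one_le_right zero_le
        (one_le_lintegral_exp_of_integral_eq_zero (hsub n) (hmean n) l)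
    calc _ ≤ ENNReal.ofReal (Real.exp (l * ε)) * μ E +
          ENNReal.ofReal (Real.exp (l * ε)) * μ (F \ E) := by
          rw [hun, ← mul_add]; gcongr; exact measure_union_le _ _
      _ ≤ ∫⁻ ω, cutExp l ε n (fun i => X i ω) * ENNReal.ofReal (Real.exp (l * X n ω)) ∂μ +
          ∫⁻ ω, (F \ E).indicator (fun _ => ENNReal.ofReal (Real.exp (l * ε))) ω ∂μ := by
          rw [lintegral_indicator_const (hF.diff (hE n))]
          gcongr
          exact ih.trans hprod
      _ = ∫⁻ ω, (cutExp l ε n (fun i => X i ω) * ENNReal.ofReal (Real.exp (l * X n ω)) +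
          (F \ E).indicator (fun _ => ENNReal.ofReal (Real.exp (l * ε))) ω) ∂μ := by
          rw [lintegral_add_right _ (measurable_const.indicator (hF.diff (hE n)))]
      _ ≤ _ := by
          refine lintegral_mono fun ω => ?_
          by_cases h1 : ω ∈ E
          · have h2 : ∃ k ≤ n + 1, ε ≤ ∑ i ∈ Finset.range k, X i ω := by
              obtain ⟨k, hk, h⟩ := h1; exact ⟨k, by omega, h⟩
            rw [Set.indicator_of_notMem (by simp [h1]), add_zero]
            unfold cutExp
            rw [Set.indicator_of_mem (by exact h1), Set.indicator_of_mem (by exact h2),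
              ← ENNReal.ofReal_mul (Real.exp_pos _).le, ← Real.exp_add, Finset.sum_range_succ,
              mul_add]
          · have h0 : cutExp l ε n (fun i => X i ω) = 0 := Set.indicator_of_notMem (by exact h1) _
            rw [h0, zero_mul, zero_add]
            by_cases h2 : ω ∈ F
            · have h3 : ∃ k ≤ n + 1, ε ≤ ∑ i ∈ Finset.range k, X i ω := ⟨_, le_rfl, h2⟩
              unfold cutExp
              rw [Set.indicator_of_mem (by exact ⟨h2, h1⟩), Set.indicator_of_mem (by exact h3)]
              exact ENNReal.ofReal_le_ofReal (Real.exp_le_exp.2 (mul_le_mul_of_nonneg_left h2 hl))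
            · rw [Set.indicator_of_notMem (by simp [h2])]
              exact zero_le

/-- Doob's maximal inequality for sums of independent centred 1-sub-Gaussian variables. -/
theorem measure_exists_le_sum_le {X : ℕ → Ω → ℝ} (hm : ∀ i, Measurable (X i))
    (hX : iIndepFun X μ) (hsub : ∀ i, HasSubgaussianMGF (X i) 1 μ)
    (hmean : ∀ i, ∫ ω, X i ω ∂μ = 0) {ε : ℝ} (hε : 0 ≤ ε) {n : ℕ} (hn : 0 < n) :
    μ {ω | ∃ k ≤ n, ε ≤ ∑ i ∈ Finset.range k, X i ω} ≤
      ENNReal.ofReal (Real.exp (-(ε ^ 2 / (2 * n)))) := by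
  set l : ℝ := ε / n with hl
  have hn' : (0 : ℝ) < n := by exact_mod_cast hn
  have hsum : HasSubgaussianMGF (fun ω => ∑ i ∈ Finset.range n, X i ω) n μ := by
    have := HasSubgaussianMGF.sum_of_iIndepFun hX (c := fun _ => 1) (s := Finset.range n)
      (fun i _ => hsub i)
    simpa using this
  have h1 := ofReal_exp_mul_measure_le_lintegral_cutExp hm hX hsub hmean (l := l) (ε := ε)
    (by positivity) n
  have h2 : ∫⁻ ω, cutExp l ε n (fun i => X i ω) ∂μ ≤
      ENNReal.ofReal (Real.exp (n * l ^ 2 / 2)) := by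
    calc ∫⁻ ω, cutExp l ε n (fun i => X i ω) ∂μ
        ≤ ∫⁻ ω, ENNReal.ofReal (Real.exp (l * ∑ i ∈ Finset.range n, X i ω)) ∂μ :=
          lintegral_mono fun ω => Set.indicator_le_self _ _ _
      _ = ENNReal.ofReal (mgf (fun ω => ∑ i ∈ Finset.range n, X i ω) μ l) :=
          (ofReal_integral_eq_lintegral_ofReal (hsum.integrable_exp_mul l)
            (ae_of_all _ fun _ => (Real.exp_pos _).le)).symm
      _ ≤ _ := ENNReal.ofReal_le_ofReal (by simpa using hsum.mgf_le l)
  have h3 : Real.exp (-(ε ^ 2 / (2 * n))) = Real.exp (-(l * ε)) * Real.exp (n * l ^ 2 / 2) := by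
    rw [← Real.exp_add, hl]; congr 1; field_simp; ring
  rw [h3, ENNReal.ofReal_mul (Real.exp_pos _).le, Real.exp_neg,
    ENNReal.ofReal_inv_of_pos (Real.exp_pos _), ← ENNReal.div_eq_inv_mul,
    ENNReal.le_div_iff_mul_le (.inl (by simp [Real.exp_pos])) (.inl (by simp)), mul_comm]
  exact h1.trans h2

end Maximal

/-! ### The confidence radius -/

/-- The exponent `m` of the dyadic block `(2 ^ (m - 1), 2 ^ m]` that contains `t`, except that
`t = 1` is put into the first block. -/
noncomputable def blockExp (t : ℕ) : ℕ := max ⌈Real.logb 2 t⌉₊ 1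

lemma radius_eq (t : ℕ) (d : ℝ) :
    radius t d = √(2 * 2 ^ blockExp t * Real.log (2 * (blockExp t : ℝ) ^ 2 / d)) / t := rfl

lemma one_le_blockExp (t : ℕ) : 1 ≤ blockExp t := le_max_right _ _

lemma radius_nonneg (t : ℕ) (d : ℝ) : 0 ≤ radius t d := by rw [radius_eq]; positivity

lemma le_two_pow_blockExp {t : ℕ} (ht : 1 ≤ t) : t ≤ 2 ^ blockExp t := by
  have h0 : (0 : ℝ) < t := by exact_mod_cast ht
  have h1 : Real.logb 2 t ≤ (blockExp t : ℝ) :=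
    (Nat.le_ceil _).trans (Nat.cast_le.2 (le_max_left _ _))
  rw [Real.logb_le_iff_le_rpow one_lt_two h0, Real.rpow_natCast] at h1
  exact_mod_cast h1

lemma two_pow_blockExp_le {t : ℕ} (ht : 1 ≤ t) : (2 : ℝ) ^ blockExp t ≤ 2 * t := by
  have h0 : (1 : ℝ) ≤ t := by exact_mod_cast ht
  rcases le_total ⌈Real.logb 2 t⌉₊ 1 with h | h
  · rw [blockExp, max_eq_right h]; linarith
  · rw [blockExp, max_eq_left h]
    have h1 : (⌈Real.logb 2 t⌉₊ : ℝ) ≤ Real.logb 2 t + 1 :=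
      (Nat.ceil_lt_add_one (Real.logb_nonneg one_lt_two h0)).le
    rw [← Real.rpow_natCast]
    calc (2 : ℝ) ^ (⌈Real.logb 2 t⌉₊ : ℝ) ≤ 2 ^ (Real.logb 2 t + 1) :=
          Real.rpow_le_rpow_of_exponent_le one_le_two h1
      _ = 2 * t := by
          rw [Real.rpow_add two_pos, Real.rpow_logb two_pos (by norm_num) (by linarith),
            Real.rpow_one, mul_comm]

lemma blockExp_mono {s t : ℕ} (hs : 1 ≤ s) (hst : s ≤ t) : blockExp s ≤ blockExp t := by
  have h0 : (0 : ℝ) < s := by exact_mod_cast hs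
  have h1 : (s : ℝ) ≤ t := by exact_mod_cast hst
  exact max_le_max (Nat.ceil_mono (Real.logb_le_logb_of_le one_lt_two h0 h1)) le_rfl

lemma sq_le_two_mul_two_pow (m : ℕ) : m ^ 2 ≤ 2 * 2 ^ m := by
  induction m with
  | zero => norm_num
  | succ n ih =>
    rcases Nat.lt_or_ge n 3 with h | h
    · interval_cases n <;> norm_num
    · rw [pow_succ 2 n]; nlinarith

lemma log_arg_nonneg (t : ℕ) {d : ℝ} (hd : 0 < d) (hd1 : d ≤ 1) :
    0 ≤ Real.log (2 * (blockExp t : ℝ) ^ 2 / d) := by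
  apply Real.log_nonneg
  have : (1 : ℝ) ≤ blockExp t := by exact_mod_cast one_le_blockExp t
  rw [le_div_iff₀ hd]
  nlinarith

lemma log_lt_div_eight {u : ℝ} (hu : 64 ≤ u) : Real.log u < u / 8 := by
  have h1 : Real.log u = Real.log (u / 64) + 6 * Real.log 2 := by
    rw [Real.log_div (by positivity) (by norm_num), show (64 : ℝ) = 2 ^ 6 by norm_num,
      Real.log_pow]
    push_cast; ring
  have h2 := Real.log_le_sub_one_of_pos (show 0 < u / 64 by positivity)
  have h3 := Real.log_two_lt_d9
  rw [h1]; linarith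

/-- The radius at `t` is at most `√(4 log (8 t / d) / t)`, whence it drops below `h` once
`h² t` is larger than a multiple of `log (1 / (d h²))`. -/
lemma radius_lt {t : ℕ} (ht : 1 ≤ t) {d h : ℝ} (hd : 0 < d) (hd1 : d ≤ 1) (hh : 0 < h)
    (h1 : 64 ≤ h ^ 2 * t) (h2 : 8 * Real.log (8 / (d * h ^ 2)) ≤ h ^ 2 * t) :
    radius t d < h := by
  have ht0 : (0 : ℝ) < t := by exact_mod_cast ht
  have hm : (1 : ℝ) ≤ blockExp t := by exact_mod_cast one_le_blockExp t
  rw [radius_eq, div_lt_iff₀ ht0, Real.sqrt_lt' (by positivity)]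
  have h3 : Real.log (2 * (blockExp t : ℝ) ^ 2 / d) ≤
      Real.log (8 / (d * h ^ 2)) + Real.log (h ^ 2 * t) := by
    rw [← Real.log_mul (by positivity) (by positivity)]
    apply Real.log_le_log (by positivity)
    have h4 : ((blockExp t : ℝ)) ^ 2 ≤ 2 * 2 ^ blockExp t := by
      exact_mod_cast sq_le_two_mul_two_pow (blockExp t)
    have h5 := two_pow_blockExp_le ht
    rw [show 8 / (d * h ^ 2) * (h ^ 2 * t) = 8 * t / d by field_simp]
    exact div_le_div_of_nonneg_right (by linarith) hd.le
  have h6 := log_lt_div_eight h1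
  calc 2 * 2 ^ blockExp t * Real.log (2 * (blockExp t : ℝ) ^ 2 / d)
      ≤ 2 * (2 * t) * Real.log (2 * (blockExp t : ℝ) ^ 2 / d) := by
        have := log_arg_nonneg t hd hd1
        gcongr
        exact two_pow_blockExp_le ht
    _ < 2 * (2 * t) * (h ^ 2 * t / 4) := by
        gcongr
        linarith
    _ = (h * t) ^ 2 := by ring

lemma radius_le_two_mul_radius_succ {t : ℕ} (ht : 1 ≤ t) {d : ℝ} (hd : 0 < d) (hd1 : d ≤ 1) :
    radius t d ≤ 2 * radius (t + 1) d := by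
  have ht0 : (1 : ℝ) ≤ t := by exact_mod_cast ht
  have hm := blockExp_mono ht (Nat.le_succ t)
  have h0 : (1 : ℝ) ≤ blockExp t := by exact_mod_cast one_le_blockExp t
  have hm' : (blockExp t : ℝ) ≤ blockExp (t + 1) := by exact_mod_cast hm
  rw [radius_eq, radius_eq, mul_div_assoc', div_le_div_iff₀ (by positivity) (by positivity)]
  have h1 : √(2 * 2 ^ blockExp t * Real.log (2 * (blockExp t : ℝ) ^ 2 / d)) ≤
      √(2 * 2 ^ blockExp (t + 1) * Real.log (2 * (blockExp (t + 1) : ℝ) ^ 2 / d)) := by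
    have := log_arg_nonneg t hd hd1
    apply Real.sqrt_le_sqrt
    gcongr
    norm_num
  push_cast
  have h2 := Real.sqrt_nonneg
    (2 * 2 ^ blockExp (t + 1) * Real.log (2 * (blockExp (t + 1) : ℝ) ^ 2 / d))
  nlinarith

lemma one_le_radius_one {d : ℝ} (hd : 0 < d) (hd1 : d ≤ 1) : 1 ≤ radius 1 d := by
  have h0 : blockExp 1 = 1 := by simp [blockExp]
  rw [radius_eq, h0, Nat.cast_one, div_one, Real.one_le_sqrt]
  have h1 : Real.log 2 ≤ Real.log (2 * 1 ^ 2 / d) := by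
    apply Real.log_le_log two_pos
    rw [le_div_iff₀ hd]; linarith
  have h2 := Real.log_two_gt_d9
  linarith

/-! ### Uniform deviation bounds -/

section Deviation

variable {Ω : Type*} [MeasurableSpace Ω] {μ : Measure Ω} [IsProbabilityMeasure μ]

/-- By the maximal inequality on the dyadic blocks, the radius gives failure probability
`d / (2 m²)` to the `m`-th block, and these sum up to less than `d`. -/
theorem measure_exists_radius_lt_sum_le {X : ℕ → Ω → ℝ} (hm : ∀ i, Measurable (X i))
    (hX : iIndepFun X μ) (hsub : ∀ i, HasSubgaussianMGF (X i) 1 μ)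
    (hmean : ∀ i, ∫ ω, X i ω ∂μ = 0) {d : ℝ} (hd : 0 < d) :
    μ {ω | ∃ n, 1 ≤ n ∧ n * radius n d < ∑ i ∈ Finset.range n, X i ω} ≤ ENNReal.ofReal d := by
  -- for `1 < d` the bound is trivial; otherwise the logarithms below are nonnegative
  rcases lt_or_ge 1 d with hd1 | hd1
  · exact prob_le_one.trans (by simpa using hd1.le)
  let ε : ℕ → ℝ := fun m => √(2 * 2 ^ m * Real.log (2 * (m : ℝ) ^ 2 / d))
  let E : ℕ → Set Ω := fun m =>
    {ω | 1 ≤ m ∧ ∃ k ≤ 2 ^ m, ε m ≤ ∑ i ∈ Finset.range k, X i ω}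
  have hsubset : {ω | ∃ n, 1 ≤ n ∧ n * radius n d < ∑ i ∈ Finset.range n, X i ω} ⊆ ⋃ m, E m := by
    rintro ω ⟨n, hn, h⟩
    refine Set.mem_iUnion.2 ⟨blockExp n, one_le_blockExp n, n, le_two_pow_blockExp hn, ?_⟩
    have hn0 : (n : ℝ) ≠ 0 := by positivity
    rw [radius_eq, mul_div_cancel₀ _ hn0] at h
    exact h.le
  have hE : ∀ m, μ (E m) ≤ ENNReal.ofReal (d / 2 * (1 / (m : ℝ) ^ 2)) := by
    intro m
    rcases Nat.eq_zero_or_pos m with rfl | hm0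
    · simp [E]
    have hm1 : (1 : ℝ) ≤ m := by exact_mod_cast hm0
    have hE' : E m = {ω | ∃ k ≤ 2 ^ m, ε m ≤ ∑ i ∈ Finset.range k, X i ω} := by
      ext ω; simp only [E, Set.mem_ofPred_eq]; exact and_iff_right hm0
    have hlog : 0 ≤ Real.log (2 * (m : ℝ) ^ 2 / d) := by
      apply Real.log_nonneg
      rw [le_div_iff₀ hd]; nlinarith
    rw [hE']
    refine (measure_exists_le_sum_le hm hX hsub hmean (Real.sqrt_nonneg _)
      (by positivity)).trans (ENNReal.ofReal_le_ofReal ?_)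
    have : (ε m) ^ 2 / (2 * ((2 ^ m : ℕ) : ℝ)) = Real.log (2 * (m : ℝ) ^ 2 / d) := by
      simp only [ε]
      rw [Real.sq_sqrt (by positivity)]
      push_cast
      field_simp
    rw [this, Real.exp_neg, Real.exp_log (by positivity)]
    apply le_of_eq
    field_simp
  have hs := hasSum_zeta_two.mul_left (d / 2)
  calc _ ≤ μ (⋃ m, E m) := measure_mono hsubset
    _ ≤ ∑' m, μ (E m) := measure_iUnion_le _
    _ ≤ ∑' m : ℕ, ENNReal.ofReal (d / 2 * (1 / (m : ℝ) ^ 2)) := ENNReal.tsum_le_tsum hE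
    _ = ENNReal.ofReal (d / 2 * (Real.pi ^ 2 / 6)) := by
        rw [← ENNReal.ofReal_tsum_of_nonneg (fun m => by positivity) hs.summable, hs.tsum_eq]
    _ ≤ ENNReal.ofReal d := by
        apply ENNReal.ofReal_le_ofReal
        have h1 := Real.pi_lt_d2
        have h2 := Real.pi_pos
        have h3 : Real.pi ^ 2 ≤ 12 := by nlinarith
        nlinarith

end Deviation

variable {K : ℕ}

/-! ### Deviations of the empirical means -/

instance (I : Instance K) : IsProbabilityMeasure I.rewardLaw := by
  have := I.prob
  unfold Instance.rewardLaw
  infer_instance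

lemma Instance.integrable_law (I : Instance K) (a : Fin K) : Integrable (fun r => r) (I.law a) := by
  have := I.prob a
  have := (I.subGaussian a).integrable.add (integrable_const (∫ x, x ∂(I.law a)))
  exact this.congr (ae_of_all _ fun r => by simp)

section Centred

variable (I : Instance K) (p : Period) (a : Fin K)

lemma Instance.measurePreserving_reward (i : Period × Fin K × ℕ) :
    MeasurePreserving (fun x : Rewards K => x i) I.rewardLaw (I.law i.2.1) := by
  have := I.prob
  exact measurePreserving_eval_infinitePi (fun i : Period × Fin K × ℕ => I.law i.2.1) i

lemma Instance.iIndepFun_centred (c : ℝ) :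
    iIndepFun (fun (s : ℕ) (x : Rewards K) => c * (x (p, a, s) - I.mean a)) I.rewardLaw := by
  have := I.prob
  have h := iIndepFun_infinitePi (P := fun i : Period × Fin K × ℕ => I.law i.2.1)
    (X := fun i r => c * (r - I.mean i.2.1)) (fun i => by fun_prop)
  exact h.precomp (g := fun s : ℕ => ((p, a, s) : Period × Fin K × ℕ)) fun s t h => by
    simpa using h

lemma Instance.subGaussian_reward (s : ℕ) :
    HasSubgaussianMGF (fun x : Rewards K => x (p, a, s) - I.mean a) 1 I.rewardLaw := by
  have h := I.measurePreserving_reward (p, a, s)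
  have h2 := I.subGaussian a
  have h3 : I.law a = I.rewardLaw.map (fun x => x (p, a, s)) := h.map_eq.symm
  exact HasSubgaussianMGF.of_map (Y := fun x : Rewards K => x (p, a, s))
    (X := fun r => r - I.mean a) h.measurable.aemeasurable (h3 ▸ h2)

lemma Instance.integral_reward_sub_mean (s : ℕ) :
    ∫ x : Rewards K, (x (p, a, s) - I.mean a) ∂I.rewardLaw = 0 := by
  have := I.prob a
  have h := I.measurePreserving_reward (p, a, s)
  have h1 : Integrable (fun x : Rewards K => x (p, a, s)) I.rewardLaw :=
    h.integrable_comp_of_integrable (I.integrable_law a)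
  have h2 : ∫ x : Rewards K, x (p, a, s) ∂I.rewardLaw = I.mean a := by
    have := integral_map (μ := I.rewardLaw) (f := fun r : ℝ => r) h.measurable.aemeasurable
      (by fun_prop)
    rw [← this, h.map_eq]
    rfl
  rw [integral_sub h1 (integrable_const _), h2]
  simp

lemma sum_sub_eq_mul_empMean_sub (x : Rewards K) {n : ℕ} (hn : 1 ≤ n) (c : ℝ) :
    ∑ s ∈ Finset.range n, (x (p, a, s) - c) = n * (empMean x p a n - c) := by
  have : (n : ℝ) ≠ 0 := by positivity
  rw [empMean, Finset.sum_sub_distrib, mul_sub, mul_div_cancel₀ _ this]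
  simp

/-- Some empirical mean of arm `a` exceeds the mean by more than the radius. -/
def Instance.upperDev (d : ℝ) : Set (Rewards K) :=
  {x | ∃ n, 1 ≤ n ∧ I.mean a + radius n d < empMean x p a n}

/-- Some empirical mean of arm `a` falls short of the mean by more than the radius. -/
def Instance.lowerDev (d : ℝ) : Set (Rewards K) :=
  {x | ∃ n, 1 ≤ n ∧ empMean x p a n + radius n d < I.mean a}

lemma Instance.measure_upperDev_le {d : ℝ} (hd : 0 < d) :
    I.rewardLaw (I.upperDev p a d) ≤ ENNReal.ofReal d := by
  have h := measure_exists_radius_lt_sum_le (μ := I.rewardLaw)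
    (X := fun s x => 1 * (x (p, a, s) - I.mean a)) (fun i => by fun_prop)
    (I.iIndepFun_centred p a 1) (fun s => by simpa using I.subGaussian_reward p a s)
    (fun s => by simpa using I.integral_reward_sub_mean p a s) hd
  refine (measure_mono ?_).trans h
  rintro x ⟨n, hn, hx⟩
  refine ⟨n, hn, ?_⟩
  have hn0 : (0 : ℝ) < n := by positivity
  simp only [one_mul]
  rw [sum_sub_eq_mul_empMean_sub p a x hn]
  gcongr
  linarith

lemma Instance.measure_lowerDev_le {d : ℝ} (hd : 0 < d) :
    I.rewardLaw (I.lowerDev p a d) ≤ ENNReal.ofReal d := by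
  have h := measure_exists_radius_lt_sum_le (μ := I.rewardLaw)
    (X := fun s x => (-1) * (x (p, a, s) - I.mean a)) (fun i => by fun_prop)
    (I.iIndepFun_centred p a (-1))
    (fun s => by
      have := (I.subGaussian_reward p a s).neg
      refine this.congr (ae_of_all _ fun x => ?_)
      simp)
    (fun s => by rw [integral_const_mul, I.integral_reward_sub_mean p a s, mul_zero]) hd
  refine (measure_mono ?_).trans h
  rintro x ⟨n, hn, hx⟩
  refine ⟨n, hn, ?_⟩
  have hn0 : (0 : ℝ) < n := by positivity
  rw [← Finset.mul_sum, sum_sub_eq_mul_empMean_sub p a x hn]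
  rw [mul_left_comm]
  gcongr
  linarith

lemma measurable_empMean (n : ℕ) : Measurable fun x : Rewards K => empMean x p a n := by
  unfold empMean
  fun_prop

lemma Instance.measurableSet_upperDev (d : ℝ) : MeasurableSet (I.upperDev p a d) := by
  have : I.upperDev p a d = ⋃ n : ℕ, ⋃ _ : 1 ≤ n,
      {x | I.mean a + radius n d < empMean x p a n} := by
    ext x; simp [Instance.upperDev]
  rw [this]
  exact MeasurableSet.iUnion fun n => MeasurableSet.iUnion fun _ =>
    measurableSet_lt measurable_const (measurable_empMean p a n)

lemma Instance.measurableSet_lowerDev (d : ℝ) : MeasurableSet (I.lowerDev p a d) := by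
  have : I.lowerDev p a d = ⋃ n : ℕ, ⋃ _ : 1 ≤ n,
      {x | empMean x p a n + radius n d < I.mean a} := by
    ext x; simp [Instance.lowerDev]
  rw [this]
  exact MeasurableSet.iUnion fun n => MeasurableSet.iUnion fun _ =>
    measurableSet_lt ((measurable_empMean p a n).add_const _) measurable_const

end Centred

/-- Some empirical mean is farther from the mean than the radius of tolerance `d / K`. -/
def Instance.badEvent (I : Instance K) (d : ℝ) : Set (Rewards K) :=
  ⋃ a, (I.upperDev .ee a (d / K) ∪ I.lowerDev .ee a (d / K)) ∪
    (I.upperDev .et a (d / K) ∪ I.lowerDev .et a (d / K))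

lemma Instance.measurableSet_badEvent (I : Instance K) (d : ℝ) :
    MeasurableSet (I.badEvent d) :=
  MeasurableSet.iUnion fun _ =>
    ((I.measurableSet_upperDev _ _ _).union (I.measurableSet_lowerDev _ _ _)).union
      ((I.measurableSet_upperDev _ _ _).union (I.measurableSet_lowerDev _ _ _))

lemma Instance.measure_badEvent_le (I : Instance K) {d : ℝ} (hd : 0 < d) :
    I.rewardLaw (I.badEvent d) ≤ ENNReal.ofReal (4 * d) := by
  rcases Nat.eq_zero_or_pos K with rfl | hK
  · simp [Instance.badEvent]
  have hK' : (0 : ℝ) < K := by exact_mod_cast hK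
  have hdK : 0 < d / K := by positivity
  calc _ ≤ ∑ a : Fin K, I.rewardLaw ((I.upperDev .ee a (d / K) ∪ I.lowerDev .ee a (d / K)) ∪
        (I.upperDev .et a (d / K) ∪ I.lowerDev .et a (d / K))) := measure_iUnion_fintype_le _ _
    _ ≤ ∑ a : Fin K, ENNReal.ofReal (4 * (d / K)) := by
        refine Finset.sum_le_sum fun a _ => ?_
        have h4 : ENNReal.ofReal (4 * (d / K)) =
            (ENNReal.ofReal (d / K) + ENNReal.ofReal (d / K)) +
              (ENNReal.ofReal (d / K) + ENNReal.ofReal (d / K)) := by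
          rw [← ENNReal.ofReal_add hdK.le hdK.le,
            ← ENNReal.ofReal_add (by positivity) (by positivity)]
          congr 1; ring
        rw [h4]
        exact (measure_union_le _ _).trans (add_le_add
          ((measure_union_le _ _).trans (add_le_add (I.measure_upperDev_le _ a hdK)
            (I.measure_lowerDev_le _ a hdK)))
          ((measure_union_le _ _).trans (add_le_add (I.measure_upperDev_le _ a hdK)
            (I.measure_lowerDev_le _ a hdK))))
    _ = ENNReal.ofReal (4 * d) := by
        rw [Finset.sum_const, Finset.card_univ, Fintype.card_fin, nsmul_eq_mul,
          ← ENNReal.ofReal_natCast, ← ENNReal.ofReal_mul hK'.le]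
        congr 1; field_simp

lemma Instance.abs_le_radius_of_notMem_badEvent {I : Instance K} {d : ℝ} {x : Rewards K}
    (h : x ∉ I.badEvent d) (p : Period) (a : Fin K) {n : ℕ} (hn : 1 ≤ n) :
    empMean x p a n ≤ I.mean a + radius n (d / K) ∧
      I.mean a ≤ empMean x p a n + radius n (d / K) := by
  simp only [Instance.badEvent, Set.mem_iUnion, Set.mem_union, not_exists, not_or,
    Instance.upperDev, Instance.lowerDev, Set.mem_ofPred_eq, not_and, not_lt] at h
  obtain ⟨⟨h1, h2⟩, h3, h4⟩ := h a
  cases p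
  · exact ⟨h1 n hn, h2 n hn⟩
  · exact ⟨h3 n hn, h4 n hn⟩

/-! ### Single steps of the algorithm -/

/-- The number of exploration rewards of arm `a` sampled so far, in the history or held back. -/
def State.armCount (s : State K) (a : Fin K) : ℕ := s.nee a + if a ∈ s.held then 1 else 0

lemma State.sum_armCount (s : State K) : ∑ a, s.armCount a = eeCount s.nee s.held := by
  simp [State.armCount, eeCount, Finset.sum_add_distrib]

/-- The arm that an exploration step in state `s` would pull. -/
noncomputable def Input.pulled (P : Input K) (x : Rewards K) (s : State K) : Fin K :=
  P.selectArm x (P.dSeq s.phase) s.nee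

/-- The history sizes once the selected arm has received its reward. -/
noncomputable def Input.neeSucc (P : Input K) (x : Rewards K) (s : State K) : Fin K → ℕ :=
  Function.update s.nee (P.pulled x s) (s.nee (P.pulled x s) + 1)

/-- In every branch the selected arm ends up with one sampled reward more than its history had. -/
lemma Input.armCount_exploreStep (P : Input K) (x : Rewards K) (s : State K) :
    (P.exploreStep x s).armCount =
      Function.update s.armCount (P.pulled x s) (s.nee (P.pulled x s) + 1) := by
  ext a
  unfold Input.exploreStep
  by_cases h : a = P.pulled x s
  · subst h
    simp only [Function.update_self]
    split_ifs <;> simp [State.armCount, Input.pulled]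
  · have h' : a ≠ P.selectArm x (P.dSeq s.phase) s.nee := h
    rw [Function.update_of_ne h]
    dsimp only
    split_ifs <;> simp [State.armCount, h']

lemma Input.net_exploreStep (P : Input K) (x : Rewards K) (s : State K) :
    (P.exploreStep x s).net = s.net := by
  unfold Input.exploreStep
  dsimp only
  split_ifs <;> rfl

lemma Input.exploreStep_cases (P : Input K) (x : Rewards K) (s : State K) (hs : s.mode = .explore) :
    let s' := P.exploreStep x s
    let d := P.dSeq s.phase
    let n' := P.neeSucc x s
    (P.Tee s.phase ≤ eeCount s'.nee s'.held ∧
      s'.mode = .explore ∧ s'.phase = s.phase + 1 ∧ s'.nee = n') ∨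
    (eeCount s'.nee s'.held < P.Tee s.phase ∧ (∀ a, ucb x d n' a ≤ (P.threshold : EReal)) ∧
      d < P.conf / 3 ∧ s'.mode = .halted none ∧ s'.phase = s.phase ∧ s'.nee = n') ∨
    (eeCount s'.nee s'.held < P.Tee s.phase ∧ (∀ a, ucb x d n' a ≤ (P.threshold : EReal)) ∧
      ¬ d < P.conf / 3 ∧ s'.mode = .explore ∧ s'.phase = s.phase + 1 ∧ s'.nee = n') ∨
    ((¬ ∀ a, ucb x d n' a ≤ (P.threshold : EReal)) ∧
      (P.threshold : EReal) < lcb P.C x d n' (P.pulled x s) ∧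
      s'.mode = .exploit (P.pulled x s) ∧ s'.phase = s.phase ∧ s'.nee = s.nee) ∨
    (eeCount s'.nee s'.held < P.Tee s.phase ∧ (¬ ∀ a, ucb x d n' a ≤ (P.threshold : EReal)) ∧
      ¬ (P.threshold : EReal) < lcb P.C x d n' (P.pulled x s) ∧
      s'.mode = .explore ∧ s'.phase = s.phase ∧ s'.nee = n') := by
  intro s' d n'
  by_cases h1 : P.Tee s.phase ≤ eeCount n' (s.held.erase (P.pulled x s))
  · left
    have : s' = { s with phase := s.phase + 1, nee := n', held := s.held.erase (P.pulled x s) } :=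
      if_pos h1
    rw [this]
    exact ⟨h1, hs, rfl, rfl⟩
  right
  have e1 : s' = if ∀ a, ucb x d n' a ≤ (P.threshold : EReal) then
      if d < P.conf / 3 then
        { s with mode := .halted none, nee := n', held := s.held.erase (P.pulled x s) }
      else
        { s with phase := s.phase + 1, nee := n', held := s.held.erase (P.pulled x s) }
      else if (P.threshold : EReal) < lcb P.C x d n' (P.pulled x s) then
        { s with
            mode := .exploit (P.pulled x s), nee := s.nee,
            held := insert (P.pulled x s) (s.held.erase (P.pulled x s)) }
      else { s with nee := n', held := s.held.erase (P.pulled x s) } := if_neg h1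
  by_cases h2 : ∀ a, ucb x d n' a ≤ (P.threshold : EReal)
  · rw [if_pos h2] at e1
    by_cases h3 : d < P.conf / 3
    · rw [if_pos h3] at e1
      left; rw [e1]; exact ⟨not_le.1 h1, h2, h3, rfl, rfl, rfl⟩
    · rw [if_neg h3] at e1
      right; left; rw [e1]; exact ⟨not_le.1 h1, h2, h3, hs, rfl, rfl⟩
  · rw [if_neg h2] at e1
    right; right
    by_cases h3 : (P.threshold : EReal) < lcb P.C x d n' (P.pulled x s)
    · rw [if_pos h3] at e1
      left; rw [e1]; exact ⟨h2, h3, rfl, rfl, rfl⟩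
    · rw [if_neg h3] at e1
      right; rw [e1]; exact ⟨not_le.1 h1, h2, h3, hs, rfl, rfl⟩

lemma Input.step_explore (P : Input K) (x : Rewards K) {s : State K} (hs : s.mode = .explore) :
    P.step x s = P.exploreStep x s := by
  simp only [Input.step, hs]

lemma Input.step_exploit (P : Input K) (x : Rewards K) {s : State K} {a : Fin K}
    (hs : s.mode = .exploit a) : P.step x s = P.exploitStep x s a := by
  simp only [Input.step, hs]

lemma Input.step_halted (P : Input K) (x : Rewards K) {s : State K} {o : Answer K}
    (hs : s.mode = .halted o) : P.step x s = s := by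
  simp only [Input.step, hs]

lemma Input.exploitStep_cases (P : Input K) (x : Rewards K) (s : State K) (a : Fin K)
    (hs : s.mode = .exploit a) :
    let s' := P.exploitStep x s a
    let n := s.net a + 1
    let ok := P.threshold < empMean x .et a n - radius n (P.conf / (K * P.aSeq s.phase))
    s'.nee = s.nee ∧ s'.held = s.held ∧
    (((s.net a : ℝ) ≤ P.Tet s.phase ∧ ok ∧ s'.mode = .halted (some a) ∧ s'.phase = s.phase ∧
        s'.net = Function.update s.net a n) ∨
      ((s.net a : ℝ) ≤ P.Tet s.phase ∧ ¬ ok ∧ s'.mode = .exploit a ∧ s'.phase = s.phase ∧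
        s'.net = Function.update s.net a n) ∨
      (P.Tet s.phase < s.net a ∧ s'.mode = .explore ∧ s'.phase = s.phase + 1 ∧
        s'.net = s.net)) := by
  intro s' n ok
  by_cases h1 : (s.net a : ℝ) ≤ P.Tet s.phase
  · by_cases h2 : ok
    · have e : s' = { s with mode := .halted (some a), net := Function.update s.net a n } :=
        (if_pos h1).trans (if_pos h2)
      rw [e]; exact ⟨rfl, rfl, .inl ⟨h1, h2, rfl, rfl, rfl⟩⟩
    · have e : s' = { s with net := Function.update s.net a n } :=
        (if_pos h1).trans (if_neg h2)
      rw [e]; exact ⟨rfl, rfl, .inr (.inl ⟨h1, h2, hs, rfl, rfl⟩)⟩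
  · have e : s' = { s with phase := s.phase + 1, mode := .explore } := if_neg h1
    rw [e]; exact ⟨rfl, rfl, .inr (.inr ⟨not_le.1 h1, rfl, rfl, rfl⟩)⟩

lemma Input.run_succ (P : Input K) (x : Rewards K) (n : ℕ) :
    P.run x (n + 1) = P.step x (P.run x n) := Function.iterate_succ_apply' _ _ _

/-! ### Accounting for the pulls on a fixed reward sequence -/

/-- What the analysis needs to know about a reward sequence `x`. A phase is *good* if its
confidence bounds hold, and `B k a` bounds the useful number of exploration rewards of arm `a` in
a good phase `k`. From phase `kstar` on, a good phase is the last one. The proposition `e` says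
whether good phases may start an exploitation period, and `prom` holds for the arms that the
exploration returns in good phases from `kstar` on.

The last five fields say the following. From `kstar` on, the exploration budget leaves room for
the useful pulls of the phase. A useless pull in a good phase ends the phase. A good phase from
`kstar` on can only lead to the next exploration period by exhausting its budget, which `room`
excludes. It starts exploitation only of promising arms, and for these the exploitation stops
the algorithm with the last reward at the latest. -/
structure Accounting (P : Input K) (x : Rewards K) (good : ℕ → Prop) (B : ℕ → Fin K → ℝ)
    (kstar : ℕ) (e : Prop) (prom : Fin K → Prop) : Prop where
  B_nonneg : ∀ k a, 0 ≤ B k a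
  B_mono : ∀ k a, B k a ≤ B (k + 1) a
  Tee_nonneg : ∀ k, 0 ≤ P.Tee k
  Tee_succ : ∀ k, P.Tee k + 1 ≤ P.Tee (k + 1)
  Tet_nonneg : ∀ k, 0 ≤ P.Tet k
  Tet_succ : ∀ k, P.Tet k + 1 ≤ P.Tet (k + 1)
  one_le_kstar : 1 ≤ kstar
  room : ∀ k, kstar ≤ k + 1 → P.Tee k + 2 + ∑ a, B (k + 1) a < P.Tee (k + 1)
  phase_ends : ∀ s : State K, s.mode = .explore → good s.phase →
    B s.phase (P.pulled x s) < s.nee (P.pulled x s) + 1 →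
    (P.step x s).mode = .explore → (P.step x s).phase ≠ s.phase
  incomplete : ∀ s : State K, s.mode = .explore → good s.phase → kstar ≤ s.phase →
    (P.step x s).mode = .explore → (P.step x s).phase = s.phase + 1 →
    P.Tee s.phase ≤ eeCount (P.step x s).nee (P.step x s).held
  exploits : ∀ s : State K, ∀ a, s.mode = .explore → good s.phase →
    (P.step x s).mode = .exploit a → e ∧ (kstar ≤ s.phase → prom a)
  succeeds : ∀ k a, good k → kstar ≤ k → prom a →
    P.threshold < empMean x .et a (⌊P.Tet k⌋₊ + 1) -
      radius (⌊P.Tet k⌋₊ + 1) (P.conf / (K * P.aSeq k))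

section Accounting

variable {P : Input K} {x : Rewards K} {good : ℕ → Prop} {B : ℕ → Fin K → ℝ} {kstar : ℕ}
  {e : Prop} {prom : Fin K → Prop}

variable (P good) in
open Classical in
/-- The exploration pulls before phase `k` in excess of `∑ a, B k a`: one for each phase, and a
whole exploration budget for each bad phase. -/
noncomputable def excess (k : ℕ) : ℝ :=
  ∑ j ∈ Finset.range k, (1 + if good j then 0 else P.Tee j)

variable (P good e) in
open Classical in
/-- A bound on the exploitation pulls before phase `k`. -/
noncomputable def exploitTotal (k : ℕ) : ℝ :=
  ∑ j ∈ Finset.range k, if good j → e then P.Tet j + 1 else 0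

/-- What holds for the exploration counts `c` when the exploration period of phase `k` is over. -/
structure DoneInv (P : Input K) (good : ℕ → Prop) (B : ℕ → Fin K → ℝ) (kstar k : ℕ)
    (c : Fin K → ℕ) : Prop where
  one_le : 1 ≤ k
  bad_before : ∀ j, kstar ≤ j → j < k → ¬ good j
  count_le : ∑ a, (c a : ℝ) ≤ P.Tee k + 1
  max_le : ∑ a, max (c a : ℝ) (B k a) ≤ ∑ a, B k a + excess P good (k + 1)

/-- The invariant of exploration periods. -/
structure ExploreInv (P : Input K) (good : ℕ → Prop) (B : ℕ → Fin K → ℝ) (kstar : ℕ) (e : Prop)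
    (s : State K) : Prop where
  one_le : 1 ≤ s.phase
  bad_before : ∀ j, kstar ≤ j → j < s.phase → ¬ good j
  count_le : ∑ a, (s.armCount a : ℝ) ≤ P.Tee s.phase
  max_le_fresh : good s.phase →
    ∑ a, max (s.armCount a : ℝ) (B s.phase a) ≤ P.Tee (s.phase - 1) + 1 + ∑ a, B s.phase a
  max_le : good s.phase →
    ∑ a, max (s.armCount a : ℝ) (B s.phase a) ≤ ∑ a, B s.phase a + excess P good s.phase
  net_le : ∀ b, (s.net b : ℝ) ≤ P.Tet s.phase
  sum_net_le : ∑ b, (s.net b : ℝ) ≤ exploitTotal P good e s.phase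

/-- The invariant of exploitation periods. -/
structure ExploitInv (P : Input K) (x : Rewards K) (good : ℕ → Prop) (B : ℕ → Fin K → ℝ)
    (kstar : ℕ) (e : Prop) (prom : Fin K → Prop) (s : State K) (a : Fin K) : Prop where
  done : DoneInv P good B kstar s.phase s.armCount
  net_le : ∀ b, (s.net b : ℝ) ≤ P.Tet s.phase + 1
  sum_net_le : ∑ b, (s.net b : ℝ) ≤ exploitTotal P good e s.phase + s.net a
  allowed : good s.phase → e
  prom_of_good : good s.phase → kstar ≤ s.phase → prom a
  failed : (s.net a : ℝ) ≤ P.Tet s.phase ∨ s.net a = ⌊P.Tet s.phase⌋₊ + 1 ∧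
    ¬ P.threshold < empMean x .et a (s.net a) -
      radius (s.net a) (P.conf / (K * P.aSeq s.phase))

/-- The invariant of all states. -/
def Inv (P : Input K) (x : Rewards K) (good : ℕ → Prop) (B : ℕ → Fin K → ℝ) (kstar : ℕ)
    (e : Prop) (prom : Fin K → Prop) (s : State K) : Prop :=
  match s.mode with
  | .explore => ExploreInv P good B kstar e s
  | .exploit a => ExploitInv P x good B kstar e prom s a
  | .halted _ => DoneInv P good B kstar s.phase s.armCount ∧
      ∑ b, (s.net b : ℝ) ≤ exploitTotal P good e (s.phase + 1)

lemma Inv.of_explore {s : State K} (hs : s.mode = .explore) (h : ExploreInv P good B kstar e s) :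
    Inv P x good B kstar e prom s := by
  simpa only [Inv, hs] using h

lemma Inv.of_exploit {s : State K} {a : Fin K} (hs : s.mode = .exploit a)
    (h : ExploitInv P x good B kstar e prom s a) : Inv P x good B kstar e prom s := by
  simpa only [Inv, hs] using h

lemma Inv.of_halted {s : State K} {o : Answer K} (hs : s.mode = .halted o)
    (h : DoneInv P good B kstar s.phase s.armCount)
    (h' : ∑ b, (s.net b : ℝ) ≤ exploitTotal P good e (s.phase + 1)) :
    Inv P x good B kstar e prom s := by
  simpa only [Inv, hs] using ⟨h, h'⟩

end Accounting

namespace Accounting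

variable {P : Input K} {x : Rewards K} {good : ℕ → Prop} {B : ℕ → Fin K → ℝ} {kstar : ℕ}
  {e : Prop} {prom : Fin K → Prop}

lemma excess_succ_of_good {k : ℕ} (h : good k) :
    excess P good (k + 1) = excess P good k + 1 := by
  simp [excess, Finset.sum_range_succ, h]

lemma excess_succ_of_bad {k : ℕ} (h : ¬ good k) :
    excess P good (k + 1) = excess P good k + (1 + P.Tee k) := by
  simp [excess, Finset.sum_range_succ, h]

lemma excess_nonneg (hA : Accounting P x good B kstar e prom) (k : ℕ) :
    0 ≤ excess P good k := by
  classical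
  refine Finset.sum_nonneg fun j _ => ?_
  have := hA.Tee_nonneg j
  split_ifs <;> linarith

lemma exploitTotal_le_succ (hA : Accounting P x good B kstar e prom) (k : ℕ) :
    exploitTotal P good e k ≤ exploitTotal P good e (k + 1) := by
  rw [exploitTotal, exploitTotal, Finset.sum_range_succ]
  have := hA.Tet_nonneg k
  split_ifs <;> linarith

lemma exploitTotal_succ {k : ℕ} (h : good k → e) :
    exploitTotal P good e (k + 1) = exploitTotal P good e k + (P.Tet k + 1) := by
  rw [exploitTotal, exploitTotal, Finset.sum_range_succ, if_pos h]

lemma exploitTotal_nonneg (hA : Accounting P x good B kstar e prom) (k : ℕ) :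
    0 ≤ exploitTotal P good e k := by
  classical
  refine Finset.sum_nonneg fun j _ => ?_
  have := hA.Tet_nonneg j
  split_ifs <;> linarith

/-- Used in bad phases, where the counts are bounded by the exploration budget only. -/
lemma sum_max_le_add (hA : Accounting P x good B kstar e prom) (k : ℕ) (c : Fin K → ℕ) :
    ∑ a, max (c a : ℝ) (B k a) ≤ ∑ a, (c a : ℝ) + ∑ a, B k a := by
  rw [← Finset.sum_add_distrib]
  refine Finset.sum_le_sum fun a _ => max_le ?_ ?_
  · linarith [hA.B_nonneg k a]
  · linarith [Nat.cast_nonneg (α := ℝ) (c a)]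

/-- When a phase ends without an answer, the next one starts with its invariant. -/
lemma exploreInv_of_next (hA : Accounting P x good B kstar e prom) {k : ℕ} {c : Fin K → ℕ}
    (h : DoneInv P good B kstar k c) {s : State K} (hphase : s.phase = k + 1)
    (hc : s.armCount = c) (hbad : kstar ≤ k → ¬ good k) (hnet : ∀ b, (s.net b : ℝ) ≤ P.Tet k + 1)
    (hsum : ∑ b, (s.net b : ℝ) ≤ exploitTotal P good e (k + 1)) :
    ExploreInv P good B kstar e s where
  one_le := by omega
  bad_before j hj hjk := by
    rw [hphase] at hjk
    rcases (Nat.lt_succ_iff.1 hjk).lt_or_eq with h1 | rfl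
    · exact h.bad_before j hj h1
    · exact hbad hj
  count_le := by
    rw [hc, hphase]
    exact h.count_le.trans (hA.Tee_succ k)
  max_le_fresh _ := by
    rw [hc, hphase]
    have := h.count_le
    have := sum_max_le_add hA (k + 1) c
    simp only [Nat.add_sub_cancel]
    linarith
  max_le _ := by
    rw [hc, hphase]
    have h1 : ∑ a, max (c a : ℝ) (B (k + 1) a) ≤
        ∑ a, (max (c a : ℝ) (B k a) + (B (k + 1) a - B k a)) := by
      refine Finset.sum_le_sum fun a _ => max_le ?_ ?_
      · linarith [le_max_left (c a : ℝ) (B k a), hA.B_mono k a]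
      · linarith [le_max_right (c a : ℝ) (B k a)]
    rw [Finset.sum_add_distrib, Finset.sum_sub_distrib] at h1
    linarith [h.max_le]
  net_le b := by
    rw [hphase]
    exact (hnet b).trans (hA.Tet_succ k)
  sum_net_le := by rwa [hphase]

section ExploreStep

variable {s : State K}

lemma armCount_step_le (hs : s.mode = .explore) (a : Fin K) :
    (P.step x s).armCount a ≤ s.armCount a + if a = P.pulled x s then 1 else 0 := by
  rw [Input.step_explore P x hs, Input.armCount_exploreStep]
  by_cases h : a = P.pulled x s
  · subst h
    simp [State.armCount]
  · simp [h]

lemma sum_armCount_step_le (hs : s.mode = .explore) :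
    ∑ a, ((P.step x s).armCount a : ℝ) ≤ ∑ a, (s.armCount a : ℝ) + 1 := by
  have h : ∑ a, (P.step x s).armCount a ≤
      ∑ a, (s.armCount a + if a = P.pulled x s then 1 else 0) :=
    Finset.sum_le_sum fun a _ => armCount_step_le hs a
  rw [Finset.sum_add_distrib, Finset.sum_ite_eq' Finset.univ] at h
  simp only [Finset.mem_univ, if_true] at h
  exact_mod_cast h

lemma sum_max_step_le (hs : s.mode = .explore) (b : Fin K → ℝ) :
    ∑ a, max ((P.step x s).armCount a : ℝ) (b a) ≤ ∑ a, max (s.armCount a : ℝ) (b a) + 1 := by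
  have h : ∑ a, max ((P.step x s).armCount a : ℝ) (b a) ≤
      ∑ a, (max (s.armCount a : ℝ) (b a) + if a = P.pulled x s then 1 else 0) := by
    refine Finset.sum_le_sum fun a _ => ?_
    have h1 : ((P.step x s).armCount a : ℝ) ≤
        s.armCount a + if a = P.pulled x s then 1 else 0 := by
      exact_mod_cast armCount_step_le hs a
    refine max_le (h1.trans ?_) ?_
    · gcongr; exact le_max_left _ _
    · split_ifs <;> linarith [le_max_right (s.armCount a : ℝ) (b a)]
  rw [Finset.sum_add_distrib, Finset.sum_ite_eq' Finset.univ] at h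
  simpa using h

/-- A useful pull does not change the maximum of the counts and their bounds. -/
lemma sum_max_step_le_of_le (hs : s.mode = .explore) (b : Fin K → ℝ)
    (hb : (s.nee (P.pulled x s) : ℝ) + 1 ≤ b (P.pulled x s)) :
    ∑ a, max ((P.step x s).armCount a : ℝ) (b a) ≤ ∑ a, max (s.armCount a : ℝ) (b a) := by
  refine Finset.sum_le_sum fun a _ => ?_
  rw [Input.step_explore P x hs, Input.armCount_exploreStep]
  by_cases h : a = P.pulled x s
  · subst h
    rw [Function.update_self]
    push_cast
    rw [max_eq_right hb]
    exact le_max_right _ _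
  · rw [Function.update_of_ne h]

lemma doneInv_step (hA : Accounting P x good B kstar e prom) (hs : s.mode = .explore)
    (h : ExploreInv P good B kstar e s) :
    DoneInv P good B kstar s.phase (P.step x s).armCount where
  one_le := h.one_le
  bad_before := h.bad_before
  count_le := (sum_armCount_step_le hs).trans (by linarith [h.count_le])
  max_le := by
    by_cases hg : good s.phase
    · rw [excess_succ_of_good hg]
      linarith [h.max_le hg, sum_max_step_le (P := P) (x := x) hs (B s.phase)]
    · rw [excess_succ_of_bad hg]
      have h1 := sum_max_le_add hA s.phase (P.step x s).armCount
      have h2 := sum_armCount_step_le (P := P) (x := x) hs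
      linarith [h.count_le, excess_nonneg hA s.phase]

lemma inv_step_explore (hA : Accounting P x good B kstar e prom) (hs : s.mode = .explore)
    (h : ExploreInv P good B kstar e s) : Inv P x good B kstar e prom (P.step x s) := by
  have hd := doneInv_step hA hs h
  have hnet : (P.step x s).net = s.net := by
    rw [Input.step_explore P x hs, Input.net_exploreStep]
  have hsum := h.sum_net_le.trans (exploitTotal_le_succ hA s.phase)
  have hnext : (P.step x s).mode = .explore → (P.step x s).phase = s.phase + 1 →
      Inv P x good B kstar e prom (P.step x s) := by
    intro hm hp
    refine Inv.of_explore hm (exploreInv_of_next hA hd hp rfl (fun hk hg => ?_)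
      (fun b => by rw [hnet]; linarith [h.net_le b]) (by rwa [hnet]))
    have h1 := hA.incomplete s hs hg hk hm hp
    rw [← State.sum_armCount, Nat.cast_sum] at h1
    have h2 : ∑ a, ((P.step x s).armCount a : ℝ) ≤
        ∑ a, max ((P.step x s).armCount a : ℝ) (B s.phase a) :=
      Finset.sum_le_sum fun a _ => le_max_left _ _
    have h3 := sum_max_step_le (P := P) (x := x) hs (B s.phase)
    have h4 := h.max_le_fresh hg
    obtain ⟨k, hk'⟩ : ∃ k, s.phase = k + 1 := ⟨s.phase - 1, by have := h.one_le; omega⟩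
    have h5 := hA.room k (by omega)
    rw [hk'] at h1 h2 h3 h4
    simp only [Nat.add_sub_cancel] at h4
    linarith
  rcases P.exploreStep_cases x s hs with c | c | c | c | c <;>
    rw [← Input.step_explore P x hs] at c
  · exact hnext c.2.1 c.2.2.1
  · refine Inv.of_halted c.2.2.2.1 ?_ ?_
    · rwa [c.2.2.2.2.1]
    · rwa [c.2.2.2.2.1, hnet]
  · exact hnext c.2.2.2.1 c.2.2.2.2.1
  · obtain ⟨-, -, hm, hp, -⟩ := c
    have hex := fun hg => hA.exploits s _ hs hg hm
    refine Inv.of_exploit hm ⟨?_, fun b => ?_, ?_, ?_, ?_, ?_⟩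
    · rwa [hp]
    · rw [hp, hnet]; linarith [h.net_le b]
    · rw [hp, hnet]
      linarith [h.sum_net_le, Nat.cast_nonneg (α := ℝ) (s.net (P.pulled x s))]
    · rw [hp]; exact fun hg => (hex hg).1
    · rw [hp]; exact fun hg => (hex hg).2
    · rw [hp, hnet]; exact .inl (h.net_le _)
  · obtain ⟨hT, -, -, hm, hp, -⟩ := c
    have hle : good s.phase → ∑ a, max ((P.step x s).armCount a : ℝ) (B s.phase a) ≤
        ∑ a, max (s.armCount a : ℝ) (B s.phase a) := fun hg =>
      sum_max_step_le_of_le hs (B s.phase) (not_lt.1 fun hlt =>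
        hA.phase_ends s hs hg hlt hm hp)
    refine Inv.of_explore hm ⟨?_, ?_, ?_, ?_, ?_, ?_, ?_⟩
    · rw [hp]; exact h.one_le
    · rw [hp]; exact h.bad_before
    · rw [← State.sum_armCount, Nat.cast_sum] at hT
      rw [hp]; exact hT.le
    · rw [hp]; exact fun hg => (hle hg).trans (h.max_le_fresh hg)
    · rw [hp]; exact fun hg => (hle hg).trans (h.max_le hg)
    · rw [hp, hnet]; exact h.net_le
    · rw [hp, hnet]; exact h.sum_net_le

end ExploreStep

lemma sum_update_net {s : State K} (a : Fin K) :
    ∑ b, ((Function.update s.net a (s.net a + 1) b : ℕ) : ℝ) = ∑ b, (s.net b : ℝ) + 1 := by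
  rw [← Nat.cast_sum, ← Nat.cast_sum, Finset.sum_update_of_mem (Finset.mem_univ a),
    ← Finset.add_sum_erase _ s.net (Finset.mem_univ a), Finset.sdiff_singleton_eq_erase]
  push_cast
  ring

lemma inv_step_exploit (hA : Accounting P x good B kstar e prom) {s : State K} {a : Fin K}
    (hs : s.mode = .exploit a) (h : ExploitInv P x good B kstar e prom s a) :
    Inv P x good B kstar e prom (P.step x s) := by
  obtain ⟨hnee, hheld, hcases⟩ := P.exploitStep_cases x s a hs
  rw [← Input.step_exploit P x hs] at hnee hheld hcases
  have hc : (P.step x s).armCount = s.armCount := by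
    ext b; simp only [State.armCount, hnee, hheld]
  have hZ := exploitTotal_succ (P := P) h.allowed
  have hupd : (s.net a : ℝ) ≤ P.Tet s.phase → ∀ b,
      ((Function.update s.net a (s.net a + 1) b : ℕ) : ℝ) ≤ P.Tet s.phase + 1 := by
    intro hle b
    by_cases hb : b = a
    · subst hb
      rw [Function.update_self]; push_cast; linarith
    · rw [Function.update_of_ne hb]; exact h.net_le b
  rcases hcases with ⟨hle, -, hm, hp, hnet⟩ | ⟨hle, hfail, hm, hp, hnet⟩ | ⟨hlt, hm, hp, hnet⟩
  · refine Inv.of_halted hm ?_ ?_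
    · rw [hc, hp]; exact h.done
    · rw [hnet, hp, sum_update_net, hZ]
      linarith [h.sum_net_le]
  · refine Inv.of_exploit hm ⟨?_, ?_, ?_, ?_, ?_, ?_⟩
    · rw [hc, hp]; exact h.done
    · rw [hp, hnet]; exact hupd hle
    · rw [hp, hnet, sum_update_net, Function.update_self]
      push_cast
      linarith [h.sum_net_le]
    · rw [hp]; exact h.allowed
    · rw [hp]; exact h.prom_of_good
    · rw [hp, hnet, Function.update_self]
      rcases le_or_gt ((s.net a + 1 : ℕ) : ℝ) (P.Tet s.phase) with h1 | h1
      · exact .inl h1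
      · have h2 : s.net a = ⌊P.Tet s.phase⌋₊ := by
          symm
          rw [Nat.floor_eq_iff (hA.Tet_nonneg _)]
          exact ⟨hle, by exact_mod_cast h1⟩
        exact .inr ⟨by rw [h2], hfail⟩
  · refine Inv.of_explore hm (exploreInv_of_next hA h.done hp hc (fun hk hg => ?_)
      (fun b => by rw [hnet]; exact h.net_le b) ?_)
    · rcases h.failed with h1 | ⟨h1, h2⟩
      · linarith
      · rw [h1] at h2
        exact h2 (hA.succeeds s.phase a hg hk (h.prom_of_good hg hk))
    · rw [hnet, hZ]
      linarith [h.sum_net_le, h.net_le a]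

lemma inv_run (hA : Accounting P x good B kstar e prom) (n : ℕ) :
    Inv P x good B kstar e prom (P.run x n) := by
  induction n with
  | zero =>
    have h0 : (P.run x 0) = initState K := rfl
    have hc : ∀ a, (initState K).armCount a = 0 := fun a => by simp [State.armCount, initState]
    have hT := hA.Tee_nonneg
    have hmax : ∑ a, max (((initState K).armCount a : ℕ) : ℝ) (B 1 a) = ∑ a, B 1 a :=
      Finset.sum_congr rfl fun a _ => by
        rw [hc, Nat.cast_zero]; exact max_eq_right (hA.B_nonneg 1 a)
    have hp : (initState K).phase = 1 := rfl
    rw [h0]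
    refine Inv.of_explore rfl ⟨le_rfl, fun j hj hj' => ?_, ?_, fun _ => ?_, fun _ => ?_,
      fun b => ?_, ?_⟩
    · have : j < 1 := hj'
      have := hA.one_le_kstar
      omega
    · simpa [hc] using hT _
    · rw [hp]; exact hmax.le.trans (by linarith [hT (1 - 1)])
    · rw [hp]; exact hmax.le.trans (by linarith [excess_nonneg hA 1])
    · simpa [initState] using hA.Tet_nonneg 1
    · simpa [initState] using exploitTotal_nonneg hA 1
  | succ n ih =>
    rw [Input.run_succ]
    rcases hm : (P.run x n).mode with _ | a | o
    · exact inv_step_explore hA hm (by simpa only [Inv, hm] using ih)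
    · exact inv_step_exploit hA hm (by simpa only [Inv, hm] using ih)
    · rwa [Input.step_halted P x hm]

lemma pulls_eq (s : State K) :
    (s.pulls : ℝ) = ∑ a, (s.armCount a : ℝ) + ∑ b, (s.net b : ℝ) := by
  rw [State.pulls, ← State.sum_armCount]
  push_cast
  rfl

/-- The invariant bounds the number of pulls by the phase. -/
lemma pulls_le_of_inv (hA : Accounting P x good B kstar e prom) {s : State K}
    (h : Inv P x good B kstar e prom s) :
    1 ≤ s.phase ∧ (∀ j, kstar ≤ j → j < s.phase → ¬ good j) ∧
    (s.pulls : ℝ) ≤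
      ∑ a, B s.phase a + excess P good (s.phase + 1) + exploitTotal P good e (s.phase + 1) := by
  have hle : ∑ a, (s.armCount a : ℝ) ≤ ∑ a, max (s.armCount a : ℝ) (B s.phase a) :=
    Finset.sum_le_sum fun a _ => le_max_left _ _
  have hBs : 0 ≤ ∑ a, B s.phase a := Finset.sum_nonneg fun a _ => hA.B_nonneg _ a
  rw [pulls_eq]
  rcases hm : s.mode with _ | a | o <;> simp only [Inv, hm] at h
  · refine ⟨h.one_le, h.bad_before, ?_⟩
    have h1 := h.sum_net_le.trans (exploitTotal_le_succ hA s.phase)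
    by_cases hg : good s.phase
    · rw [excess_succ_of_good hg]
      linarith [h.max_le hg]
    · rw [excess_succ_of_bad hg]
      linarith [h.count_le, excess_nonneg hA s.phase]
  · refine ⟨h.done.one_le, h.done.bad_before, ?_⟩
    rw [exploitTotal_succ h.allowed]
    linarith [h.done.max_le, h.net_le a, h.sum_net_le]
  · exact ⟨h.1.one_le, h.1.bad_before, by linarith [h.1.max_le, h.2]⟩

/-! ### Progress -/

/-- A quantity that increases with every step within a phase. -/
def potential (s : State K) : ℕ :=
  ∑ a, s.nee a + ∑ a, s.net a + match s.mode with
    | .exploit _ => 1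
    | _ => 0

lemma sum_neeSucc (P : Input K) (x : Rewards K) (s : State K) :
    ∑ a, P.neeSucc x s a = ∑ a, s.nee a + 1 := by
  rw [Input.neeSucc, Finset.sum_update_of_mem (Finset.mem_univ _),
    ← Finset.add_sum_erase _ s.nee (Finset.mem_univ (P.pulled x s)),
    Finset.sdiff_singleton_eq_erase]
  ring

lemma phase_step (P : Input K) (x : Rewards K) (s : State K) :
    s.phase ≤ (P.step x s).phase ∧
      ((P.step x s).phase = s.phase → (∀ o, (P.step x s).mode ≠ .halted o) →
        potential s + 1 ≤ potential (P.step x s)) := by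
  rcases hm : s.mode with _ | a | o
  · have hnet : (P.step x s).net = s.net := by
      rw [Input.step_explore P x hm, Input.net_exploreStep]
    rcases P.exploreStep_cases x s hm with c | c | c | c | c <;>
      rw [← Input.step_explore P x hm] at c
    · exact ⟨by omega, fun h => by omega⟩
    · exact ⟨by omega, fun _ h => absurd c.2.2.2.1 (h _)⟩
    · exact ⟨by omega, fun h => by omega⟩
    · obtain ⟨-, -, hm', hp, hn⟩ := c
      exact ⟨hp.ge, fun _ _ => by simp [potential, hnet, hn, hm, hm']⟩
    · obtain ⟨-, -, -, hm', hp, hn⟩ := c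
      refine ⟨hp.ge, fun _ _ => ?_⟩
      simp only [potential, hnet, hn, hm, hm', sum_neeSucc]
      omega
  · obtain ⟨hnee, -, c⟩ := P.exploitStep_cases x s a hm
    rw [← Input.step_exploit P x hm] at hnee c
    rcases c with c | c | c
    · exact ⟨c.2.2.2.1.ge, fun _ h => absurd c.2.2.1 (h _)⟩
    · obtain ⟨-, -, hm', hp, hn⟩ := c
      refine ⟨hp.ge, fun _ _ => ?_⟩
      have := sum_update_net (s := s) a
      rw [← Nat.cast_sum, ← Nat.cast_sum] at this
      have h2 : ∑ b, Function.update s.net a (s.net a + 1) b = ∑ b, s.net b + 1 := by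
        exact_mod_cast this
      simp only [potential, hnee, hn, hm, hm', h2]
      omega
    · exact ⟨by omega, fun h => by omega⟩
  · rw [Input.step_halted P x hm]
    exact ⟨le_rfl, fun _ h => absurd hm (h _)⟩

lemma potential_le (s : State K) : potential s ≤ s.pulls + 1 := by
  unfold potential State.pulls eeCount
  rcases s.mode with _ | a | o <;> simp only <;> omega

/-- If the algorithm never stops, it goes through all phases. -/
lemma exists_le_phase (hA : Accounting P x good B kstar e prom)
    (hnever : ∀ n o, (P.run x n).mode ≠ .halted o) (k : ℕ) : ∃ n, k ≤ (P.run x n).phase := by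
  induction k with
  | zero => exact ⟨0, Nat.zero_le _⟩
  | succ k ih =>
    obtain ⟨n, hn⟩ := ih
    by_contra! hcon
    have hphase : ∀ m, (P.run x (n + m)).phase = k := by
      intro m
      induction m with
      | zero => have := hcon n; simp only [add_zero]; omega
      | succ m ihm =>
        have h1 := (phase_step P x (P.run x (n + m))).1
        rw [← Input.run_succ] at h1
        have h2 := hcon (n + (m + 1))
        have h3 : n + m + 1 = n + (m + 1) := by ring
        rw [h3] at h1
        omega
    have hpot : ∀ m, m ≤ potential (P.run x (n + m)) := by
      intro m
      induction m with
      | zero => exact Nat.zero_le _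
      | succ m ihm =>
        have h1 := (phase_step P x (P.run x (n + m))).2
        rw [← Input.run_succ] at h1
        have h3 : n + m + 1 = n + (m + 1) := by ring
        rw [h3, hphase, hphase] at h1
        have := h1 rfl (hnever _)
        omega
    obtain ⟨m, hm⟩ := exists_nat_gt
      (∑ a, B k a + excess P good (k + 1) + exploitTotal P good e (k + 1) + 1)
    have h1 := (pulls_le_of_inv hA (inv_run hA (n + m))).2.2
    rw [hphase] at h1
    have h2 : (m : ℝ) ≤ (P.run x (n + m)).pulls + 1 := by
      exact_mod_cast (hpot m).trans (potential_le _)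
    linarith

lemma bad_of_never_halted (hA : Accounting P x good B kstar e prom)
    (hnever : ∀ n o, (P.run x n).mode ≠ .halted o) {j : ℕ} (hj : kstar ≤ j) : ¬ good j := by
  obtain ⟨n, hn⟩ := exists_le_phase hA hnever (j + 1)
  exact (pulls_le_of_inv hA (inv_run hA n)).2.1 j hj (by omega)

/-! ### Charging the pulls to the bad phases -/

variable (P e) in
open Classical in
/-- The pulls in phase `j` that are paid for even if the phase is good. -/
noncomputable def goodCost (j : ℕ) : ℝ := 1 + if e then P.Tet j + 1 else 0

variable (P B e) in
/-- The cost of a bad phase `j`: the pulls in it, and those by which the bound on the pulls grows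
if phase `j + 1` is reached. -/
noncomputable def badCost (j : ℕ) : ℝ :=
  P.Tee j + (P.Tet j + 1) + goodCost P e (j + 1) + ∑ a, B (j + 1) a

open Classical in
/-- The summand `f (j + 1)` is charged to the bad phase `j`. -/
lemma sum_range_le_add_sum_bad {f : ℕ → ℝ} (hf : ∀ j, 0 ≤ f j) {k : ℕ}
    (hbad : ∀ j, kstar ≤ j → j < k → ¬ good j) :
    ∑ j ∈ Finset.range (k + 1), f j ≤ ∑ j ∈ Finset.range (kstar + 1), f j +
      ∑ j ∈ Finset.range k, if good j then 0 else f (j + 1) := by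
  rcases Nat.lt_or_ge k kstar with hk | hk
  · have h1 : ∑ j ∈ Finset.range (k + 1), f j ≤ ∑ j ∈ Finset.range (kstar + 1), f j :=
      Finset.sum_le_sum_of_subset_of_nonneg (Finset.range_mono (by omega)) fun j _ _ => hf j
    have h2 : 0 ≤ ∑ j ∈ Finset.range k, if good j then 0 else f (j + 1) :=
      Finset.sum_nonneg fun j _ => by split_ifs <;> [exact le_rfl; exact hf _]
    linarith
  · induction k, hk using Nat.le_induction with
    | base =>
      have h2 : 0 ≤ ∑ j ∈ Finset.range kstar, if good j then 0 else f (j + 1) :=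
        Finset.sum_nonneg fun j _ => by split_ifs <;> [exact le_rfl; exact hf _]
      linarith
    | succ k hk ih =>
      have ih' := ih fun j hj hj' => hbad j hj (by omega)
      rw [Finset.sum_range_succ f (k + 1), Finset.sum_range_succ (fun j => ite _ _ _) k,
        if_neg (hbad k hk (by omega))]
      linarith

lemma goodCost_nonneg (hA : Accounting P x good B kstar e prom) (j : ℕ) :
    0 ≤ goodCost P e j := by
  have := hA.Tet_nonneg j
  unfold goodCost
  split_ifs <;> linarith

lemma B_le_of_le (hA : Accounting P x good B kstar e prom) {j k : ℕ} (h : j ≤ k) (a : Fin K) :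
    B j a ≤ B k a :=
  monotone_nat_of_le_succ (f := fun k => B k a) (fun k => hA.B_mono k a) h

open Classical in
lemma sum_B_le (hA : Accounting P x good B kstar e prom) {k : ℕ} (hk1 : 1 ≤ k)
    (hbad : ∀ j, kstar ≤ j → j < k → ¬ good j) :
    ∑ a, B k a ≤ ∑ a, B kstar a +
      ∑ j ∈ Finset.range (k + 1), if good j then 0 else ∑ a, B (j + 1) a := by
  have hnn : ∀ j, 0 ≤ if good j then 0 else ∑ a, B (j + 1) a := fun j => by
    split_ifs
    exacts [le_rfl, Finset.sum_nonneg fun a _ => hA.B_nonneg _ a]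
  rcases Nat.lt_or_ge kstar k with hk | hk
  · have h1 := Finset.single_le_sum (fun j _ => hnn j)
      (Finset.mem_range.2 (show k - 1 < k + 1 by omega))
    rw [if_neg (hbad (k - 1) (by omega) (by omega)), Nat.sub_add_cancel hk1] at h1
    have h2 : 0 ≤ ∑ a, B kstar a := Finset.sum_nonneg fun a _ => hA.B_nonneg _ a
    linarith
  · have h1 : ∑ a, B k a ≤ ∑ a, B kstar a := Finset.sum_le_sum fun a _ => B_le_of_le hA hk a
    have h2 := Finset.sum_nonneg fun j (_ : j ∈ Finset.range (k + 1)) => hnn j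
    linarith

open Classical in
/-- The pulls are bounded by the cost of the phases up to `kstar` and that of the bad phases. -/
theorem pulls_run_le (hA : Accounting P x good B kstar e prom) (n : ℕ) :
    ((P.run x n).pulls : ℝ) ≤
      ∑ a, B kstar a + ∑ j ∈ Finset.range (kstar + 1), goodCost P e j +
        ∑ j ∈ Finset.range ((P.run x n).phase + 1), if good j then 0 else badCost P B e j := by
  obtain ⟨hk1, hbad, hle⟩ := pulls_le_of_inv hA (inv_run hA n)
  set k := (P.run x n).phase
  have h1 := sum_B_le hA hk1 hbad
  have h2 := sum_range_le_add_sum_bad (f := goodCost P e) (goodCost_nonneg hA) hbad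
  have h3 : ∑ j ∈ Finset.range k, (if good j then 0 else goodCost P e (j + 1)) ≤
      ∑ j ∈ Finset.range (k + 1), if good j then 0 else goodCost P e (j + 1) :=
    Finset.sum_le_sum_of_subset_of_nonneg (Finset.range_mono (by omega)) fun j _ _ => by
      split_ifs
      exacts [le_rfl, goodCost_nonneg hA _]
  have h4 : excess P good (k + 1) + exploitTotal P good e (k + 1) ≤
      ∑ j ∈ Finset.range (k + 1), goodCost P e j +
        ∑ j ∈ Finset.range (k + 1), if good j then 0 else (P.Tee j + (P.Tet j + 1)) := by
    rw [excess, exploitTotal, ← Finset.sum_add_distrib, ← Finset.sum_add_distrib]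
    refine Finset.sum_le_sum fun j _ => ?_
    have := hA.Tet_nonneg j
    unfold goodCost
    by_cases hg : good j <;> by_cases he : e <;> simp only [hg, he, if_true, if_false,
      forall_const, implies_true, false_implies] <;> linarith
  have h5 : (∑ j ∈ Finset.range (k + 1), if good j then 0 else badCost P B e j) =
      (∑ j ∈ Finset.range (k + 1), if good j then 0 else (P.Tee j + (P.Tet j + 1))) +
      (∑ j ∈ Finset.range (k + 1), if good j then 0 else goodCost P e (j + 1)) +
      ∑ j ∈ Finset.range (k + 1), if good j then 0 else ∑ a, B (j + 1) a := by
    rw [← Finset.sum_add_distrib, ← Finset.sum_add_distrib]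
    refine Finset.sum_congr rfl fun j _ => ?_
    unfold badCost
    split_ifs <;> ring
  linarith

lemma one_le_badCost (hA : Accounting P x good B kstar e prom) (j : ℕ) :
    1 ≤ badCost P B e j := by
  have h1 := hA.Tee_nonneg j
  have h2 := hA.Tet_nonneg j
  have h3 := goodCost_nonneg hA (j + 1)
  have h4 : 0 ≤ ∑ a, B (j + 1) a := Finset.sum_nonneg fun a _ => hA.B_nonneg _ a
  unfold badCost
  linarith

open Classical in
/-- The stopping time is bounded by the cost of the phases up to `kstar` and that of all bad
phases; if the algorithm never stops, the latter is infinite. -/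
theorem time_le (hA : Accounting P x good B kstar e prom) :
    ((P.outcome x).time : ℝ≥0∞) ≤
      ENNReal.ofReal (∑ a, B kstar a + ∑ j ∈ Finset.range (kstar + 1), goodCost P e j) +
        ∑' j, if good j then 0 else ENNReal.ofReal (badCost P B e j) := by
  unfold Input.outcome
  split_ifs with h
  · have h1 := pulls_run_le hA h.choose
    set n := h.choose
    have hnn : ∀ j, 0 ≤ if good j then 0 else badCost P B e j := fun j => by
      split_ifs
      exacts [le_rfl, zero_le_one.trans (one_le_badCost hA j)]
    calc (((P.run x n).pulls : ℕ∞) : ℝ≥0∞) = ENNReal.ofReal ((P.run x n).pulls : ℝ) := by simp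
      _ ≤ _ := ENNReal.ofReal_le_ofReal h1
      _ ≤ _ := ENNReal.ofReal_add_le
      _ ≤ _ := by
        gcongr
        rw [ENNReal.ofReal_sum_of_nonneg fun j _ => hnn j]
        refine le_trans (Finset.sum_le_sum fun j _ => ?_)
          (ENNReal.sum_le_tsum (Finset.range ((P.run x n).phase + 1)))
        split_ifs <;> simp
  · have hinf : (∑' j, if good j then 0 else ENNReal.ofReal (badCost P B e j)) = ⊤ := by
      rw [← top_le_iff, ← ENNReal.tsum_const_eq_top_of_ne_zero (α := ℕ) (c := 1) one_ne_zero]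
      refine le_trans ?_ (ENNReal.tsum_comp_le_tsum_of_injective
        (f := fun j : ℕ => j + kstar) (add_left_injective kstar) _)
      refine ENNReal.tsum_le_tsum fun j => ?_
      rw [if_neg (bad_of_never_halted hA (fun n o ho => h ⟨n, o, ho⟩) (by omega)),
        ENNReal.one_le_ofReal]
      exact one_le_badCost hA _
    rw [hinf]
    simp

end Accounting

/-! ### The schedules of SEE -/

/-- The input of SEE with the default schedules. -/
noncomputable def seeInput (tieBreak : Finset (Fin K) → Fin K) (μ₀ C δ : ℝ) : Input K where
  threshold := μ₀
  conf := δ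
  C := C
  dSeq := fun k => (1 / 3) ^ k
  aSeq := fun k => 5 ^ k
  bSeq := fun k => 2 ^ k
  tieBreak := tieBreak

lemma SEE_eq (tieBreak : Finset (Fin K) → Fin K) (μ₀ C δ : ℝ) :
    SEE tieBreak μ₀ C δ = (seeInput tieBreak μ₀ C δ).outcome := rfl

lemma one_lt_log_three : 1 < Real.log 3 := by
  rw [Real.lt_log_iff_exp_lt (by norm_num)]
  linarith [Real.exp_one_lt_d9]

lemma log_three_le : Real.log 3 ≤ 2 * Real.log 2 := by
  rw [← Real.log_rpow two_pos]
  exact Real.log_le_log (by norm_num) (by norm_num)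

lemma log_five_le : Real.log 5 ≤ 2 := by
  rw [Real.log_le_iff_le_exp (by norm_num), show (2 : ℝ) = 1 + 1 by norm_num, Real.exp_add]
  nlinarith [Real.exp_one_gt_d9]

lemma one_lt_log_four_mul (hK : 1 ≤ K) : 1 < Real.log (4 * K) := by
  have hK' : (1 : ℝ) ≤ K := by exact_mod_cast hK
  exact one_lt_log_three.trans_le (Real.log_le_log (by norm_num) (by linarith))

section Schedules

variable {tieBreak : Finset (Fin K) → Fin K} {μ₀ C δ : ℝ}

lemma Tee_see (hK : 1 ≤ K) (k : ℕ) : (seeInput tieBreak μ₀ C δ).Tee k =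
    1000 * (C + 1) ^ 2 * K * 2 ^ k * (Real.log (4 * K) + k * Real.log 3) := by
  have hK' : (0 : ℝ) < K := by exact_mod_cast hK
  simp only [Input.Tee, seeInput]
  congr 1
  rw [one_div, inv_pow, div_inv_eq_mul, Real.log_mul (by positivity) (by positivity),
    Real.log_pow]

lemma Tet_see (hK : 1 ≤ K) (hδ : 0 < δ) (k : ℕ) : (seeInput tieBreak μ₀ C δ).Tet k =
    1000 * 2 ^ k * (Real.log (4 * K / δ) + k * Real.log 5) := by
  have hK' : (0 : ℝ) < K := by exact_mod_cast hK
  simp only [Input.Tet, seeInput]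
  congr 1
  rw [show 4 * (5 : ℝ) ^ k * K / δ = 4 * K / δ * 5 ^ k by ring,
    Real.log_mul (by positivity) (by positivity), Real.log_pow]

lemma one_lt_log_four_mul_div (hK : 1 ≤ K) (hδ : 0 < δ) (hδ1 : δ < 1) :
    1 < Real.log (4 * K / δ) := by
  have hK' : (1 : ℝ) ≤ K := by exact_mod_cast hK
  refine (one_lt_log_four_mul hK).trans_le (Real.log_le_log (by positivity) ?_)
  rw [le_div_iff₀ hδ]
  nlinarith

/-- The schedules are nonnegative, grow by at least one and at least double. -/
lemma doubling_bounds {c l m : ℝ} (hc : 1000 ≤ c) (hl : 1 ≤ l) (hm : 0 ≤ m) (k : ℕ) :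
    0 ≤ c * 2 ^ k * (l + k * m) ∧ c * 2 ^ k * (l + k * m) + 1 ≤
      c * 2 ^ (k + 1) * (l + (k + 1 : ℕ) * m) ∧
    2 * (c * 2 ^ k * (l + k * m)) ≤ c * 2 ^ (k + 1) * (l + (k + 1 : ℕ) * m) := by
  have hk : (0 : ℝ) ≤ k := Nat.cast_nonneg k
  have h2 : (1 : ℝ) ≤ 2 ^ k := one_le_pow₀ one_le_two
  have hkm : 0 ≤ k * m := by positivity
  have h3 : 1 ≤ c * 2 ^ k * (l + k * m) := by
    have h4 : 1 ≤ c * 2 ^ k := by nlinarith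
    nlinarith
  have h5 : 2 * (c * 2 ^ k * (l + k * m)) ≤ c * 2 ^ (k + 1) * (l + (k + 1 : ℕ) * m) := by
    push_cast
    rw [pow_succ]
    have h6 : 0 ≤ c * 2 ^ k * m := by positivity
    nlinarith
  exact ⟨by linarith, by linarith, h5⟩

end Schedules

/-- The number of rewards beyond which the radius of an arm in phase `k` is below `h a`. -/
noncomputable def usefulBound (h : Fin K → ℝ) (kstar k : ℕ) (a : Fin K) : ℝ :=
  1 + 64 * (Real.log (4 * K) + (max k kstar : ℕ)) / h a ^ 2

/-- The radius of phase `k` with `t` rewards is below `h` once `t` exceeds the bound. The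
iterated logarithm of `1 / h` is absorbed by the number of the phase. -/
lemma radius_lt_of_usefulBound (hK : 1 ≤ K) {h : ℝ} (hh : 0 < h) {k kmax t : ℕ}
    (hk : k ≤ kmax) (hh2 : 1 ≤ h ^ 2 * 2 ^ kmax) (ht1 : 1 ≤ t)
    (ht : 64 * (Real.log (4 * K) + kmax) / h ^ 2 ≤ t) : radius t ((1 / 3) ^ k / K) < h := by
  have hK' : (1 : ℝ) ≤ K := by exact_mod_cast hK
  have hL := one_lt_log_four_mul hK
  have hkm : (k : ℝ) ≤ kmax := by exact_mod_cast hk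
  have hk0 : (0 : ℝ) ≤ k := Nat.cast_nonneg k
  have h1 : 64 * (Real.log (4 * K) + kmax) ≤ h ^ 2 * t := by
    rwa [div_le_iff₀ (by positivity), mul_comm (t : ℝ)] at ht
  refine radius_lt ht1 (by positivity) ?_ hh (by linarith) (le_trans ?_ h1)
  · rw [div_le_one (by positivity)]
    exact (pow_le_one₀ (by norm_num) (by norm_num)).trans hK'
  · have h2 : 8 / ((1 / 3 : ℝ) ^ k / K * h ^ 2) ≤ (4 * K) * 2 * 3 ^ k * 2 ^ kmax := by
      rw [div_le_iff₀ (by positivity)]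
      rw [show (4 * (K : ℝ)) * 2 * 3 ^ k * 2 ^ kmax * ((1 / 3) ^ k / K * h ^ 2) =
        8 * (h ^ 2 * 2 ^ kmax) by
          rw [one_div, inv_pow]
          field_simp
          ring]
      linarith
    have h3 := Real.log_le_log (by positivity) h2
    rw [Real.log_mul (by positivity) (by positivity), Real.log_mul (by positivity) (by positivity),
      Real.log_mul (by positivity) (by positivity), Real.log_pow, Real.log_pow] at h3
    have h4 := Real.log_two_lt_d9
    have h5 := log_three_le
    have h6 : (k : ℝ) * Real.log 3 ≤ kmax * 2 := by
      have : Real.log 3 ≤ 2 := by linarith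
      have := one_lt_log_three
      gcongr
    have h7 : (kmax : ℝ) * Real.log 2 ≤ kmax * 1 := by
      gcongr
      linarith
    linarith

/-! ### Good phases of SEE -/

section GoodPhase

variable {I : Instance K} {x : Rewards K} {d : ℝ}

lemma mean_le_ucb (hg : x ∉ I.badEvent d) (nee : Fin K → ℕ) (a : Fin K) :
    (I.mean a : EReal) ≤ ucb x d nee a := by
  unfold ucb
  split_ifs with h
  · exact le_top
  · exact EReal.coe_le_coe_iff.2
      (Instance.abs_le_radius_of_notMem_badEvent hg .ee a (Nat.one_le_iff_ne_zero.2 h)).2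

lemma ucb_le_mean (hg : x ∉ I.badEvent d) {nee : Fin K → ℕ} {a : Fin K} (ha : 1 ≤ nee a) :
    ucb x d nee a ≤ ((I.mean a + 2 * radius (nee a) (d / K) : ℝ) : EReal) := by
  unfold ucb
  rw [if_neg (by omega)]
  have := (Instance.abs_le_radius_of_notMem_badEvent hg .ee a ha).1
  exact EReal.coe_le_coe_iff.2 (by linarith)

lemma mean_le_lcb (hg : x ∉ I.badEvent d) {nee : Fin K → ℕ} {a : Fin K} (ha : 1 ≤ nee a) (C : ℝ) :
    ((I.mean a - (C + 1) * radius (nee a) (d / K) : ℝ) : EReal) ≤ lcb C x d nee a := by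
  unfold lcb
  rw [if_neg (by omega)]
  have := (Instance.abs_le_radius_of_notMem_badEvent hg .ee a ha).2
  exact EReal.coe_le_coe_iff.2 (by linarith)

lemma lcb_le_mean (hg : x ∉ I.badEvent d) {nee : Fin K → ℕ} {a : Fin K} (ha : 1 ≤ nee a) (C : ℝ) :
    lcb C x d nee a ≤ ((I.mean a - (C - 1) * radius (nee a) (d / K) : ℝ) : EReal) := by
  unfold lcb
  rw [if_neg (by omega)]
  have := (Instance.abs_le_radius_of_notMem_badEvent hg .ee a ha).1
  exact EReal.coe_le_coe_iff.2 (by linarith)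

lemma ucb_le_ucb_pulled {P : Input K} (hK : 1 ≤ K)
    (htie : ∀ s : Finset (Fin K), s.Nonempty → P.tieBreak s ∈ s) (x : Rewards K) (s : State K)
    (b : Fin K) :
    ucb x (P.dSeq s.phase) s.nee b ≤ ucb x (P.dSeq s.phase) s.nee (P.pulled x s) := by
  classical
  have : NeZero K := ⟨by omega⟩
  obtain ⟨m, -, hm⟩ := Finset.exists_max_image Finset.univ (ucb x (P.dSeq s.phase) s.nee)
    ⟨0, Finset.mem_univ _⟩
  have h := htie (Finset.univ.filter fun a => ∀ b, ucb x (P.dSeq s.phase) s.nee b ≤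
    ucb x (P.dSeq s.phase) s.nee a) ⟨m, by simpa using fun b => hm b (Finset.mem_univ b)⟩
  have h2 := (Finset.mem_filter.1 h).2 b
  unfold Input.pulled Input.selectArm
  convert h2

variable {tieBreak : Finset (Fin K) → Fin K} {μ₀ C δ : ℝ}

/-- In a good phase, a pull of an arm with a small radius ends the phase: such an arm is
pulled only if its index is not below a better mean, so either its lower bound clears the
threshold or its upper bound, and with it all others, does not. -/
lemma phase_ne_of_small_radius (hK : 1 ≤ K)
    (htie : ∀ s : Finset (Fin K), s.Nonempty → tieBreak s ∈ s) (hC : 1 < C)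
    {s : State K} (hs : s.mode = .explore) (hg : x ∉ I.badEvent ((1 / 3) ^ s.phase)) {h : ℝ}
    {A : Fin K} (hA : A = (seeInput tieBreak μ₀ C δ).pulled x s) (h1 : 1 ≤ s.nee A)
    (hr : radius (s.nee A) ((1 / 3) ^ s.phase / K) < h)
    (hr' : radius (s.nee A + 1) ((1 / 3) ^ s.phase / K) < h)
    (hsep : (∃ b, I.mean A + 2 * h ≤ I.mean b) ∨ μ₀ + (C + 1) * h ≤ I.mean A ∨
      I.mean A + 2 * h ≤ μ₀)
    (hm : ((seeInput tieBreak μ₀ C δ).step x s).mode = .explore) :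
    ((seeInput tieBreak μ₀ C δ).step x s).phase ≠ s.phase := by
  set P := seeInput tieBreak μ₀ C δ
  intro hp
  have hmax := ucb_le_ucb_pulled (P := P) hK htie x s
  have hn' : P.neeSucc x s A = s.nee A + 1 := by simp [Input.neeSucc, hA]
  have hn1 : 1 ≤ P.neeSucc x s A := by omega
  rcases P.exploreStep_cases x s hs with c | c | c | c | c <;>
    rw [← Input.step_explore P x hs] at c
  · omega
  · rw [c.2.2.2.1] at hm; cases hm
  · omega
  · rw [c.2.2.1] at hm; cases hm
  obtain ⟨-, hu, hl, -⟩ := c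
  rw [← hA] at hmax hl
  have hd : P.dSeq s.phase = (1 / 3) ^ s.phase := rfl
  have hth : P.threshold = μ₀ := rfl
  have hCC : P.C = C := rfl
  rw [hd, hth] at hu hl
  rw [hd] at hmax
  rw [hCC] at hl
  rcases hsep with ⟨b, hb⟩ | hb | hb
  · have h2 := ((mean_le_ucb hg s.nee b).trans (hmax b)).trans (ucb_le_mean hg h1)
    have := EReal.coe_le_coe_iff.1 h2
    linarith
  · refine hl (lt_of_lt_of_le (EReal.coe_lt_coe_iff.2 ?_) (mean_le_lcb hg hn1 C))
    rw [hn']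
    nlinarith
  · refine hu fun a => ?_
    by_cases ha : a = A
    · subst ha
      refine (ucb_le_mean hg hn1).trans (EReal.coe_le_coe_iff.2 ?_)
      rw [hn']
      linarith
    · have h2 : ucb x ((1 / 3) ^ s.phase) (P.neeSucc x s) a =
          ucb x ((1 / 3) ^ s.phase) s.nee a := by
        have : P.neeSucc x s a = s.nee a := by
          rw [Input.neeSucc, ← hA, Function.update_of_ne ha]
        simp only [ucb, this]
      rw [h2]
      refine ((hmax a).trans (ucb_le_mean hg h1)).trans (EReal.coe_le_coe_iff.2 ?_)
      linarith

lemma tolerance_div_le_one (hK : 1 ≤ K) (k : ℕ) : (1 / 3 : ℝ) ^ k / K ≤ 1 := by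
  have hK' : (1 : ℝ) ≤ K := by exact_mod_cast hK
  rw [div_le_one (by positivity)]
  exact (pow_le_one₀ (by norm_num) (by norm_num)).trans hK'

/-- In a good phase, an arm returned by the exploration lies above the threshold by a constant
fraction of the gap of any other arm `b`: the radius `U` of the arm is less than
`(mean - μ₀) / (C - 1)`, and its selection means that `b` is better by at most `4 * U`. -/
lemma mean_of_exploit (hK : 1 ≤ K)
    (htie : ∀ s : Finset (Fin K), s.Nonempty → tieBreak s ∈ s) (hC : 1 < C)
    {s : State K} (hs : s.mode = .explore) (hg : x ∉ I.badEvent ((1 / 3) ^ s.phase))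
    {A : Fin K} (hm : ((seeInput tieBreak μ₀ C δ).step x s).mode = .exploit A) :
    μ₀ < I.mean A ∧ ∀ b, min (C - 1) ((C - 1) / (C + 3) * (I.mean b - μ₀)) ≤ I.mean A - μ₀ := by
  set P := seeInput tieBreak μ₀ C δ
  have hmax := ucb_le_ucb_pulled (P := P) hK htie x s
  have hK' : (1 : ℝ) ≤ K := by exact_mod_cast hK
  have hd0 : (0 : ℝ) < (1 / 3) ^ s.phase / K := by positivity
  have hd1 := tolerance_div_le_one hK s.phase
  rcases P.exploreStep_cases x s hs with c | c | c | c | c <;>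
    rw [← Input.step_explore P x hs] at c
  · rw [c.2.1] at hm; cases hm
  · rw [c.2.2.2.1] at hm; cases hm
  · rw [c.2.2.2.1] at hm; cases hm
  · obtain ⟨-, hl, hm', -⟩ := c
    rw [hm'] at hm
    have hA : P.pulled x s = A := by injection hm
    have hn' : P.neeSucc x s A = s.nee A + 1 := by simp [Input.neeSucc, hA]
    have hn1 : 1 ≤ P.neeSucc x s A := by omega
    rw [hA] at hl hmax
    have h1 := EReal.coe_lt_coe_iff.1 (hl.trans_le (lcb_le_mean (I := I) hg hn1 C))
    have hth : P.threshold = μ₀ := rfl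
    rw [hn', hth] at h1
    have h1' : μ₀ < I.mean A - (C - 1) * radius (s.nee A + 1) ((1 / 3) ^ s.phase / K) := h1
    have hr0 := radius_nonneg (s.nee A + 1) ((1 / 3) ^ s.phase / K)
    have hC1 : 0 < C - 1 := by linarith
    refine ⟨by nlinarith, fun b => ?_⟩
    rcases Nat.eq_zero_or_pos (s.nee A) with h0 | h0
    · rw [h0, zero_add] at h1'
      have := one_le_radius_one hd0 hd1
      exact (min_le_left _ _).trans (by nlinarith)
    · refine (min_le_right _ _).trans ?_
      have h2 := EReal.coe_le_coe_iff.1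
        (((mean_le_ucb (I := I) hg s.nee b).trans (hmax b)).trans (ucb_le_mean hg h0))
      have h3 := radius_le_two_mul_radius_succ h0 hd0 hd1
      have h2' : I.mean b ≤ I.mean A + 2 * radius (s.nee A) ((1 / 3) ^ s.phase / K) := h2
      rw [div_mul_eq_mul_div, div_le_iff₀ (by linarith)]
      nlinarith
  · rw [c.2.2.2.1] at hm; cases hm

/-- With the final number of exploitation rewards of phase `k`, both the radius of the phase and
that of the stopping rule are below `h`. -/
lemma radius_exploit_lt (hK : 1 ≤ K) (hδ : 0 < δ) (hδ1 : δ < 1) {h : ℝ} (hh : 0 < h) {k t : ℕ}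
    (hh2 : 1 ≤ h ^ 2 * 2 ^ k) (ht1 : 1 ≤ t) (ht : (seeInput tieBreak μ₀ C δ).Tet k ≤ t) :
    radius t ((1 / 3) ^ k / K) < h ∧ radius t (δ / (K * 5 ^ k)) < h := by
  have hK' : (1 : ℝ) ≤ K := by exact_mod_cast hK
  have hL := one_lt_log_four_mul_div hK hδ hδ1
  have h5 : (0 : ℝ) < Real.log 5 := Real.log_pos (by norm_num)
  have hk5 : (k : ℝ) * Real.log 2 ≤ k * Real.log 5 := by
    gcongr
    norm_num
  have hk0 : (0 : ℝ) ≤ k * Real.log 5 := by positivity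
  have h2 := Real.log_two_lt_d9
  rw [Tet_see hK hδ] at ht
  set l := Real.log (4 * K / δ) + k * Real.log 5 with hl
  have h1 : 1000 * l ≤ h ^ 2 * t := by
    calc 1000 * l ≤ 1000 * l * (h ^ 2 * 2 ^ k) := le_mul_of_one_le_right (by linarith) hh2
      _ = h ^ 2 * (1000 * 2 ^ k * l) := by ring
      _ ≤ h ^ 2 * t := by gcongr
  have hlog : Real.log (8 / (δ / (K * 5 ^ k) * h ^ 2)) ≤ 3 * l := by
    have h3 : 8 / (δ / (K * 5 ^ k) * h ^ 2) ≤ (4 * K / δ) * 2 * 5 ^ k * 2 ^ k := by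
      rw [div_le_iff₀ (by positivity)]
      rw [show (4 * (K : ℝ) / δ) * 2 * 5 ^ k * 2 ^ k * (δ / (K * 5 ^ k) * h ^ 2) =
        8 * (h ^ 2 * 2 ^ k) by field_simp; ring]
      linarith
    have h4 := Real.log_le_log (by positivity) h3
    rw [Real.log_mul (by positivity) (by positivity), Real.log_mul (by positivity) (by positivity),
      Real.log_mul (by positivity) (by positivity), Real.log_pow, Real.log_pow] at h4
    linarith
  have hcmp : δ / (K * 5 ^ k) ≤ (1 / 3) ^ k / K := by
    rw [div_le_div_iff₀ (by positivity) (by positivity), one_div, inv_pow]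
    have h6 : (3 : ℝ) ^ k ≤ 5 ^ k := by gcongr; norm_num
    have h7 : 1 ≤ ((3 : ℝ) ^ k)⁻¹ * 5 ^ k := by
      rw [inv_mul_eq_div, le_div_iff₀ (by positivity)]; linarith
    nlinarith
  have hlog' : Real.log (8 / ((1 / 3) ^ k / K * h ^ 2)) ≤ 3 * l :=
    (Real.log_le_log (by positivity) (by gcongr)).trans hlog
  have hd1 := tolerance_div_le_one hK k
  exact ⟨radius_lt ht1 (by positivity) hd1 hh (by linarith) (by linarith),
    radius_lt ht1 (by positivity) (hcmp.trans hd1) hh (by linarith) (by linarith)⟩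

end GoodPhase

/-- SEE fits the accounting scheme. Arm `a` is settled once its radius is below `h a`, and `hm`
is a common lower bound of these levels at which exploitation succeeds. -/
theorem accounting_see {I : Instance K} {tieBreak : Finset (Fin K) → Fin K} {μ₀ C δ : ℝ}
    (hK : 1 ≤ K) (htie : ∀ s : Finset (Fin K), s.Nonempty → tieBreak s ∈ s) (hC : 1 < C)
    (hδ : 0 < δ) (hδ1 : δ < 1) {h : Fin K → ℝ} {hm : ℝ} (hm0 : 0 < hm) (hmh : ∀ a, hm ≤ h a)
    {kstar : ℕ} (hk1 : 1 ≤ kstar) (hk : 1 ≤ hm ^ 2 * 2 ^ kstar) {e : Prop}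
    (hsep : ∀ a, (∃ b, I.mean a + 2 * h a ≤ I.mean b) ∨ μ₀ + (C + 1) * h a ≤ I.mean a ∨
      I.mean a + 2 * h a ≤ μ₀)
    (hfinal : (∃ b, μ₀ < I.mean b) ∨ (1 / 3 : ℝ) ^ kstar < δ / 3)
    (hprom : (∀ a, I.mean a ≤ μ₀) ∨
      e ∧ ∃ b, 2 * hm ≤ min (C - 1) ((C - 1) / (C + 3) * (I.mean b - μ₀)))
    (x : Rewards K) :
    Accounting (seeInput tieBreak μ₀ C δ) x (fun j => x ∉ I.badEvent ((1 / 3) ^ j))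
      (usefulBound h kstar) kstar e (fun a => μ₀ + 2 * hm ≤ I.mean a) := by
  have hK' : (1 : ℝ) ≤ K := by exact_mod_cast hK
  have hL := one_lt_log_four_mul hK
  have h3 := one_lt_log_three
  have hTee := fun k => doubling_bounds (c := 1000 * (C + 1) ^ 2 * K)
    (by nlinarith [mul_le_mul (show 1 ≤ (C + 1) ^ 2 by nlinarith) hK' zero_le_one (by positivity)])
    hL.le (by linarith : 0 ≤ Real.log 3) k
  have hTet := fun k => doubling_bounds (c := 1000) le_rfl
    (one_lt_log_four_mul_div hK hδ hδ1).le (Real.log_nonneg (by norm_num) : 0 ≤ Real.log 5) k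
  have hh : ∀ a, 0 < h a := fun a => hm0.trans_le (hmh a)
  have hpow : ∀ {k}, kstar ≤ k → ∀ {r}, hm ≤ r → 1 ≤ r ^ 2 * 2 ^ k := by
    intro k hkk r hr
    refine hk.trans ?_
    gcongr
    norm_num
  refine ⟨?_, ?_, ?_, ?_, ?_, ?_, hk1, ?_, ?_, ?_, ?_, ?_⟩
  · intro k a
    unfold usefulBound
    positivity
  · intro k a
    unfold usefulBound
    gcongr
    omega
  · intro k; rw [Tee_see hK]; exact (hTee k).1
  · intro k; rw [Tee_see hK, Tee_see hK]; exact (hTee k).2.1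
  · intro k; rw [Tet_see hK hδ]; exact (hTet k).1
  · intro k; rw [Tet_see hK hδ, Tet_see hK hδ]; exact (hTet k).2.1
  · -- half of the budget of a phase from `kstar` on covers the useful pulls
    intro k hkk
    rw [Tee_see hK, Tee_see hK]
    have h1 := (hTee k).2.2
    set T' := 1000 * (C + 1) ^ 2 * K * 2 ^ (k + 1) *
      (Real.log (4 * K) + (k + 1 : ℕ) * Real.log 3) with hT'
    set L := Real.log (4 * K) + (k + 1 : ℕ) with hLdef
    have hL1 : 1 ≤ L := by
      have : (0 : ℝ) ≤ (k + 1 : ℕ) := Nat.cast_nonneg _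
      linarith
    have hp : (1 : ℝ) ≤ 2 ^ (k + 1) := one_le_pow₀ one_le_two
    have h2 : ∀ a, usefulBound h kstar (k + 1) a ≤ 65 * (2 ^ (k + 1) * L) := by
      intro a
      unfold usefulBound
      rw [max_eq_left hkk]
      have h4 : 64 * L / h a ^ 2 ≤ 64 * L * 2 ^ (k + 1) := by
        rw [div_le_iff₀ (by have := hh a; positivity)]
        have := hpow hkk (hmh a)
        nlinarith
      nlinarith
    have h5 : ∑ a, usefulBound h kstar (k + 1) a ≤ K * (65 * (2 ^ (k + 1) * L)) := by
      refine (Finset.sum_le_sum fun a _ => h2 a).trans ?_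
      simp
    have h6 : 4000 * (K * (2 ^ (k + 1) * L)) ≤ T' := by
      rw [hT']
      have h7 : L ≤ Real.log (4 * K) + (k + 1 : ℕ) * Real.log 3 := by
        rw [hLdef]
        gcongr
        exact le_mul_of_one_le_right (Nat.cast_nonneg _) h3.le
      calc 4000 * (K * (2 ^ (k + 1) * L)) = 1000 * (2 : ℝ) ^ 2 * K * 2 ^ (k + 1) * L := by ring
        _ ≤ 1000 * (C + 1) ^ 2 * K * 2 ^ (k + 1) *
          (Real.log (4 * K) + (k + 1 : ℕ) * Real.log 3) := by
          gcongr
          linarith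
    have h8 : 1 ≤ K * (2 ^ (k + 1) * L) := by
      have : 1 ≤ 2 ^ (k + 1) * L := by nlinarith
      nlinarith
    linarith
  · -- beyond the useful number of rewards, the radius is small before and after the pull
    intro s hs hg hlt hmode
    set A := (seeInput tieBreak μ₀ C δ).pulled x s with hA
    unfold usefulBound at hlt
    have hlt' : 64 * (Real.log (4 * K) + (max s.phase kstar : ℕ)) / h A ^ 2 < s.nee A := by
      linarith
    have hpos : (0 : ℝ) < s.nee A := by
      have := hh A
      refine lt_of_le_of_lt ?_ hlt'
      positivity
    have h1 : 1 ≤ s.nee A := by exact_mod_cast hpos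
    have hp2 := hpow (le_max_right s.phase kstar) (hmh A)
    refine phase_ne_of_small_radius hK htie hC hs hg hA h1 (h := h A) ?_ ?_ (hsep A) hmode
    · exact radius_lt_of_usefulBound hK (hh A) (le_max_left _ _) hp2 h1 hlt'.le
    · refine radius_lt_of_usefulBound hK (hh A) (le_max_left _ _) hp2 (by omega) ?_
      push_cast at hlt' ⊢
      linarith
  · -- a good phase answers `none` only below the threshold, and then it is final
    intro s hs hg hkk hmode hphase
    set P := seeInput tieBreak μ₀ C δ
    rcases P.exploreStep_cases x s hs with c | c | c | c | c <;>
      rw [← Input.step_explore P x hs] at c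
    · exact c.1
    · rw [c.2.2.2.1] at hmode; cases hmode
    · exfalso
      obtain ⟨-, hu, hd, -⟩ := c
      rcases hfinal with ⟨b, hb⟩ | hfinal
      · have h1 := EReal.coe_le_coe_iff.1 ((mean_le_ucb hg _ b).trans (hu b))
        have h2 : I.mean b ≤ μ₀ := h1
        linarith
      · refine hd (lt_of_le_of_lt ?_ hfinal)
        exact pow_le_pow_of_le_one (by norm_num) (by norm_num) hkk
    · rw [c.2.2.1] at hmode; cases hmode
    · omega
  · intro s a hs hg hmode
    obtain ⟨h1, h2⟩ := mean_of_exploit hK htie hC hs hg hmode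
    rcases hprom with hn | ⟨he, b, hb⟩
    · exact absurd (hn a) (not_le.2 h1)
    · exact ⟨he, fun _ => by linarith [h2 b]⟩
  · -- with the last exploitation reward, two radii fit below the gap of a promising arm
    intro k a hg hkk hp
    have hfl := Nat.lt_floor_add_one ((seeInput tieBreak μ₀ C δ).Tet k)
    have hr := radius_exploit_lt (tieBreak := tieBreak) (μ₀ := μ₀) (C := C) hK hδ hδ1 hm0
      (hpow hkk le_rfl) (t := ⌊(seeInput tieBreak μ₀ C δ).Tet k⌋₊ + 1) (by omega)
      (by push_cast; exact hfl.le)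
    have he := (Instance.abs_le_radius_of_notMem_badEvent hg .et a
      (n := ⌊(seeInput tieBreak μ₀ C δ).Tet k⌋₊ + 1) (by omega)).2
    change μ₀ < _ - radius _ (δ / (K * 5 ^ k))
    linarith [hr.1, hr.2]

/-! ### Bounds on the expected stopping time -/

open Classical in
lemma lintegral_tsum_bad_le (I : Instance K) (c : ℕ → ℝ) (hc : ∀ j, 0 ≤ c j) :
    ∫⁻ x, ∑' j : ℕ, (if x ∉ I.badEvent ((1 / 3) ^ j) then 0 else ENNReal.ofReal (c j))
      ∂I.rewardLaw ≤ ∑' j : ℕ, ENNReal.ofReal (4 * (1 / 3) ^ j * c j) := by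
  have hind : ∀ j (x : Rewards K),
      (if x ∉ I.badEvent ((1 / 3) ^ j) then 0 else ENNReal.ofReal (c j)) =
        (I.badEvent ((1 / 3) ^ j)).indicator (fun _ => ENNReal.ofReal (c j)) x := by
    intro j x
    by_cases hx : x ∈ I.badEvent ((1 / 3) ^ j)
    · rw [if_neg (not_not.2 hx), Set.indicator_of_mem hx]
    · rw [if_pos hx, Set.indicator_of_notMem hx]
  simp_rw [hind]
  rw [lintegral_tsum fun j =>
    (measurable_const.indicator (I.measurableSet_badEvent _)).aemeasurable]
  refine ENNReal.tsum_le_tsum fun j => ?_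
  rw [lintegral_indicator_const (I.measurableSet_badEvent _), mul_comm (4 * (1 / 3 : ℝ) ^ j),
    ENNReal.ofReal_mul (hc j)]
  gcongr
  exact I.measure_badEvent_le (by positivity)

lemma one_add_le_geometric (j : ℕ) : (1 + j : ℝ) ≤ 4 * (5 / 4) ^ j := by
  have h := one_add_mul_le_pow (show (-2 : ℝ) ≤ 1 / 4 by norm_num) j
  have h2 : (1 + 1 / 4 : ℝ) = 5 / 4 := by norm_num
  rw [h2] at h
  linarith

lemma tsum_geometric_le {c : ℕ → ℝ} {M : ℝ} (hM : 0 ≤ M)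
    (h : ∀ j, c j ≤ M * ((1 + j) * 2 ^ j)) :
    ∑' j : ℕ, ENNReal.ofReal (4 * (1 / 3) ^ j * c j) ≤ ENNReal.ofReal (96 * M) := by
  have hs : HasSum (fun j : ℕ => 16 * M * (5 / 6 : ℝ) ^ j) (16 * M * (1 - 5 / 6)⁻¹) :=
    (hasSum_geometric_of_lt_one (by norm_num) (by norm_num)).mul_left _
  have hle : ∀ j : ℕ, 4 * (1 / 3) ^ j * c j ≤ 16 * M * (5 / 6 : ℝ) ^ j := by
    intro j
    have h56 : (5 / 6 : ℝ) ^ j = (1 / 3) ^ j * ((5 / 4) ^ j * 2 ^ j) := by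
      rw [← mul_pow, ← mul_pow]; norm_num
    calc 4 * (1 / 3 : ℝ) ^ j * c j ≤ 4 * (1 / 3) ^ j * (M * (4 * (5 / 4) ^ j * 2 ^ j)) := by
          gcongr
          refine (h j).trans ?_
          gcongr
          exact one_add_le_geometric j
      _ = 16 * M * (5 / 6 : ℝ) ^ j := by rw [h56]; ring
  calc _ ≤ ∑' j : ℕ, ENNReal.ofReal (16 * M * (5 / 6 : ℝ) ^ j) :=
        ENNReal.tsum_le_tsum fun j => ENNReal.ofReal_le_ofReal (hle j)
    _ = ENNReal.ofReal (16 * M * (1 - 5 / 6)⁻¹) := by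
        rw [← ENNReal.ofReal_tsum_of_nonneg (fun j => by positivity) hs.summable, hs.tsum_eq]
    _ = ENNReal.ofReal (96 * M) := by congr 1; ring

section CostBounds

variable {tieBreak : Finset (Fin K) → Fin K} {μ₀ C δ : ℝ}

lemma log_four_mul_div (hK : 1 ≤ K) (hδ : 0 < δ) :
    Real.log (4 * K / δ) = Real.log (4 * K) + Real.log (1 / δ) := by
  have hK' : (0 : ℝ) < K := by exact_mod_cast hK
  rw [← Real.log_mul (by positivity) (by positivity)]
  congr 1; ring

lemma log_one_div_pos (hδ : 0 < δ) (hδ1 : δ < 1) : 0 < Real.log (1 / δ) :=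
  Real.log_pos (by rw [lt_div_iff₀ hδ]; linarith)

lemma Tee_le (hK : 1 ≤ K) (j : ℕ) : (seeInput tieBreak μ₀ C δ).Tee j ≤
    2000 * (C + 1) ^ 2 * (K * Real.log (4 * K)) * ((1 + j) * 2 ^ j) := by
  rw [Tee_see hK]
  have hL := one_lt_log_four_mul hK
  have h3 : Real.log 3 ≤ 2 := by linarith [log_three_le, Real.log_two_lt_d9]
  have hj : (0 : ℝ) ≤ j := Nat.cast_nonneg j
  have h1 : Real.log (4 * K) + j * Real.log 3 ≤ 2 * Real.log (4 * K) * (1 + j) := by nlinarith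
  calc _ ≤ 1000 * (C + 1) ^ 2 * K * 2 ^ j * (2 * Real.log (4 * K) * (1 + j)) := by gcongr
    _ = _ := by ring

lemma Tet_le (hK : 1 ≤ K) (hδ : 0 < δ) (hδ1 : δ < 1) (j : ℕ) :
    (seeInput tieBreak μ₀ C δ).Tet j ≤ 2000 * Real.log (4 * K / δ) * ((1 + j) * 2 ^ j) := by
  rw [Tet_see hK hδ]
  have hL := one_lt_log_four_mul_div hK hδ hδ1
  have h5 := log_five_le
  have hj : (0 : ℝ) ≤ j := Nat.cast_nonneg j
  have h1 : Real.log (4 * K / δ) + j * Real.log 5 ≤ 2 * Real.log (4 * K / δ) * (1 + j) := by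
    nlinarith
  calc _ ≤ 1000 * 2 ^ j * (2 * Real.log (4 * K / δ) * (1 + j)) := by gcongr
    _ = _ := by ring

lemma sum_usefulBound (h : Fin K → ℝ) (kstar k : ℕ) : ∑ a, usefulBound h kstar k a =
    K + 64 * ((∑ a, 1 / h a ^ 2) * (Real.log (4 * K) + (max k kstar : ℕ))) := by
  simp only [usefulBound, Finset.sum_add_distrib, Finset.sum_const, Finset.card_univ,
    Fintype.card_fin, nsmul_eq_mul, mul_one]
  rw [Finset.sum_mul, Finset.mul_sum]
  congr 1
  refine Finset.sum_congr rfl fun a _ => ?_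
  ring

lemma natCast_le_sum_one_div_sq {h : Fin K → ℝ} (h0 : ∀ a, 0 < h a) (h1 : ∀ a, h a ≤ 1) :
    (K : ℝ) ≤ ∑ a, 1 / h a ^ 2 := by
  calc (K : ℝ) = ∑ _a : Fin K, (1 : ℝ) := by simp
    _ ≤ _ := Finset.sum_le_sum fun a _ => by
      rw [le_div_iff₀ (by have := h0 a; positivity), one_mul]
      exact pow_le_one₀ (h0 a).le (h1 a)

lemma sum_usefulBound_succ_le (hK : 1 ≤ K) {h : Fin K → ℝ}
    (h0 : ∀ a, 0 < h a) (h1 : ∀ a, h a ≤ 1) (kstar j : ℕ) :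
    ∑ a, usefulBound h kstar (j + 1) a ≤
      129 * ((∑ a, 1 / h a ^ 2) * (Real.log (4 * K) + kstar)) * (1 + j) := by
  have hH := natCast_le_sum_one_div_sq h0 h1
  have hL := one_lt_log_four_mul hK
  rw [sum_usefulBound]
  set H := ∑ a, 1 / h a ^ 2
  set L := Real.log (4 * K)
  have hk0 : (0 : ℝ) ≤ kstar := Nat.cast_nonneg _
  have hj0 : (0 : ℝ) ≤ j := Nat.cast_nonneg _
  have hH0 : 0 ≤ H := (Nat.cast_nonneg K).trans hH
  have h2 : ((max (j + 1) kstar : ℕ) : ℝ) ≤ j + 1 + kstar := by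
    exact_mod_cast (by omega : max (j + 1) kstar ≤ j + 1 + kstar)
  have h3 : L + (max (j + 1) kstar : ℕ) ≤ 2 * ((L + kstar) * (1 + j)) := by
    have h4 : (1 : ℝ) + j ≤ (L + kstar) * (1 + j) :=
      le_mul_of_one_le_left (by linarith) (by linarith)
    have h5 : L + kstar ≤ (L + kstar) * (1 + j) :=
      le_mul_of_one_le_right (by linarith) (by linarith)
    linarith
  have h4 : H * (L + (max (j + 1) kstar : ℕ)) ≤ H * (2 * ((L + kstar) * (1 + j))) :=
    mul_le_mul_of_nonneg_left h3 hH0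
  have h5 : (K : ℝ) ≤ H * ((L + kstar) * (1 + j)) := by
    refine hH.trans (le_mul_of_one_le_right hH0 ?_)
    exact one_le_mul_of_one_le_of_one_le (by linarith) (by linarith)
  linarith

lemma goodCost_succ_le (hK : 1 ≤ K) (hδ : 0 < δ) (hδ1 : δ < 1) (e : Prop) (j : ℕ) :
    Accounting.goodCost (seeInput tieBreak μ₀ C δ) e (j + 1) ≤
      8002 * Real.log (4 * K / δ) * ((1 + j) * 2 ^ j) := by
  have hL := one_lt_log_four_mul_div hK hδ hδ1
  have het := Tet_le (tieBreak := tieBreak) (μ₀ := μ₀) (C := C) hK hδ hδ1 (j + 1)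
  have hj0 : (0 : ℝ) ≤ j := Nat.cast_nonneg _
  have hp : (1 : ℝ) ≤ 2 ^ j := one_le_pow₀ one_le_two
  have hG : (1 : ℝ) ≤ (1 + j) * 2 ^ j :=
    one_le_mul_of_one_le_of_one_le (by linarith) hp
  have h1 : (1 + ((j + 1 : ℕ) : ℝ)) * 2 ^ (j + 1) ≤ 4 * ((1 + j) * 2 ^ j) := by
    rw [pow_succ]
    push_cast
    nlinarith
  have h2 : (1 : ℝ) ≤ Real.log (4 * K / δ) * ((1 + j) * 2 ^ j) :=
    one_le_mul_of_one_le_of_one_le hL.le hG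
  have h3 := mul_le_mul_of_nonneg_left h1
    (show 0 ≤ 2000 * Real.log (4 * K / δ) by linarith)
  unfold Accounting.goodCost
  split_ifs <;> linarith

lemma badCost_le (hK : 1 ≤ K) (hδ : 0 < δ) (hδ1 : δ < 1) (hC : 1 < C) {h : Fin K → ℝ}
    (h0 : ∀ a, 0 < h a) (h1 : ∀ a, h a ≤ 1) (e : Prop) (kstar j : ℕ) :
    Accounting.badCost (seeInput tieBreak μ₀ C δ) (usefulBound h kstar) e j ≤
      5000 * (C + 1) ^ 2 * ((∑ a, 1 / h a ^ 2) * (Real.log (4 * K) + kstar) +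
        Real.log (1 / δ)) * ((1 + j) * 2 ^ j) := by
  have hH := natCast_le_sum_one_div_sq h0 h1
  have hL := one_lt_log_four_mul hK
  have hW := log_one_div_pos hδ hδ1
  have hL' := one_lt_log_four_mul_div hK hδ hδ1
  have hee := Tee_le (tieBreak := tieBreak) (μ₀ := μ₀) (C := C) (δ := δ) hK j
  have het := Tet_le (tieBreak := tieBreak) (μ₀ := μ₀) (C := C) hK hδ hδ1 j
  have hgc := goodCost_succ_le (tieBreak := tieBreak) (μ₀ := μ₀) (C := C) hK hδ hδ1 e j
  have hB := sum_usefulBound_succ_le hK h0 h1 kstar j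
  rw [log_four_mul_div hK hδ] at het hgc hL'
  have hk0 : (0 : ℝ) ≤ kstar := Nat.cast_nonneg _
  have hj0 : (0 : ℝ) ≤ j := Nat.cast_nonneg _
  have hK' : (1 : ℝ) ≤ K := by exact_mod_cast hK
  have hp : (1 : ℝ) ≤ 2 ^ j := one_le_pow₀ one_le_two
  have hjG : (1 + j : ℝ) ≤ (1 + j) * 2 ^ j := le_mul_of_one_le_right (by linarith) hp
  set H := ∑ a, 1 / h a ^ 2
  set L := Real.log (4 * K)
  set W := Real.log (1 / δ)
  set G : ℝ := (1 + j) * 2 ^ j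
  have hS : K * L ≤ H * (L + kstar) :=
    mul_le_mul hH (by linarith) (by linarith) (by linarith)
  have hLS : L ≤ K * L := le_mul_of_one_le_left (by linarith) hK'
  set S := H * (L + kstar)
  have hC4 : 4 ≤ (C + 1) ^ 2 := by nlinarith
  have hcoef : 2000 * (C + 1) ^ 2 * (K * L) + 10003 * (L + W) + 129 * S ≤
      5000 * (C + 1) ^ 2 * (S + W) := by
    have e1 := mul_le_mul_of_nonneg_left hS (show 0 ≤ (C + 1) ^ 2 by positivity)
    have e2 := mul_le_mul_of_nonneg_right hC4 (show 0 ≤ S by linarith)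
    have e3 := mul_le_mul_of_nonneg_right hC4 hW.le
    linarith
  have hcoefG := mul_le_mul_of_nonneg_right hcoef (show 0 ≤ G by linarith)
  have hone : 1 ≤ (L + W) * G := one_le_mul_of_one_le_of_one_le hL'.le (by linarith)
  have hBG := mul_le_mul_of_nonneg_left hjG (show 0 ≤ 129 * S by linarith)
  unfold Accounting.badCost
  linarith

lemma sum_goodCost_le_of_not (P : Input K) {e : Prop} (he : ¬ e) (k : ℕ) :
    ∑ j ∈ Finset.range (k + 1), Accounting.goodCost P e j ≤ k + 1 := by
  simp [Accounting.goodCost, he]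

lemma sum_goodCost_le (hK : 1 ≤ K) (hδ : 0 < δ) (hδ1 : δ < 1) (e : Prop) (k : ℕ) :
    ∑ j ∈ Finset.range (k + 1), Accounting.goodCost (seeInput tieBreak μ₀ C δ) e j ≤
      2 * (k + 1) + 4000 * (2 ^ k * (Real.log (4 * K) + k + Real.log (1 / δ))) := by
  have hL := one_lt_log_four_mul_div hK hδ hδ1
  have h1 : ∀ j ∈ Finset.range (k + 1), Accounting.goodCost (seeInput tieBreak μ₀ C δ) e j ≤
      2 + 2000 * (Real.log (4 * K) + k + Real.log (1 / δ)) * 2 ^ j := by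
    intro j hj
    have hjk : (j : ℝ) ≤ k := by exact_mod_cast Nat.lt_succ_iff.1 (Finset.mem_range.1 hj)
    have hj0 : (0 : ℝ) ≤ j := Nat.cast_nonneg _
    have h2 : (seeInput tieBreak μ₀ C δ).Tet j ≤
        2000 * (Real.log (4 * K) + k + Real.log (1 / δ)) * 2 ^ j := by
      rw [Tet_see hK hδ]
      have h3 : Real.log (4 * K / δ) + j * Real.log 5 ≤
          2 * (Real.log (4 * K) + k + Real.log (1 / δ)) := by
        have := log_five_le
        rw [log_four_mul_div hK hδ] at hL ⊢
        nlinarith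
      calc _ ≤ 1000 * 2 ^ j * (2 * (Real.log (4 * K) + k + Real.log (1 / δ))) := by gcongr
        _ = _ := by ring
    have h4 : 0 ≤ (seeInput tieBreak μ₀ C δ).Tet j := by
      rw [Tet_see hK hδ]
      have : 0 ≤ Real.log 5 := Real.log_nonneg (by norm_num)
      positivity
    unfold Accounting.goodCost
    split_ifs <;> linarith
  have h2 : ∑ j ∈ Finset.range (k + 1), (2 : ℝ) ^ j ≤ 2 * 2 ^ k := by
    rw [geom_sum_eq (by norm_num), pow_succ]
    norm_num
    linarith
  calc _ ≤ ∑ j ∈ Finset.range (k + 1),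
        (2 + 2000 * (Real.log (4 * K) + k + Real.log (1 / δ)) * 2 ^ j) := Finset.sum_le_sum h1
    _ = 2 * (k + 1) + 2000 * (Real.log (4 * K) + k + Real.log (1 / δ)) *
        ∑ j ∈ Finset.range (k + 1), (2 : ℝ) ^ j := by
      rw [Finset.sum_add_distrib, ← Finset.mul_sum]
      simp
      ring
    _ ≤ 2 * (k + 1) + 2000 * (Real.log (4 * K) + k + Real.log (1 / δ)) * (2 * 2 ^ k) := by
      have : 0 ≤ Real.log (4 * K) + k + Real.log (1 / δ) := by
        rw [log_four_mul_div hK hδ] at hL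
        have : (0 : ℝ) ≤ k := Nat.cast_nonneg _
        linarith
      gcongr
    _ = _ := by ring

end CostBounds

open Classical in
/-- The expected stopping time of SEE in terms of the levels `h a` at which the arms are settled
and of the phase `kstar` from which on good phases are the last ones. -/
theorem expectedTime_see_le {I : Instance K} {tieBreak : Finset (Fin K) → Fin K} {μ₀ C δ : ℝ}
    (hK : 1 ≤ K) (htie : ∀ s : Finset (Fin K), s.Nonempty → tieBreak s ∈ s) (hC : 1 < C)
    (hδ : 0 < δ) (hδ1 : δ < 1) {h : Fin K → ℝ} {hm : ℝ} (hm0 : 0 < hm) (hmh : ∀ a, hm ≤ h a)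
    (hh1 : ∀ a, h a ≤ 1)
    {kstar : ℕ} (hk1 : 1 ≤ kstar) (hk : 1 ≤ hm ^ 2 * 2 ^ kstar) {e : Prop}
    (hsep : ∀ a, (∃ b, I.mean a + 2 * h a ≤ I.mean b) ∨ μ₀ + (C + 1) * h a ≤ I.mean a ∨
      I.mean a + 2 * h a ≤ μ₀)
    (hfinal : (∃ b, μ₀ < I.mean b) ∨ (1 / 3 : ℝ) ^ kstar < δ / 3)
    (hprom : (∀ a, I.mean a ≤ μ₀) ∨
      e ∧ ∃ b, 2 * hm ≤ min (C - 1) ((C - 1) / (C + 3) * (I.mean b - μ₀))) :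
    expectedTime (SEE tieBreak μ₀ C δ) I ≤ ENNReal.ofReal
      (500000 * (C + 1) ^ 2 * ((∑ a, 1 / h a ^ 2) * (Real.log (4 * K) + kstar) +
        Real.log (1 / δ)) +
      if e then 4000 * (2 ^ kstar * (Real.log (4 * K) + kstar + Real.log (1 / δ))) else 0) := by
  have hacc := accounting_see hK htie hC hδ hδ1 hm0 hmh hk1 hk hsep hfinal hprom
  have hh0 : ∀ a, 0 < h a := fun a => hm0.trans_le (hmh a)
  have hK' : (1 : ℝ) ≤ K := by exact_mod_cast hK
  have hH := natCast_le_sum_one_div_sq hh0 hh1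
  have hL := one_lt_log_four_mul hK
  have hW := log_one_div_pos hδ hδ1
  have hk0 : (0 : ℝ) ≤ kstar := Nat.cast_nonneg _
  set P := seeInput tieBreak μ₀ C δ with hP
  set B := usefulBound h kstar
  set S := (∑ a, 1 / h a ^ 2) * (Real.log (4 * K) + kstar) with hS
  have hKS : (K : ℝ) ≤ S := by rw [hS]; nlinarith
  have hkS : (kstar + 1 : ℝ) ≤ S := by rw [hS]; nlinarith
  set M := 5000 * (C + 1) ^ 2 * (S + Real.log (1 / δ)) with hM
  have hM0 : 0 ≤ M := by
    have : 0 ≤ S + Real.log (1 / δ) := by linarith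
    positivity
  set D := ∑ a, B kstar a + ∑ j ∈ Finset.range (kstar + 1), Accounting.goodCost P e j with hD
  have hnn : ∀ j, 0 ≤ Accounting.badCost P B e j := by
    -- the cost does not depend on the rewards
    have x : Rewards K := fun _ => 0
    exact fun j => zero_le_one.trans ((hacc x).one_le_badCost j)
  have hint : expectedTime (SEE tieBreak μ₀ C δ) I ≤
      ENNReal.ofReal D + ENNReal.ofReal (96 * M) := by
    calc expectedTime (SEE tieBreak μ₀ C δ) I
        ≤ ∫⁻ x, (ENNReal.ofReal D + ∑' j : ℕ, (if x ∉ I.badEvent ((1 / 3) ^ j) then 0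
            else ENNReal.ofReal (Accounting.badCost P B e j))) ∂I.rewardLaw :=
          lintegral_mono fun x => (hacc x).time_le.trans (le_of_eq (by congr!))
      _ = ENNReal.ofReal D + ∫⁻ x, ∑' j : ℕ, (if x ∉ I.badEvent ((1 / 3) ^ j) then 0
            else ENNReal.ofReal (Accounting.badCost P B e j)) ∂I.rewardLaw := by
          rw [lintegral_add_left measurable_const]; simp
      _ ≤ _ := by
          gcongr
          exact (lintegral_tsum_bad_le I _ hnn).trans
            (tsum_geometric_le hM0 fun j => badCost_le hK hδ hδ1 hC hh0 hh1 e kstar j)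
  have hBk : ∑ a, B kstar a ≤ 65 * S := by
    rw [sum_usefulBound, max_self]
    linarith
  have hDle : D ≤ 67 * S +
      if e then 4000 * (2 ^ kstar * (Real.log (4 * K) + kstar + Real.log (1 / δ))) else 0 := by
    split_ifs with he
    · have := sum_goodCost_le (tieBreak := tieBreak) (μ₀ := μ₀) (C := C) hK hδ hδ1 e kstar
      linarith
    · have := sum_goodCost_le_of_not P he kstar
      linarith
  have hD0 : 0 ≤ D := by
    have x : Rewards K := fun _ => 0
    exact add_nonneg (Finset.sum_nonneg fun a _ => (hacc x).B_nonneg _ a)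
      (Finset.sum_nonneg fun j _ => (hacc x).goodCost_nonneg j)
  rw [← ENNReal.ofReal_add hD0 (by positivity)] at hint
  refine hint.trans (ENNReal.ofReal_le_ofReal ?_)
  have hC4 : 4 ≤ (C + 1) ^ 2 := by nlinarith
  have e1 := mul_le_mul_of_nonneg_right hC4 (show 0 ≤ S + Real.log (1 / δ) by linarith)
  linarith

/-! ### The bounds in terms of the gaps -/

lemma Instance.mean_le_best (I : Instance K) (a : Fin K) : I.mean a ≤ I.best :=
  le_ciSup (Set.finite_range _).bddAbove a

lemma Instance.exists_mean_eq_best (I : Instance K) (hK : 1 ≤ K) : ∃ b, I.mean b = I.best := by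
  have : NeZero K := ⟨by omega⟩
  exact exists_eq_ciSup_of_finite

lemma Instance.gapOne_eq (I : Instance K) (a : Fin K) : I.gapOne a = I.best - I.mean a :=
  abs_of_nonneg (by linarith [I.mean_le_best a])

lemma exists_phase {r : ℝ} (hr0 : 0 < r) (hr1 : r ≤ 1) :
    ∃ k : ℕ, 1 ≤ k ∧ 1 ≤ r ^ 2 * 2 ^ k ∧ (2 : ℝ) ^ k ≤ 2 / r ^ 2 ∧
      (k : ℝ) ≤ 1 + 2 * Real.log (1 / r ^ 2) := by
  have h1 : 1 ≤ 1 / r ^ 2 := by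
    rw [le_div_iff₀ (by positivity), one_mul]; exact pow_le_one₀ hr0.le hr1
  obtain ⟨n, hn, hn'⟩ := exists_nat_pow_near h1 (one_lt_two : (1 : ℝ) < 2)
  have h2 : (2 : ℝ) ^ (n + 1) ≤ 2 / r ^ 2 := by
    rw [pow_succ, show 2 / r ^ 2 = 1 / r ^ 2 * 2 by ring]
    linarith
  refine ⟨n + 1, by omega, ?_, h2, ?_⟩
  · rw [div_lt_iff₀ (by positivity)] at hn'
    linarith
  · have h3 := Real.log_le_log (by positivity) hn
    rw [Real.log_pow] at h3
    have h4 := Real.log_two_gt_d9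
    have h5 : (0 : ℝ) ≤ n := Nat.cast_nonneg _
    push_cast
    nlinarith

/-- The phase from which on the radii fall below `θ * g` is at most logarithmic in `1 / g`. -/
lemma exists_phase_mul (hK : 1 ≤ K) {t g : ℝ} (ht0 : 0 < t) (ht1 : t ≤ 1) (hg0 : 0 < g)
    (hg1 : g ≤ 1) : ∃ k : ℕ, 1 ≤ k ∧ 1 ≤ (t * g) ^ 2 * 2 ^ k ∧
      (2 : ℝ) ^ k ≤ 2 / t ^ 2 * (1 / g ^ 2) ∧
      Real.log (4 * K) + k ≤ (4 + 2 * Real.log (1 / t ^ 2)) * (1 + Real.log (K / g ^ 2)) := by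
  have hK' : (1 : ℝ) ≤ K := by exact_mod_cast hK
  obtain ⟨k, h1, h2, h3, h4⟩ := exists_phase (mul_pos ht0 hg0) (mul_le_one₀ ht1 hg0.le hg1)
  refine ⟨k, h1, h2, ?_, ?_⟩
  · rw [mul_pow] at h3
    calc _ ≤ 2 / (t ^ 2 * g ^ 2) := h3
      _ = _ := by field_simp
  · have e1 : Real.log (1 / (t * g) ^ 2) = Real.log (1 / t ^ 2) + Real.log (1 / g ^ 2) := by
      rw [← Real.log_mul (by positivity) (by positivity)]
      congr 1
      field_simp
    have e2 : Real.log (K / g ^ 2) = Real.log K + Real.log (1 / g ^ 2) := by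
      rw [← Real.log_mul (by positivity) (by positivity)]
      congr 1
      field_simp
    have e3 : Real.log (4 * K) = 2 * Real.log 2 + Real.log K := by
      rw [Real.log_mul (by norm_num) (by positivity), show (4 : ℝ) = 2 ^ 2 by norm_num,
        Real.log_pow]
      norm_num
    have l1 : 0 ≤ Real.log (1 / t ^ 2) := Real.log_nonneg (by
      rw [le_div_iff₀ (by positivity), one_mul]; exact pow_le_one₀ ht0.le ht1)
    have l2 : 0 ≤ Real.log (1 / g ^ 2) := Real.log_nonneg (by
      rw [le_div_iff₀ (by positivity), one_mul]; exact pow_le_one₀ hg0.le hg1)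
    have l3 : 0 ≤ Real.log K := Real.log_nonneg hK'
    have l4 := Real.log_two_lt_d9
    rw [e1] at h4
    rw [e2, e3]
    have := mul_nonneg l1 (add_nonneg l3 l2)
    linarith

/-- A ratio `θ` such that exploitation succeeds with radii below `θ` times the gap. -/
lemma exists_ratio {C : ℝ} (hC : 1 < C) : ∃ t : ℝ, 0 < t ∧ t ≤ 1 ∧ t ≤ 1 / (C + 1) ∧
    2 * t ≤ (C - 1) / (C + 3) ∧ 2 * t ≤ C - 1 := by
  have h1 : 0 < C - 1 := by linarith
  have h2 : 0 < C + 1 := by linarith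
  have h3 : 0 < C + 3 := by linarith
  have h4 : (C - 1) / (C + 3) ≤ 1 := by rw [div_le_one h3]; linarith
  have h5 : (C - 1) / (C + 3) ≤ C - 1 := div_le_self h1.le (by linarith)
  have h6 : 0 < (C - 1) / (C + 3) := by positivity
  have h7 : 1 / (C + 1) ≤ 1 := by rw [div_le_one h2]; linarith
  have h8 : 0 < 1 / (C + 1) := by positivity
  exact ⟨(C - 1) / (C + 3) * (1 / (C + 1)) / 2, by positivity, by nlinarith, by nlinarith,
    by nlinarith, by nlinarith⟩

lemma sum_one_div_levels (C : ℝ) (g : Fin K → ℝ) :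
    ∑ a, 1 / (g a / (C + 1)) ^ 2 = (C + 1) ^ 2 * ∑ a, 1 / g a ^ 2 := by
  rw [Finset.mul_sum]
  refine Finset.sum_congr rfl fun a _ => ?_
  rw [div_pow, one_div_div]
  ring

lemma log_ratio_nonneg (hK : 1 ≤ K) {g : ℝ} (hg0 : 0 < g) (hg1 : g ≤ 1) :
    0 ≤ Real.log (K / g ^ 2) := by
  have hK' : (1 : ℝ) ≤ K := by exact_mod_cast hK
  refine Real.log_nonneg ?_
  rw [le_div_iff₀ (by positivity), one_mul]
  exact (pow_le_one₀ hg0.le hg1).trans hK'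

/-- On a positive instance, arm `a` is settled at a level proportional to `g a`, and the
exploitation pays for the gap `g` of the best arm. -/
theorem exists_expectedTime_pos_le {C : ℝ} (hC : 1 < C) : ∃ c : ℝ, 0 < c ∧
    ∀ (K : ℕ) (tieBreak : Finset (Fin K) → Fin K) (μ₀ δ : ℝ) (I : Instance K),
      1 ≤ K → (∀ s : Finset (Fin K), s.Nonempty → tieBreak s ∈ s) → 0 < δ → δ < 1 →
      I ∈ posSet K μ₀ → ∀ (g : Fin K → ℝ) (gm : ℝ), 0 < gm → (∀ a, gm ≤ g a) →
      (∀ a, g a ≤ 1) → (∀ a, g a ≤ max (I.gapZero μ₀ a) (I.gapOne a)) → gm ≤ I.best - μ₀ →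
      expectedTime (SEE tieBreak μ₀ C δ) I ≤ ENNReal.ofReal
        (c * ((∑ a, 1 / g a ^ 2) * (1 + Real.log (K / gm ^ 2)) +
          1 / gm ^ 2 * (Real.log (1 / δ) + (1 + Real.log (K / gm ^ 2))))) := by
  obtain ⟨t, ht0, ht1, htC, ht2, ht3⟩ := exists_ratio hC
  set q := 4 + 2 * Real.log (1 / t ^ 2) with hq
  have hq1 : 1 ≤ q := by
    have : 0 ≤ Real.log (1 / t ^ 2) := Real.log_nonneg (by
      rw [le_div_iff₀ (by positivity), one_mul]; exact pow_le_one₀ ht0.le ht1)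
    linarith
  refine ⟨500000 * (C + 1) ^ 4 * q + 8000 * q / t ^ 2, by positivity, ?_⟩
  intro K tieBreak μ₀ δ I hK htie hδ hδ1 hI g gm hgm hgmg hg1 hgmax hgap
  obtain ⟨b, hb⟩ := I.exists_mean_eq_best hK
  have hpos : μ₀ < I.best := hI
  have hgm1 : gm ≤ 1 := (hgmg b).trans (hg1 b)
  obtain ⟨k, hk1, hk2, hk3, hk4⟩ := exists_phase_mul hK ht0 ht1 hgm hgm1
  have hC1 : 0 < C + 1 := by linarith
  have hg0 : ∀ a, 0 < g a := fun a => hgm.trans_le (hgmg a)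
  have hW := log_one_div_pos hδ hδ1
  have hmain := expectedTime_see_le (I := I) (μ₀ := μ₀) (e := True) (h := fun a => g a / (C + 1))
    (hm := t * gm) hK htie hC hδ hδ1 (by positivity) (fun a => ?_) (fun a => ?_) hk1 hk2
    (fun a => ?_) (.inl ⟨b, by rwa [hb]⟩) (.inr ⟨trivial, b, ?_⟩)
  · refine hmain.trans (ENNReal.ofReal_le_ofReal ?_)
    rw [if_pos trivial, sum_one_div_levels]
    have hl := log_ratio_nonneg hK hgm hgm1
    set l := 1 + Real.log (K / gm ^ 2)
    set G := ∑ a, 1 / g a ^ 2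
    set W := Real.log (1 / δ)
    have hG0 : 0 ≤ G := Finset.sum_nonneg fun a _ => by positivity
    have hv : 1 ≤ 1 / gm ^ 2 := by
      rw [le_div_iff₀ (by positivity), one_mul]; exact pow_le_one₀ hgm.le hgm1
    set v := 1 / gm ^ 2
    have hWv : W ≤ v * W := le_mul_of_one_le_left hW.le hv
    have hl0 : 0 ≤ l := by positivity
    have hCC : (1 : ℝ) ≤ (C + 1) ^ 2 := one_le_pow₀ (by linarith)
    have e1 : (C + 1) ^ 2 * G * (Real.log (4 * K) + k) + W ≤
        (C + 1) ^ 2 * q * (G * l + v * (W + l)) := by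
      have h1 : (C + 1) ^ 2 * G * (Real.log (4 * K) + k) ≤ (C + 1) ^ 2 * G * (q * l) := by
        gcongr
      have h2 : v * W ≤ (C + 1) ^ 2 * q * (v * (W + l)) := by
        have h3 : v * W ≤ v * (W + l) := by gcongr; linarith
        refine h3.trans (le_mul_of_one_le_left (by positivity) ?_)
        exact one_le_mul_of_one_le_of_one_le hCC hq1
      linarith
    have e2 : 2 ^ k * (Real.log (4 * K) + k + W) ≤ 2 / t ^ 2 * q * (G * l + v * (W + l)) := by
      have h1 : Real.log (4 * K) + k + W ≤ q * (W + l) := by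
        have := le_mul_of_one_le_left hW.le hq1
        linarith
      calc 2 ^ k * (Real.log (4 * K) + k + W) ≤ 2 / t ^ 2 * v * (q * (W + l)) := by
            have := one_lt_log_four_mul hK
            gcongr
        _ ≤ 2 / t ^ 2 * v * (q * (W + l)) + 2 / t ^ 2 * q * (G * l) := by
            have : 0 ≤ 2 / t ^ 2 * q * (G * l) := by positivity
            linarith
        _ = _ := by ring
    calc 500000 * (C + 1) ^ 2 * ((C + 1) ^ 2 * G * (Real.log (4 * K) + k) + W) +
          4000 * (2 ^ k * (Real.log (4 * K) + k + W))
        ≤ 500000 * (C + 1) ^ 2 * ((C + 1) ^ 2 * q * (G * l + v * (W + l))) +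
          4000 * (2 / t ^ 2 * q * (G * l + v * (W + l))) := by gcongr
      _ = _ := by ring
  · calc t * gm ≤ 1 / (C + 1) * g a :=
          mul_le_mul htC (hgmg a) hgm.le (by positivity)
      _ = g a / (C + 1) := by ring
  · rw [div_le_one hC1]
    linarith [hg1 a]
  · have h2 : 2 * (g a / (C + 1)) ≤ g a := by
      rw [mul_div_assoc', div_le_iff₀ hC1]
      nlinarith [hg0 a]
    have h3 : (C + 1) * (g a / (C + 1)) = g a := by field_simp
    rcases le_max_iff.1 (hgmax a) with h | h
    · rcases le_total μ₀ (I.mean a) with h4 | h4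
      · rw [Instance.gapZero, abs_sub_comm, abs_of_nonneg (by linarith)] at h
        exact .inr (.inl (by linarith))
      · rw [Instance.gapZero, abs_of_nonneg (by linarith)] at h
        exact .inl ⟨b, by linarith⟩
    · rw [I.gapOne_eq] at h
      exact .inl ⟨b, by linarith⟩
  · rw [hb]
    refine le_min ?_ ?_
    · nlinarith
    · calc 2 * (t * gm) = 2 * t * gm := by ring
        _ ≤ (C - 1) / (C + 3) * (I.best - μ₀) := by
          have : 0 < (C - 1) / (C + 3) := by linarith
          gcongr

/-- On a negative instance there is no exploitation in good phases, and the confidence level only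
enters through the phase whose tolerance is small enough for the answer `none`. -/
theorem exists_expectedTime_neg_le {C : ℝ} (hC : 1 < C) : ∃ c : ℝ, 0 < c ∧
    ∀ (K : ℕ) (tieBreak : Finset (Fin K) → Fin K) (μ₀ δ : ℝ) (I : Instance K),
      1 ≤ K → (∀ s : Finset (Fin K), s.Nonempty → tieBreak s ∈ s) → 0 < δ → δ < 1 →
      ∀ (g : Fin K → ℝ) (gm : ℝ), 0 < gm → (∀ a, gm ≤ g a) →
      (∀ a, g a ≤ 1) → (∀ a, I.mean a + g a ≤ μ₀) →
      expectedTime (SEE tieBreak μ₀ C δ) I ≤ ENNReal.ofReal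
        (c * ((∑ a, 1 / g a ^ 2) * (1 + Real.log (K / gm ^ 2) + Real.log (1 / δ)))) := by
  obtain ⟨t, ht0, ht1, htC, -, -⟩ := exists_ratio hC
  set q := 4 + 2 * Real.log (1 / t ^ 2) with hq
  have hq1 : 1 ≤ q := by
    have : 0 ≤ Real.log (1 / t ^ 2) := Real.log_nonneg (by
      rw [le_div_iff₀ (by positivity), one_mul]; exact pow_le_one₀ ht0.le ht1)
    linarith
  refine ⟨500000 * (C + 1) ^ 4 * (q + 3), by positivity, ?_⟩
  intro K tieBreak μ₀ δ I hK htie hδ hδ1 g gm hgm hgmg hg1 hgmean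
  obtain ⟨b, hb⟩ := I.exists_mean_eq_best hK
  have hgm1 : gm ≤ 1 := (hgmg b).trans (hg1 b)
  obtain ⟨k, hk1, hk2, -, hk4⟩ := exists_phase_mul hK ht0 ht1 hgm hgm1
  have hW := log_one_div_pos hδ hδ1
  obtain ⟨n, hn, hn'⟩ := exists_nat_pow_near
    (show (1 : ℝ) ≤ 3 / δ by rw [le_div_iff₀ hδ]; linarith) (by norm_num : (1 : ℝ) < 3)
  have hnW : (n : ℝ) ≤ 2 + Real.log (1 / δ) := by
    have h1 := Real.log_le_log (by positivity) hn
    rw [Real.log_pow, show 3 / δ = 3 * (1 / δ) by ring,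
      Real.log_mul (by norm_num) (by positivity)] at h1
    have h2 := one_lt_log_three
    have h3 : Real.log 3 ≤ 2 := by linarith [log_three_le, Real.log_two_lt_d9]
    have h4 : (n : ℝ) ≤ n * Real.log 3 := le_mul_of_one_le_right (Nat.cast_nonneg n) h2.le
    linarith
  have hC1 : 0 < C + 1 := by linarith
  have hg0 : ∀ a, 0 < g a := fun a => hgm.trans_le (hgmg a)
  have hmain := expectedTime_see_le (I := I) (μ₀ := μ₀) (e := False)
    (h := fun a => g a / (C + 1)) (hm := t * gm) (kstar := k + (n + 1)) hK htie hC hδ hδ1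
    (by positivity) (fun a => ?_) (fun a => ?_) (by omega) ?_
    (fun a => .inr (.inr ?_)) (.inr ?_) (.inl fun a => by linarith [hgmean a, hg0 a])
  · refine hmain.trans (ENNReal.ofReal_le_ofReal ?_)
    rw [if_neg not_false, add_zero, sum_one_div_levels]
    have hl := log_ratio_nonneg hK hgm hgm1
    have hG1 := natCast_le_sum_one_div_sq hg0 hg1
    have hK' : (1 : ℝ) ≤ K := by exact_mod_cast hK
    have hCC : (1 : ℝ) ≤ (C + 1) ^ 2 := one_le_pow₀ (by linarith)
    set l := Real.log (K / gm ^ 2)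
    set G := ∑ a, 1 / g a ^ 2
    set W := Real.log (1 / δ)
    have hG0 : 1 ≤ G := hK'.trans hG1
    have e1 : Real.log (4 * K) + (k + (n + 1) : ℕ) ≤ (q + 2) * (1 + l + W) + 1 + l := by
      push_cast
      nlinarith
    have e2 : G * (Real.log (4 * K) + (k + (n + 1) : ℕ)) + W ≤ (q + 3) * (G * (1 + l + W)) := by
      have h1 := mul_le_mul_of_nonneg_left e1 (show 0 ≤ G by linarith)
      have h2 : W ≤ G * W := le_mul_of_one_le_left hW.le hG0
      linarith
    calc 500000 * (C + 1) ^ 2 *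
          ((C + 1) ^ 2 * G * (Real.log (4 * K) + (k + (n + 1) : ℕ)) + W)
        ≤ 500000 * (C + 1) ^ 2 *
          ((C + 1) ^ 2 * (G * (Real.log (4 * K) + (k + (n + 1) : ℕ)) + W)) := by
          have := le_mul_of_one_le_left hW.le hCC
          gcongr
          linarith
      _ ≤ 500000 * (C + 1) ^ 2 * ((C + 1) ^ 2 * ((q + 3) * (G * (1 + l + W)))) := by gcongr
      _ = _ := by ring
  · calc t * gm ≤ 1 / (C + 1) * g a :=
          mul_le_mul htC (hgmg a) hgm.le (by positivity)
      _ = g a / (C + 1) := by ring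
  · rw [div_le_one hC1]
    linarith [hg1 a]
  · refine hk2.trans ?_
    gcongr
    · norm_num
    · omega
  · have h2 : 2 * (g a / (C + 1)) ≤ g a := by
      rw [mul_div_assoc', div_le_iff₀ hC1]
      nlinarith [hg0 a]
    linarith [hgmean a]
  · rw [div_lt_iff₀ hδ] at hn'
    have h1 : (1 / 3 : ℝ) ^ (k + (n + 1)) ≤ (1 / 3) ^ (n + 1) :=
      pow_le_pow_of_le_one (by norm_num) (by norm_num) (by omega)
    refine h1.trans_lt ?_
    rw [one_div, inv_pow, inv_lt_iff_one_lt_mul₀ (by positivity)]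
    linarith

/-! ### Measurability -/

instance : Countable (Mode K) := by
  let f : Mode K → Option (Fin K ⊕ Answer K) := fun m => match m with
    | .explore => none
    | .exploit a => some (.inl a)
    | .halted o => some (.inr o)
  refine Function.Injective.countable (f := f) fun m m' h => ?_
  rcases m with _ | a | o <;> rcases m' with _ | a' | o' <;> simp_all [f]

instance : Countable (State K) := by
  let f : State K → ℕ × Mode K × (Fin K → ℕ) × Finset (Fin K) × (Fin K → ℕ) :=
    fun s => (s.phase, s.mode, s.nee, s.held, s.net)
  refine Function.Injective.countable (f := f) fun s s' h => ?_
  cases s; cases s'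
  simpa [f] using h

/-- The states are countable and carry the discrete σ-algebra. -/
instance : MeasurableSpace (State K) := ⊤

instance : DiscreteMeasurableSpace (State K) := ⟨fun _ => trivial⟩

lemma measurable_comp_param {X S T : Type*} [MeasurableSpace X] [Countable S] [MeasurableSpace T]
    {f : X → S → T} {g : X → S} (hf : ∀ s, Measurable fun x => f x s)
    (hg : ∀ s, MeasurableSet {x | g x = s}) : Measurable fun x => f x (g x) := by
  intro U hU
  have : (fun x => f x (g x)) ⁻¹' U = ⋃ s, {x | g x = s} ∩ (fun x => f x s) ⁻¹' U := by
    ext x; simp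
  rw [this]
  exact MeasurableSet.iUnion fun s => (hg s).inter (hf s hU)

lemma measurable_ucb (d : ℝ) (nee : Fin K → ℕ) (a : Fin K) :
    Measurable fun x : Rewards K => ucb x d nee a := by
  unfold ucb
  split_ifs
  · exact measurable_const
  · exact measurable_coe_real_ereal.comp ((measurable_empMean .ee a _).add_const _)

lemma measurable_lcb (C d : ℝ) (nee : Fin K → ℕ) (a : Fin K) :
    Measurable fun x : Rewards K => lcb C x d nee a := by
  unfold lcb
  split_ifs
  · exact measurable_const
  · exact measurable_coe_real_ereal.comp ((measurable_empMean .ee a _).sub_const _)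

open Classical in
lemma measurableSet_selectArm (P : Input K) (d : ℝ) (nee : Fin K → ℕ) (A : Fin K) :
    MeasurableSet {x : Rewards K | P.selectArm x d nee = A} := by
  let best : Rewards K → Finset (Fin K) := fun x =>
    Finset.univ.filter fun a => ∀ b, ucb x d nee b ≤ ucb x d nee a
  have hS : ∀ S, MeasurableSet {x | best x = S} := by
    intro S
    have : {x | best x = S} = ⋂ a, {x | (∀ b, ucb x d nee b ≤ ucb x d nee a) ↔ a ∈ S} := by
      ext x; simp [best, Finset.ext_iff]
    rw [this]
    refine MeasurableSet.iInter fun a => ?_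
    have h1 : MeasurableSet {x : Rewards K | ∀ b, ucb x d nee b ≤ ucb x d nee a} := by
      simp only [Set.ofPred_forall]
      exact MeasurableSet.iInter fun b =>
        measurableSet_le (measurable_ucb d nee b) (measurable_ucb d nee a)
    by_cases ha : a ∈ S
    · simpa only [ha, iff_true] using h1
    · simp only [ha, iff_false]
      exact h1.compl
  have : {x : Rewards K | P.selectArm x d nee = A} =
      ⋃ S, ⋃ _ : P.tieBreak S = A, {x | best x = S} := by
    ext x
    simp only [Set.mem_ofPred_eq, Set.mem_iUnion, exists_prop]
    exact ⟨fun h => ⟨best x, h, rfl⟩, fun ⟨S, h, hS⟩ => by rw [← hS] at h; exact h⟩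
  rw [this]
  exact MeasurableSet.iUnion fun S => MeasurableSet.iUnion fun _ => hS S

open Classical in
lemma measurable_step (P : Input K) (s : State K) : Measurable fun x => P.step x s := by
  rcases hm : s.mode with _ | a | o
  · simp only [Input.step, hm]
    unfold Input.exploreStep
    refine measurable_comp_param (g := fun x => P.selectArm x (P.dSeq s.phase) s.nee)
      (f := fun x A =>
        let d := P.dSeq s.phase
        let nee' := Function.update s.nee A (s.nee A + 1)
        let held' := s.held.erase A
        if P.Tee s.phase ≤ eeCount nee' held' then
          { s with phase := s.phase + 1, nee := nee', held := held' }
        else if ∀ a, ucb x d nee' a ≤ (P.threshold : EReal) then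
          if d < P.conf / 3 then { s with mode := .halted none, nee := nee', held := held' }
          else { s with phase := s.phase + 1, nee := nee', held := held' }
        else if (P.threshold : EReal) < lcb P.C x d nee' A then
          { s with mode := .exploit A, nee := s.nee, held := insert A held' }
        else { s with nee := nee', held := held' })
      (fun A => ?_) (measurableSet_selectArm P _ _)
    refine Measurable.ite (MeasurableSet.const _) measurable_const ?_
    refine Measurable.ite ?_ (Measurable.ite (MeasurableSet.const _) measurable_const
      measurable_const) (Measurable.ite ?_ measurable_const measurable_const)
    · simp only [Set.ofPred_forall]
      exact MeasurableSet.iInter fun b => measurableSet_le (measurable_ucb _ _ _) measurable_const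
    · exact measurableSet_lt measurable_const (measurable_lcb _ _ _ _)
  · simp only [Input.step, hm]
    unfold Input.exploitStep
    refine Measurable.ite (MeasurableSet.const _) ?_ measurable_const
    exact Measurable.ite (measurableSet_lt measurable_const
      ((measurable_empMean .et a _).sub_const _)) measurable_const measurable_const
  · simp only [Input.step, hm]
    exact measurable_const

lemma measurable_run (P : Input K) (n : ℕ) : Measurable fun x => P.run x n := by
  induction n with
  | zero => exact measurable_const
  | succ n ih =>
    simp only [Input.run_succ]
    exact measurable_comp_param (f := fun x s => P.step x s) (measurable_step P)
      fun s => ih (measurableSet_singleton s)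

lemma run_eq_of_halted {P : Input K} {x : Rewards K} {n : ℕ} {o : Answer K}
    (h : (P.run x n).mode = .halted o) {m : ℕ} (hnm : n ≤ m) : P.run x m = P.run x n := by
  induction m, hnm using Nat.le_induction with
  | base => rfl
  | succ m _ ih => rw [Input.run_succ, ih, Input.step_halted P x h]

lemma outcome_of_halted {P : Input K} {x : Rewards K} {n : ℕ} {o : Answer K}
    (h : (P.run x n).mode = .halted o) :
    P.outcome x = { time := ((P.run x n).pulls : ℕ∞), answer := some o } := by
  have hex : ∃ n o, (P.run x n).mode = .halted o := ⟨n, o, h⟩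
  have heq : P.run x hex.choose = P.run x n := by
    rcases le_total n hex.choose with hle | hle
    · exact run_eq_of_halted h hle
    · exact (run_eq_of_halted hex.choose_spec.choose_spec hle).symm
  have ho : hex.choose_spec.choose = o := by
    have h1 : (P.run x hex.choose).mode = .halted o := by rw [heq]; exact h
    have h2 := hex.choose_spec.choose_spec.symm.trans h1
    injection h2
  have hp : (P.run x hex.choose).pulls = (P.run x n).pulls := by rw [heq]
  unfold Input.outcome
  rw [dif_pos hex, hp, ho]

lemma outcome_of_never {P : Input K} {x : Rewards K}
    (h : ¬ ∃ n o, (P.run x n).mode = .halted o) :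
    P.outcome x = { time := ⊤, answer := none } := by
  unfold Input.outcome
  rw [dif_neg h]

/-- An event described by the outcome is a countable union of events described by the states,
and the event that the algorithm never stops. -/
lemma measurableSet_outcome (P : Input K) (p : Outcome K → Prop) :
    MeasurableSet {x | p (P.outcome x)} := by
  have hE : ∀ (S : Set (State K)) (n : ℕ), MeasurableSet {x | P.run x n ∈ S} := fun S n =>
    measurable_run P n (MeasurableSet.of_discrete)
  have hhalt : MeasurableSet {x | ∃ n o, (P.run x n).mode = .halted o} := by
    simp only [Set.ofPred_exists]
    exact MeasurableSet.iUnion fun n => MeasurableSet.iUnion fun o =>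
      hE {s | s.mode = .halted o} n
  have : {x | p (P.outcome x)} =
      (⋃ n, {x | P.run x n ∈ {s : State K | ∃ o, s.mode = .halted o ∧
        p { time := (s.pulls : ℕ∞), answer := some o }}}) ∪
      ({x | ∃ n o, (P.run x n).mode = .halted o}ᶜ ∩ {_x | p { time := ⊤, answer := none }}) := by
    ext x
    simp only [Set.mem_ofPred_eq, Set.mem_union, Set.mem_iUnion, Set.mem_inter_iff,
      Set.mem_compl_iff]
    by_cases hex : ∃ n o, (P.run x n).mode = .halted o
    · obtain ⟨n, o, h⟩ := id hex
      constructor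
      · intro hp
        rw [outcome_of_halted h] at hp
        exact .inl ⟨n, o, h, hp⟩
      · rintro (⟨m, o', h', hp⟩ | hp)
        · rwa [outcome_of_halted h']
        · exact absurd hex hp.1
    · rw [outcome_of_never hex]
      constructor
      · exact fun hp => .inr ⟨hex, hp⟩
      · rintro (⟨m, o', h', hp⟩ | hp)
        · exact absurd ⟨m, o', h'⟩ hex
        · exact hp.2
  rw [this]
  exact (MeasurableSet.iUnion fun n => hE _ n).union
    (hhalt.compl.inter (MeasurableSet.const _))

lemma isMeasurableAlg_see (tieBreak : Finset (Fin K) → Fin K) (μ₀ C δ : ℝ) :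
    IsMeasurableAlg (SEE tieBreak μ₀ C δ) :=
  ⟨fun t => measurableSet_outcome _ fun o => o.time = t,
    fun a => measurableSet_outcome _ fun o => o.answer = a⟩

/-! ### Correctness -/

lemma one_le_phase_run (P : Input K) (x : Rewards K) (n : ℕ) : 1 ≤ (P.run x n).phase := by
  induction n with
  | zero => exact le_rfl
  | succ n ih =>
    rw [Input.run_succ]
    exact ih.trans (Accounting.phase_step P x _).1

/-- The evidence with which SEE stops. -/
lemma evidence_of_halted {tieBreak : Finset (Fin K) → Fin K} {μ₀ C δ : ℝ} {x : Rewards K} {n : ℕ}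
    {o : Answer K} (h : ((seeInput tieBreak μ₀ C δ).run x n).mode = .halted o) :
    (o = none ∧ ∃ (k : ℕ) (nee : Fin K → ℕ), (1 / 3 : ℝ) ^ k < δ / 3 ∧
      ∀ a, ucb x ((1 / 3) ^ k) nee a ≤ (μ₀ : EReal)) ∨
    ∃ a, o = some a ∧ ∃ k t : ℕ, 1 ≤ k ∧ 1 ≤ t ∧
      μ₀ < empMean x .et a t - radius t (δ / (K * 5 ^ k)) := by
  set P := seeInput tieBreak μ₀ C δ
  induction n with
  | zero => cases h
  | succ n ih =>
    rw [Input.run_succ] at h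
    have hph := one_le_phase_run P x n
    rcases hm : (P.run x n).mode with _ | a | o'
    · rcases P.exploreStep_cases x _ hm with c | c | c | c | c <;>
        rw [← Input.step_explore P x hm] at c
      · rw [c.2.1] at h; cases h
      · obtain ⟨-, hu, hd, hm', -⟩ := c
        rw [hm'] at h
        injection h with h
        exact .inl ⟨h.symm, _, _, hd, hu⟩
      · rw [c.2.2.2.1] at h; cases h
      · rw [c.2.2.1] at h; cases h
      · rw [c.2.2.2.1] at h; cases h
    · obtain ⟨-, -, c⟩ := P.exploitStep_cases x _ a hm
      rw [← Input.step_exploit P x hm] at c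
      rcases c with c | c | c
      · obtain ⟨-, hok, hm', -⟩ := c
        rw [hm'] at h
        injection h with h
        exact .inr ⟨a, h.symm, (P.run x n).phase, _, hph, Nat.le_add_left 1 _, hok⟩
      · rw [c.2.2.1] at h; cases h
      · rw [c.2.1] at h; cases h
    · rw [Input.step_halted P x hm] at h
      exact ih h

/-- Some confidence bound on which a stopping rule relies fails: that of the best arm `b` in a
phase from `k₀` on, or that of some arm in an exploitation period. -/
def Instance.errorEvent (I : Instance K) (b : Fin K) (k₀ : ℕ) (δ : ℝ) : Set (Rewards K) :=
  (⋃ j : ℕ, I.lowerDev .ee b ((1 / 3) ^ (k₀ + j) / K)) ∪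
    ⋃ j : ℕ, ⋃ a, I.upperDev .et a (δ / (K * 5 ^ (j + 1)))

lemma Instance.measurableSet_errorEvent (I : Instance K) (b : Fin K) (k₀ : ℕ) (δ : ℝ) :
    MeasurableSet (I.errorEvent b k₀ δ) :=
  (MeasurableSet.iUnion fun _ => I.measurableSet_lowerDev _ _ _).union
    (MeasurableSet.iUnion fun _ => MeasurableSet.iUnion fun _ => I.measurableSet_upperDev _ _ _)

lemma Instance.measure_errorEvent_le (I : Instance K) (hK : 1 ≤ K) (b : Fin K) {k₀ : ℕ} {δ : ℝ}
    (hδ : 0 < δ) (hk₀ : (1 / 3 : ℝ) ^ k₀ < δ / 3) :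
    I.rewardLaw (I.errorEvent b k₀ δ) ≤ ENNReal.ofReal (3 / 4 * δ) := by
  have hK' : (1 : ℝ) ≤ K := by exact_mod_cast hK
  have h1 : I.rewardLaw (⋃ j : ℕ, I.lowerDev .ee b ((1 / 3) ^ (k₀ + j) / K)) ≤
      ENNReal.ofReal (δ / 2) := by
    have hs : HasSum (fun j : ℕ => δ / 3 * (1 / 3 : ℝ) ^ j) (δ / 3 * (1 - 1 / 3)⁻¹) :=
      (hasSum_geometric_of_lt_one (by norm_num) (by norm_num)).mul_left _
    calc _ ≤ ∑' j : ℕ, I.rewardLaw (I.lowerDev .ee b ((1 / 3) ^ (k₀ + j) / K)) :=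
          measure_iUnion_le _
      _ ≤ ∑' j : ℕ, ENNReal.ofReal (δ / 3 * (1 / 3 : ℝ) ^ j) := by
          refine ENNReal.tsum_le_tsum fun j =>
            (I.measure_lowerDev_le .ee b (by positivity)).trans (ENNReal.ofReal_le_ofReal ?_)
          calc (1 / 3 : ℝ) ^ (k₀ + j) / K ≤ (1 / 3) ^ (k₀ + j) := div_le_self (by positivity) hK'
            _ = (1 / 3) ^ k₀ * (1 / 3) ^ j := pow_add _ _ _
            _ ≤ δ / 3 * (1 / 3) ^ j := by gcongr
      _ = ENNReal.ofReal (δ / 2) := by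
          rw [← ENNReal.ofReal_tsum_of_nonneg (fun j => by positivity) hs.summable, hs.tsum_eq]
          congr 1
          ring
  have h2 : I.rewardLaw (⋃ j : ℕ, ⋃ a, I.upperDev .et a (δ / (K * 5 ^ (j + 1)))) ≤
      ENNReal.ofReal (δ / 4) := by
    have hs : HasSum (fun j : ℕ => δ / 5 * (1 / 5 : ℝ) ^ j) (δ / 5 * (1 - 1 / 5)⁻¹) :=
      (hasSum_geometric_of_lt_one (by norm_num) (by norm_num)).mul_left _
    calc _ ≤ ∑' j : ℕ, I.rewardLaw (⋃ a, I.upperDev .et a (δ / (K * 5 ^ (j + 1)))) :=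
          measure_iUnion_le _
      _ ≤ ∑' j : ℕ, ENNReal.ofReal (δ / 5 * (1 / 5 : ℝ) ^ j) := by
          refine ENNReal.tsum_le_tsum fun j => ?_
          calc _ ≤ ∑ a : Fin K, I.rewardLaw (I.upperDev .et a (δ / (K * 5 ^ (j + 1)))) :=
                measure_iUnion_fintype_le _ _
            _ ≤ ∑ _a : Fin K, ENNReal.ofReal (δ / (K * 5 ^ (j + 1))) :=
                Finset.sum_le_sum fun a _ => I.measure_upperDev_le _ a (by positivity)
            _ = ENNReal.ofReal (δ / 5 * (1 / 5 : ℝ) ^ j) := by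
                rw [Finset.sum_const, Finset.card_univ, Fintype.card_fin, nsmul_eq_mul,
                  ← ENNReal.ofReal_natCast, ← ENNReal.ofReal_mul (by positivity)]
                congr 1
                rw [one_div, inv_pow]
                field_simp
                ring
      _ = ENNReal.ofReal (δ / 4) := by
          rw [← ENNReal.ofReal_tsum_of_nonneg (fun j => by positivity) hs.summable, hs.tsum_eq]
          congr 1
          ring
  calc _ ≤ ENNReal.ofReal (δ / 2) + ENNReal.ofReal (δ / 4) :=
        (measure_union_le _ _).trans (add_le_add h1 h2)
    _ = ENNReal.ofReal (3 / 4 * δ) := by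
        rw [← ENNReal.ofReal_add (by positivity) (by positivity)]
        congr 1
        ring

lemma mem_correct_of_halted {I : Instance K} {μ₀ C δ : ℝ} {tieBreak : Finset (Fin K) → Fin K}
    {b : Fin K} (hb : I.mean b = I.best) {k₀ : ℕ} (hk₀ : ∀ k : ℕ, (1 / 3 : ℝ) ^ k < δ / 3 → k₀ ≤ k)
    {x : Rewards K} (hx : x ∉ I.errorEvent b k₀ δ) {n : ℕ} {o : Answer K}
    (h : ((seeInput tieBreak μ₀ C δ).run x n).mode = .halted o) : o ∈ I.correct μ₀ := by
  simp only [Instance.errorEvent, Set.mem_union, Set.mem_iUnion, not_or, not_exists,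
    Instance.lowerDev, Instance.upperDev, Set.mem_ofPred_eq, not_and, not_lt] at hx
  obtain ⟨hx1, hx2⟩ := hx
  rcases evidence_of_halted h with ⟨rfl, k, nee, hk, hu⟩ | ⟨a, rfl, k, t, hk, ht, hlt⟩
  · by_cases hpos : I ∈ posSet K μ₀
    · exfalso
      have hub := hu b
      unfold ucb at hub
      split_ifs at hub with h0
      · simp at hub
      · have h1 := EReal.coe_le_coe_iff.1 hub
        obtain ⟨j, rfl⟩ := Nat.exists_eq_add_of_le (hk₀ k hk)
        have h2 := hx1 j (nee b) (Nat.one_le_iff_ne_zero.2 h0)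
        have h3 : μ₀ < I.best := hpos
        linarith
    · simp [Instance.correct, hpos]
  · obtain ⟨j, rfl⟩ : ∃ j, k = j + 1 := ⟨k - 1, by omega⟩
    have h1 := hx2 j a t ht
    have h2 : μ₀ < I.mean a := by linarith
    have hpos : I ∈ posSet K μ₀ := h2.trans_le (I.mean_le_best a)
    simp only [Instance.correct, hpos, if_true]
    exact ⟨a, rfl, h2.le⟩

/-- A finite expected stopping time makes the algorithm stop almost surely. -/
lemma measure_time_eq_top {alg : Rewards K → Outcome K} {I : Instance K}
    (hm : MeasurableSet {x | (alg x).time = ⊤}) (h : expectedTime alg I < ⊤) :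
    I.rewardLaw {x | (alg x).time = ⊤} = 0 := by
  by_contra h0
  have h1 : ∫⁻ x, {x | (alg x).time = ⊤}.indicator (fun _ => (⊤ : ℝ≥0∞)) x ∂I.rewardLaw ≤
      expectedTime alg I := by
    refine lintegral_mono fun x => ?_
    by_cases hx : (alg x).time = ⊤ <;> simp [hx]
  rw [lintegral_indicator_const hm, ENNReal.top_mul h0] at h1
  exact absurd (h1.trans_lt h) (lt_irrefl _)

theorem isDeltaPAC_see {tieBreak : Finset (Fin K) → Fin K} {μ₀ C : ℝ} (hK : 1 ≤ K)
    (hfin : ∀ δ : ℝ, 0 < δ → δ < 1 → ∀ I ∈ posSet K μ₀ ∪ negSet K μ₀,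
      expectedTime (SEE tieBreak μ₀ C δ) I < ⊤) :
    IsDeltaPAC μ₀ (SEE tieBreak μ₀ C) := by
  classical
  intro δ hδ hδ1 I hI
  obtain ⟨b, hb⟩ := I.exists_mean_eq_best hK
  have hex : ∃ k : ℕ, (1 / 3 : ℝ) ^ k < δ / 3 :=
    exists_pow_lt_of_lt_one (by positivity) (by norm_num)
  have hmeas := (isMeasurableAlg_see tieBreak μ₀ C δ).1 ⊤
  have hzero := measure_time_eq_top hmeas (hfin δ hδ hδ1 I hI)
  set N := I.errorEvent b (Nat.find hex) δ
  set T := {x | (SEE tieBreak μ₀ C δ x).time = ⊤}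
  have hNT : I.rewardLaw (N ∪ T) ≤ ENNReal.ofReal (3 / 4 * δ) := by
    refine (measure_union_le _ _).trans ?_
    rw [hzero, add_zero]
    exact I.measure_errorEvent_le hK b hδ (Nat.find_spec hex)
  have hmNT : MeasurableSet (N ∪ T) := (I.measurableSet_errorEvent _ _ _).union hmeas
  calc ENNReal.ofReal (1 - δ) < ENNReal.ofReal (1 - 3 / 4 * δ) :=
        (ENNReal.ofReal_lt_ofReal_iff (by linarith)).2 (by linarith)
    _ = 1 - ENNReal.ofReal (3 / 4 * δ) := by
        rw [ENNReal.ofReal_sub _ (by positivity), ENNReal.ofReal_one]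
    _ ≤ 1 - I.rewardLaw (N ∪ T) := tsub_le_tsub_left hNT 1
    _ = I.rewardLaw (N ∪ T)ᶜ := (prob_compl_eq_one_sub hmNT).symm
    _ ≤ _ := by
        refine measure_mono fun x hx => ?_
        rw [Set.mem_compl_iff, Set.mem_union, not_or] at hx
        have hlt : (SEE tieBreak μ₀ C δ x).time < ⊤ := lt_top_iff_ne_top.2 hx.2
        refine ⟨hlt, ?_⟩
        by_cases hfinal : ∃ n o, ((seeInput tieBreak μ₀ C δ).run x n).mode = .halted o
        · obtain ⟨n, o, h⟩ := hfinal
          refine ⟨o, mem_correct_of_halted hb (fun k hk => Nat.find_min' hex hk) hx.1 h, ?_⟩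
          rw [SEE_eq, outcome_of_halted h]
        · rw [SEE_eq, outcome_of_never hfinal] at hlt
          exact absurd hlt (lt_irrefl _)

/-- With a gap of at least `Δ`, all arms can be settled at the same level. -/
theorem iSup_expectedTime_lt_top {tieBreak : Finset (Fin K) → Fin K} {μ₀ C : ℝ} (hK : 1 ≤ K)
    (htie : ∀ s : Finset (Fin K), s.Nonempty → tieBreak s ∈ s) (hC : 1 < C) {Δ δ : ℝ}
    (hΔ : 0 < Δ) (hδ : 0 < δ) (hδ1 : δ < 1) :
    ⨆ I ∈ posGapSet K μ₀ Δ ∪ negGapSet K μ₀ Δ, expectedTime (SEE tieBreak μ₀ C δ) I < ⊤ := by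
  obtain ⟨c, -, hpos⟩ := exists_expectedTime_pos_le hC
  obtain ⟨c', -, hneg⟩ := exists_expectedTime_neg_le hC
  set g := min Δ 1 / 2 with hg
  have hm0 : 0 < min Δ 1 := lt_min hΔ one_pos
  have hg0 : 0 < g := by positivity
  have hg1 : g ≤ 1 := by linarith [min_le_right Δ 1]
  have hgΔ : 2 * g ≤ Δ := by linarith [min_le_left Δ 1]
  refine lt_of_le_of_lt (iSup₂_le fun I hI => ?_) (ENNReal.add_lt_top.2
    ⟨ENNReal.ofReal_lt_top (r := c * ((∑ _a : Fin K, 1 / g ^ 2) * (1 + Real.log (K / g ^ 2)) +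
      1 / g ^ 2 * (Real.log (1 / δ) + (1 + Real.log (K / g ^ 2))))),
    ENNReal.ofReal_lt_top (r := c' * ((∑ _a : Fin K, 1 / g ^ 2) *
      (1 + Real.log (K / g ^ 2) + Real.log (1 / δ))))⟩)
  rcases hI with hI | hI
  · have hI' : Δ ≤ I.best - μ₀ := hI
    refine (hpos K tieBreak μ₀ δ I hK htie hδ hδ1 (show μ₀ < I.best by linarith) (fun _ => g) g
      hg0 (fun _ => le_rfl) (fun _ => hg1) (fun a => ?_) (by linarith)).trans le_self_add
    rw [le_max_iff, I.gapOne_eq]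
    by_contra! hcon
    have := neg_abs_le (μ₀ - I.mean a)
    unfold Instance.gapZero at hcon
    linarith [hcon.1, hcon.2]
  · have hI' : Δ ≤ μ₀ - I.best := hI
    exact (hneg K tieBreak μ₀ δ I hK htie hδ hδ1 (fun _ => g) g hg0 (fun _ => le_rfl)
      (fun _ => hg1) (fun a => by linarith [I.mean_le_best a])).trans le_add_self

/-! ### The bounds in terms of the complexities -/

/-- The levels `max (Δ_{0,a}, Δ_{1,a}) / 2` and `Δ_{0,1} / 4` lie in `(0, 1]`. The condition
`2 ≤ K ∨ δ ≤ 1 / 2` bounds the additive constants. -/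
theorem exists_expectedTime_le_Hpos {C : ℝ} (hC : 1 < C) : ∃ γ : ℝ, 0 < γ ∧
    ∀ (K : ℕ) (tieBreak : Finset (Fin K) → Fin K) (μ₀ δ : ℝ) (I : Instance K),
      1 ≤ K → (∀ s : Finset (Fin K), s.Nonempty → tieBreak s ∈ s) → 0 < δ → δ < 1 →
      (∀ a, I.gapZero μ₀ a ≤ 1) → I ∈ posSet K μ₀ → (2 ≤ K ∨ δ ≤ 1 / 2) →
      expectedTime (SEE tieBreak μ₀ C δ) I ≤ ENNReal.ofReal (γ *
        (Real.log (1 / δ) / I.gap μ₀ ^ 2 + Real.log (K / I.gap μ₀ ^ 2) * I.Hpos μ₀)) := by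
  obtain ⟨c, hc, hpos⟩ := exists_expectedTime_pos_le hC
  refine ⟨176 * c, by positivity, ?_⟩
  intro K tieBreak μ₀ δ I hK htie hδ hδ1 hgap hI hKδ
  obtain ⟨b, hb⟩ := I.exists_mean_eq_best hK
  have hI' : μ₀ < I.best := hI
  have hgap_eq : I.gap μ₀ = I.best - μ₀ := by
    rw [Instance.gap, abs_sub_comm, abs_of_pos (by linarith)]
  have hgb : I.gapZero μ₀ b = I.gap μ₀ := by rw [Instance.gapZero, hb, Instance.gap]
  have hg0 : 0 < I.gap μ₀ := by rw [hgap_eq]; linarith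
  have hg1 : I.gap μ₀ ≤ 1 := hgb ▸ hgap b
  have hone : ∀ a, I.gapOne a ≤ I.gap μ₀ + I.gapZero μ₀ a := fun a => by
    rw [I.gapOne_eq, hgap_eq, Instance.gapZero]
    linarith [le_abs_self (μ₀ - I.mean a)]
  have hzero : ∀ a, I.gap μ₀ ≤ I.gapOne a + I.gapZero μ₀ a := fun a => by
    rw [I.gapOne_eq, hgap_eq, Instance.gapZero]
    linarith [neg_abs_le (μ₀ - I.mean a)]
  have hlow : ∀ a, I.gap μ₀ / 2 ≤ max (I.gapZero μ₀ a) (I.gapOne a) := fun a => by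
    linarith [hzero a, le_max_left (I.gapZero μ₀ a) (I.gapOne a),
      le_max_right (I.gapZero μ₀ a) (I.gapOne a)]
  have hz0 : ∀ a, 0 ≤ I.gapZero μ₀ a := fun a => abs_nonneg _
  have ho0 : ∀ a, 0 ≤ I.gapOne a := fun a => abs_nonneg _
  have hsum : ∑ a, 1 / (max (I.gapZero μ₀ a) (I.gapOne a) / 2) ^ 2 = 2 * I.Hpos μ₀ := by
    rw [Instance.Hpos, Finset.mul_sum]
    refine Finset.sum_congr rfl fun a _ => ?_
    have hmax : max (I.gapZero μ₀ a ^ 2) (I.gapOne a ^ 2) =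
        max (I.gapZero μ₀ a) (I.gapOne a) ^ 2 := by
      rcases le_total (I.gapZero μ₀ a) (I.gapOne a) with h | h
      · rw [max_eq_right h, max_eq_right (pow_le_pow_left₀ (hz0 a) h 2)]
      · rw [max_eq_left h, max_eq_left (pow_le_pow_left₀ (ho0 a) h 2)]
    rw [hmax, div_pow, one_div_div]
    ring
  have hmain := hpos K tieBreak μ₀ δ I hK htie hδ hδ1 hI
    (fun a => max (I.gapZero μ₀ a) (I.gapOne a) / 2) (I.gap μ₀ / 4) (by positivity)
    (fun a => by linarith [hlow a])
    (fun a => by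
      rw [div_le_one two_pos]
      exact max_le (by linarith [hgap a]) (by linarith [hone a, hgap a]))
    (fun a => by linarith [hlow a]) (by linarith)
  refine hmain.trans (ENNReal.ofReal_le_ofReal ?_)
  have hK' : (1 : ℝ) ≤ K := by exact_mod_cast hK
  have hW := log_one_div_pos hδ hδ1
  have hlog : 1 + Real.log (K / (I.gap μ₀ / 4) ^ 2) ≤ 4 + Real.log (K / I.gap μ₀ ^ 2) := by
    rw [show (K : ℝ) / (I.gap μ₀ / 4) ^ 2 = 2 ^ 4 * (K / I.gap μ₀ ^ 2) by field_simp; norm_num,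
      Real.log_mul (by norm_num) (by positivity), Real.log_pow]
    push_cast
    linarith [Real.log_two_lt_d9]
  have hH : 2 / I.gap μ₀ ^ 2 ≤ I.Hpos μ₀ := by
    have h1 : 2 / max (I.gapZero μ₀ b ^ 2) (I.gapOne b ^ 2) = 2 / I.gap μ₀ ^ 2 := by
      rw [hgb, I.gapOne_eq, hb, sub_self, max_eq_left (by rw [zero_pow two_ne_zero]; positivity)]
    rw [← h1]
    exact Finset.single_le_sum (f := fun a => 2 / max (I.gapZero μ₀ a ^ 2) (I.gapOne a ^ 2))
      (fun a _ => by positivity) (Finset.mem_univ b)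
  have hL := log_ratio_nonneg hK hg0 hg1
  set L := Real.log (K / I.gap μ₀ ^ 2)
  set W := Real.log (1 / δ)
  set v := 1 / I.gap μ₀ ^ 2 with hv
  have hv0 : 0 < v := by positivity
  have hvH : 2 * v ≤ I.Hpos μ₀ := by rw [hv, mul_one_div]; exact hH
  have hv16 : 1 / (I.gap μ₀ / 4) ^ 2 = 16 * v := by rw [hv]; field_simp; norm_num
  have hWv : W / I.gap μ₀ ^ 2 = v * W := by rw [hv]; ring
  have hlog2 := Real.log_two_gt_d9
  have hconst : I.Hpos μ₀ ≤ 2 * (L * I.Hpos μ₀) + 4 * (v * W) := by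
    by_cases hK2 : 2 ≤ K
    · have h2 : (2 : ℝ) ≤ K := by exact_mod_cast hK2
      have h3 : Real.log 2 ≤ L := by
        refine Real.log_le_log two_pos ?_
        rw [le_div_iff₀ (by positivity)]
        have : I.gap μ₀ ^ 2 ≤ 1 := pow_le_one₀ hg0.le hg1
        linarith
      have h4 := mul_le_mul_of_nonneg_right (show 1 ≤ 2 * L by linarith)
        (show 0 ≤ I.Hpos μ₀ by linarith)
      have h5 : 0 ≤ v * W := by positivity
      linarith
    · obtain rfl : K = 1 := by omega
      have h2 : I.Hpos μ₀ = 2 * v := by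
        have hb0 : b = 0 := Subsingleton.elim _ _
        rw [Instance.Hpos, Fin.sum_univ_one, ← hb0, hgb, I.gapOne_eq, hb, sub_self,
          max_eq_left (by rw [zero_pow two_ne_zero]; positivity), hv]
        ring
      have h3 : Real.log 2 ≤ W := by
        refine Real.log_le_log two_pos ?_
        rw [le_div_iff₀ hδ]
        linarith [hKδ.resolve_left hK2]
      have h4 := mul_le_mul_of_nonneg_left (show 1 / 2 ≤ W by linarith) hv0.le
      have h5 : 0 ≤ L * I.Hpos μ₀ := mul_nonneg hL (by linarith)
      linarith
  rw [hsum, hv16, hWv]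
  have e1 := mul_le_mul_of_nonneg_left hlog (show 0 ≤ 2 * I.Hpos μ₀ by linarith)
  have e2 := mul_le_mul_of_nonneg_left hlog (show 0 ≤ 16 * v by linarith)
  have e3 := mul_le_mul_of_nonneg_right hvH (show 0 ≤ 4 + L by linarith)
  have hfin : 2 * I.Hpos μ₀ * (1 + Real.log (K / (I.gap μ₀ / 4) ^ 2)) +
      16 * v * (W + (1 + Real.log (K / (I.gap μ₀ / 4) ^ 2))) ≤
      176 * (v * W + L * I.Hpos μ₀) := by
    have h5 : 0 ≤ L * I.Hpos μ₀ := mul_nonneg hL (by linarith)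
    linarith
  calc _ ≤ c * (176 * (v * W + L * I.Hpos μ₀)) := by gcongr
    _ = _ := by ring

/-- The number of arms and the inverse square of the smallest gap are at most `Hneg / 2`, so the
logarithms are bounded by `log Hneg`, and `2 ≤ Hneg` absorbs the additive constants. -/
theorem exists_expectedTime_le_Hneg {C : ℝ} (hC : 1 < C) : ∃ γ : ℝ, 0 < γ ∧
    ∀ (K : ℕ) (tieBreak : Finset (Fin K) → Fin K) (μ₀ δ : ℝ) (I : Instance K),
      1 ≤ K → (∀ s : Finset (Fin K), s.Nonempty → tieBreak s ∈ s) → 0 < δ → δ < 1 →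
      (∀ a, I.gapZero μ₀ a ≤ 1) → I ∈ negSet K μ₀ →
      expectedTime (SEE tieBreak μ₀ C δ) I ≤ ENNReal.ofReal (γ *
        (I.Hneg μ₀ * (Real.log (1 / δ) + Real.log (I.Hneg μ₀)))) := by
  obtain ⟨c, hc, hneg⟩ := exists_expectedTime_neg_le hC
  refine ⟨2 * c, by positivity, ?_⟩
  intro K tieBreak μ₀ δ I hK htie hδ hδ1 hgap hI
  obtain ⟨b, hb⟩ := I.exists_mean_eq_best hK
  have hI' : I.best < μ₀ := hI
  have hzero : ∀ a, I.gapZero μ₀ a = μ₀ - I.mean a := fun a =>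
    abs_of_pos (by linarith [I.mean_le_best a])
  have hz0 : ∀ a, 0 < I.gapZero μ₀ a := fun a => by
    rw [hzero]; linarith [I.mean_le_best a]
  have hmain := hneg K tieBreak μ₀ δ I hK htie hδ hδ1 (I.gapZero μ₀) (I.gapZero μ₀ b) (hz0 b)
    (fun a => by rw [hzero, hzero, hb]; linarith [I.mean_le_best a]) hgap
    (fun a => by rw [hzero]; linarith)
  refine hmain.trans (ENNReal.ofReal_le_ofReal ?_)
  have hK' : (1 : ℝ) ≤ K := by exact_mod_cast hK
  have hW := log_one_div_pos hδ hδ1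
  have hKG := natCast_le_sum_one_div_sq hz0 hgap
  have hbG : 1 / I.gapZero μ₀ b ^ 2 ≤ ∑ a, 1 / I.gapZero μ₀ a ^ 2 :=
    Finset.single_le_sum (f := fun a => 1 / I.gapZero μ₀ a ^ 2) (fun a _ => by positivity)
      (Finset.mem_univ b)
  have hH : I.Hneg μ₀ = 2 * ∑ a, 1 / I.gapZero μ₀ a ^ 2 := by
    rw [Instance.Hneg, Finset.mul_sum]
    exact Finset.sum_congr rfl fun a _ => by ring
  set G := ∑ a, 1 / I.gapZero μ₀ a ^ 2
  have hG1 : 1 ≤ G := hK'.trans hKG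
  have hlogH : Real.log (I.Hneg μ₀) = Real.log 2 + Real.log G := by
    rw [hH, Real.log_mul two_ne_zero (by linarith)]
  have hl : Real.log (K / I.gapZero μ₀ b ^ 2) ≤ 2 * Real.log G := by
    have hb0 := hz0 b
    rw [div_eq_mul_one_div, Real.log_mul (by positivity) (by positivity)]
    have h1 := Real.log_le_log (by positivity) hKG
    have h2 := Real.log_le_log (by positivity) hbG
    linarith
  have hG0 : 0 ≤ Real.log G := Real.log_nonneg hG1
  have hlog2 := Real.log_two_gt_d9
  calc c * (G * (1 + Real.log (K / I.gapZero μ₀ b ^ 2) + Real.log (1 / δ)))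
      ≤ c * (G * (4 * (Real.log (1 / δ) + Real.log (I.Hneg μ₀)))) := by
        gcongr
        linarith
    _ = _ := by rw [hH]; ring

end OneIdent

theorem mainTheorem1 (C : ℝ) (hC : 1 < C) :
    (∃ γ : ℝ, 0 < γ ∧
      ∀ (K : ℕ) (tieBreak : Finset (Fin K) → Fin K) (μ₀ δ : ℝ) (I : OneIdent.Instance K),
        1 ≤ K → (∀ s : Finset (Fin K), s.Nonempty → tieBreak s ∈ s) → 0 < δ → δ < 1 →
        (∀ a, I.gapZero μ₀ a ≤ 1) →
          (I ∈ OneIdent.posSet K μ₀ → (2 ≤ K ∨ δ ≤ 1 / 2) →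
            OneIdent.expectedTime (OneIdent.SEE tieBreak μ₀ C δ) I ≤
              ENNReal.ofReal (γ * (Real.log (1 / δ) / I.gap μ₀ ^ 2 +
                Real.log (K / I.gap μ₀ ^ 2) * I.Hpos μ₀))) ∧
          (I ∈ OneIdent.negSet K μ₀ →
            OneIdent.expectedTime (OneIdent.SEE tieBreak μ₀ C δ) I ≤
              ENNReal.ofReal (γ * (I.Hneg μ₀ *
                (Real.log (1 / δ) + Real.log (I.Hneg μ₀)))))) ∧
    ∀ (K : ℕ) (tieBreak : Finset (Fin K) → Fin K) (μ₀ : ℝ),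
      1 ≤ K → (∀ s : Finset (Fin K), s.Nonempty → tieBreak s ∈ s) →
        (∀ δ : ℝ, 0 < δ → δ < 1 →
          OneIdent.IsMeasurableAlg (OneIdent.SEE tieBreak μ₀ C δ)) ∧
        OneIdent.IsGapDeltaPAC μ₀ (OneIdent.SEE tieBreak μ₀ C) := by
  constructor
  · obtain ⟨γ₁, h₁, hpos⟩ := OneIdent.exists_expectedTime_le_Hpos hC
    obtain ⟨γ₂, h₂, hneg⟩ := OneIdent.exists_expectedTime_le_Hneg hC
    refine ⟨max γ₁ γ₂, lt_max_of_lt_left h₁, ?_⟩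
    -- enlarging the constant is harmless even where the bound were negative: `ofReal` cuts it off
    have hmono : ∀ {r s t : ℝ}, 0 < r → r ≤ s →
        ENNReal.ofReal (r * t) ≤ ENNReal.ofReal (s * t) := by
      intro r s t hr hrs
      rw [ENNReal.ofReal_mul hr.le, ENNReal.ofReal_mul (hr.le.trans hrs)]
      gcongr
    intro K tieBreak μ₀ δ I hK htie hδ hδ1 hgap
    exact ⟨fun hI hKδ => (hpos K tieBreak μ₀ δ I hK htie hδ hδ1 hgap hI hKδ).trans
        (hmono h₁ (le_max_left _ _)),
      fun hI => (hneg K tieBreak μ₀ δ I hK htie hδ hδ1 hgap hI).trans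
        (hmono h₂ (le_max_right _ _))⟩
  · intro K tieBreak μ₀ hK htie
    refine ⟨fun δ _ _ => OneIdent.isMeasurableAlg_see tieBreak μ₀ C δ,
      OneIdent.isDeltaPAC_see hK fun δ hδ hδ1 I hI => ?_, fun Δ δ hΔ hδ hδ1 =>
        OneIdent.iSup_expectedTime_lt_top hK htie hC hΔ hδ hδ1⟩
    have hgap : 0 < |I.best - μ₀| := by
      rw [abs_pos, sub_ne_zero]
      rcases hI with hI | hI
      · exact ne_of_gt hI
      · exact ne_of_lt hI
    refine lt_of_le_of_lt (le_iSup₂_of_le I ?_ le_rfl)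
      (OneIdent.iSup_expectedTime_lt_top hK htie hC hgap hδ hδ1)
    rcases hI with hI | hI
    · have h : μ₀ < I.best := hI
      exact .inl (show |I.best - μ₀| ≤ I.best - μ₀ from (abs_of_pos (sub_pos.2 h)).le)
    · have h : I.best < μ₀ := hI
      refine .inr (show |I.best - μ₀| ≤ μ₀ - I.best from ?_)
      rw [abs_sub_comm]
      exact (abs_of_pos (sub_pos.2 h)).le
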